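/- Bosonic cohomology $H^0,H^1,H^2$ of $\sigma_-$ in $AdS_4$. Spinor indices $\alpha,\mu,\nu,\dots$ and $\dot\alpha,\dot\mu,\dots$ take two values, $\epsilon_{12}=\epsilon^{12}=1$ is antisymmetric, and indices are lowered by $A_\alpha=A^\beta\epsilon_{\beta\alpha}$ (likewise for dotted indices). Let $A$ be the commutative $\mathbb C$-algebra of complex functions of the space-time point $x$ (for instance $C^\infty(AdS_4,\mathbb C)$, or $\mathbb C$ if the point is fixed; any commutative $\mathbb C$-algebra is allowed), let $\Omega^1$ be the $A$-module of one-forms, and let the non-degenerate vierbein $h^{\alpha\dot\alpha}$ be an $A$-basis of $\Omega^1$. Consider $p$-forms $\omega(y,\bar y|x)\in\Lambda^p_A\Omega^1\otimes_A A[y^\alpha,\bar y^{\dot\alpha}]$ that are bosonic: only bidegrees $(N,\bar N)$ in $(y,\bar y)$ with $|N-\bar N|$ even occur. Put $\partial_\alpha=\partial/\partial y^\alpha$, $\bar\partial_{\dot\alpha}=\partial/\partial\bar y^{\dot\alpha}$, and let $\sigma_-$ be the $A$-linear operator from $p$-forms to $(p+1)$-forms given by $$\sigma_-\omega=i\,\bar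 y^{\dot\alpha}h^{\alpha}{}_{\dot\alpha}\,\partial_\alpha\omega\ (N>\bar N),\qquad \sigma_-\omega=i\,y^{\alpha}h_{\alpha}{}^{\dot\alpha}\,\bar\partial_{\dot\alpha}\omega\ (N<\bar N),\qquad \sigma_-\omega=0\ (N=\bar N),$$ with the wedge product of forms understood. Then $\sigma_-^2=0$ on bosonic forms. Let $H^p(\sigma_-)$ be the space of $\sigma_-$-closed bosonic $p$-forms modulo the image under $\sigma_-$ of the bosonic $(p-1)$-forms. Call a polynomial $F(y,\bar y|x)$ diagonal if $(y^\alpha\partial_\alpha-\bar y^{\dot\alpha}\bar\partial_{\dot\alpha})F=0$, that is, $N=\bar N$, and put $H^{\mu\nu}=h^\mu{}_{\dot\gamma}\wedge h^{\nu\dot\gamma}$, $\bar H^{\dot\mu\dot\nu}=h_\gamma{}^{\dot\mu}\wedge h^{\gamma\dot\nu}$. In each of the following cases the listed forms are $\sigma_-$-closed and every class in $H^p(\sigma_-)$ is represented by exactly one form in their span. 1. $H^0(\sigma_-)$: the zero-forms $F_{\alpha(n),\dot\alpha(n)}(x)\,y^{\alpha(n)}\bar y^{\dot\alpha(n)}$,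 $n\in\mathbb N_0$, where $F_{\alpha(n),\dot\alpha(n)}$ is totally symmetric in its undotted and in its dotted indices. 2. $H^1(\sigma_-)$: the one-forms $\phi=h^{\mu\dot\mu}\partial_\mu\bar\partial_{\dot\mu}F_1$ and $\phi^{\rm tr}=h_{\mu\dot\mu}y^\mu\bar y^{\dot\mu}F_2$ with arbitrary diagonal $F_1$, $F_2$. The space of all $\phi$ and the space of all $\phi^{\rm tr}$ intersect only in zero. 3. $H^2(\sigma_-)$: the Weyl cocycles $W=H^{\mu\nu}\partial_\mu\partial_\nu C(y,0|x)+\bar H^{\dot\mu\dot\nu}\bar\partial_{\dot\mu}\bar\partial_{\dot\nu}C(0,\bar y|x)$ with an arbitrary bosonic polynomial $C$, and the Fronsdal cocycles $\mathcal E_A=(H^{\mu\nu}\partial_\mu\partial_\nu+\bar H^{\dot\mu\dot\nu}\bar\partial_{\dot\mu}\bar\partial_{\dot\nu})C_A$ and $\mathcal E_B=(H^{\mu\nu}y_\mu y_\nu+\bar H^{\dot\mu\dot\nu}\bar y_{\dot\mu}\bar y_{\dot\nu})C_B$ with arbitrary diagonal $C_A$, $C_B$. The sum of these three spaces of cocycles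 is direct. -/

import Mathlib

open scoped TensorProduct

namespace HigherSpin

noncomputable section

/-! ## Two-component spinor variables

`Sum.inl α` labels the undotted variable `y^α` and `Sum.inr α'` the dotted variable `ȳ^α'`;
the two index values are `0, 1 : Fin 2`. -/

/-- Polynomials in the commuting spinors `y^α`, `ȳ^α'`, with coefficients in the algebra `A` of
functions on space-time. -/
abbrev SpinorPoly (A : Type*) [CommRing A] : Type _ := MvPolynomial (Fin 2 ⊕ Fin 2) A

/-- The antisymmetric bispinor `ε` with `ε₁₂ = ε¹² = 1`. -/
def eps : Matrix (Fin 2) (Fin 2) ℤ := !![0, 1; -1, 0]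

section Polynomials

variable (A : Type*) [CommRing A]

/-- Multiplication by `y^α`. -/
def y (α : Fin 2) : SpinorPoly A →ₗ[A] SpinorPoly A :=
  LinearMap.mulLeft A (MvPolynomial.X (Sum.inl α))

/-- Multiplication by `ȳ^α'`. -/
def yBar (α' : Fin 2) : SpinorPoly A →ₗ[A] SpinorPoly A :=
  LinearMap.mulLeft A (MvPolynomial.X (Sum.inr α'))

/-- Multiplication by `y_α = y^β ε_{βα}`. -/
def yLow (α : Fin 2) : SpinorPoly A →ₗ[A] SpinorPoly A := ∑ β, eps β α • y A β

/-- Multiplication by `ȳ_α' = ȳ^β' ε_{β'α'}`. -/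
def yBarLow (α' : Fin 2) : SpinorPoly A →ₗ[A] SpinorPoly A := ∑ β', eps β' α' • yBar A β'

/-- The derivative `∂_α = ∂/∂y^α`. -/
def dY (α : Fin 2) : SpinorPoly A →ₗ[A] SpinorPoly A :=
  (MvPolynomial.pderiv (R := A) (Sum.inl α : Fin 2 ⊕ Fin 2)).toLinearMap

/-- The derivative `∂̄_α' = ∂/∂ȳ^α'`. -/
def dYBar (α' : Fin 2) : SpinorPoly A →ₗ[A] SpinorPoly A :=
  (MvPolynomial.pderiv (R := A) (Sum.inr α' : Fin 2 ⊕ Fin 2)).toLinearMap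

/-- The degree `N` in `y` of a monomial. -/
def degY (m : Fin 2 ⊕ Fin 2 →₀ ℕ) : ℕ := ∑ α, m (Sum.inl α)

/-- The degree `N̄` in `ȳ` of a monomial. -/
def degYBar (m : Fin 2 ⊕ Fin 2 →₀ ℕ) : ℕ := ∑ α', m (Sum.inr α')

open Classical in
/-- The projection of a polynomial onto its part with bidegrees `(N, N̄)` satisfying `P`. -/
def bidegProj (P : ℕ → ℕ → Prop) : SpinorPoly A →ₗ[A] SpinorPoly A :=
  (MvPolynomial.basisMonomials (Fin 2 ⊕ Fin 2) A).constr A fun m =>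
    if P (degY m) (degYBar m) then MvPolynomial.monomial m 1 else 0

/-- The grading `G = |N - N̄|`. -/
def grading (N Nb : ℕ) : ℕ := ((N : ℤ) - (Nb : ℤ)).natAbs

/-- The projection onto the bosonic sector: `G` is even. -/
def bosonicProj : SpinorPoly A →ₗ[A] SpinorPoly A :=
  bidegProj A fun N Nb => Even (grading N Nb)

/-- The bosonic polynomials: those with even grading `G`. -/
def bosonicPoly : Submodule A (SpinorPoly A) := LinearMap.range (bosonicProj A)

/-- The diagonal polynomials: `(y^α ∂_α - ȳ^α' ∂̄_α') F = 0`. -/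
def diagonalPoly : Submodule A (SpinorPoly A) :=
  LinearMap.ker ((∑ α, y A α ∘ₗ dY A α) - ∑ α', yBar A α' ∘ₗ dYBar A α')

/-- The substitution `C(y, ȳ) ↦ C(y, 0)`. -/
def holomorphicPart : SpinorPoly A →ₗ[A] SpinorPoly A :=
  (MvPolynomial.aeval (R := A) (S₁ := SpinorPoly A)
    (Sum.elim (fun α => MvPolynomial.X (Sum.inl α)) (fun _ => 0))).toLinearMap

/-- The substitution `C(y, ȳ) ↦ C(0, ȳ)`. -/
def antiholomorphicPart : SpinorPoly A →ₗ[A] SpinorPoly A :=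
  (MvPolynomial.aeval (R := A) (S₁ := SpinorPoly A)
    (Sum.elim (fun _ => 0) (fun α' => MvPolynomial.X (Sum.inr α')))).toLinearMap

variable {A}

/-- A multispinor `F_{α₁…αₙ, α'₁…α'ₘ}` that is totally symmetric in its undotted indices and
totally symmetric in its dotted indices. -/
def IsSymmMultispinor {n m : ℕ} (F : (Fin n → Fin 2) → (Fin m → Fin 2) → A) : Prop :=
  ∀ (π : Equiv.Perm (Fin n)) (τ : Equiv.Perm (Fin m)) a b, F (a ∘ π) (b ∘ τ) = F a b

/-- The generating polynomial `F_{α(n), α'(m)} y^{α(n)} ȳ^{α'(m)}` of a multispinor. -/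
def multispinorPoly {n m : ℕ} (F : (Fin n → Fin 2) → (Fin m → Fin 2) → A) : SpinorPoly A :=
  ∑ a, ∑ b, MvPolynomial.C (F a b) *
    ((∏ i, MvPolynomial.X (Sum.inl (a i))) * ∏ j, MvPolynomial.X (Sum.inr (b j)))

end Polynomials

/-! ## Vierbein, forms and the operator `σ₋`

`A` is the algebra of complex functions on space-time, `L` the `A`-module of one-forms, and the
non-degenerate vierbein is a basis `h` of `L`, with `h (α, α') = h^{αα'}`. -/

section Forms

variable {A : Type*} [CommRing A] [Algebra ℂ A] {L : Type*} [AddCommGroup L] [Module A L]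

/-- Differential forms of all degrees valued in polynomials in `y`, `ȳ`. -/
abbrev SpinorForm (A : Type*) [CommRing A] (L : Type*) [AddCommGroup L] [Module A L] : Type _ :=
  ExteriorAlgebra A L ⊗[A] SpinorPoly A

/-- The one-form `h^{αα'}`. -/
def hUU (h : Module.Basis (Fin 2 × Fin 2) A L) (α α' : Fin 2) : ExteriorAlgebra A L :=
  ExteriorAlgebra.ι A (h (α, α'))

/-- The one-form `h^α_α' = h^{αβ'} ε_{β'α'}`. -/
def hUD (h : Module.Basis (Fin 2 × Fin 2) A L) (α α' : Fin 2) : ExteriorAlgebra A L :=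
  ∑ β', eps β' α' • hUU h α β'

/-- The one-form `h_α^α' = h^{βα'} ε_{βα}`. -/
def hDU (h : Module.Basis (Fin 2 × Fin 2) A L) (α α' : Fin 2) : ExteriorAlgebra A L :=
  ∑ β, eps β α • hUU h β α'

/-- The one-form `h_{αα'} = h^{ββ'} ε_{βα} ε_{β'α'}`. -/
def hDD (h : Module.Basis (Fin 2 × Fin 2) A L) (α α' : Fin 2) : ExteriorAlgebra A L :=
  ∑ β, ∑ β', (eps β α * eps β' α') • hUU h β β'

/-- The two-form `H^{μν} = h^μ_γ' ∧ h^{νγ'}`. -/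
def H2 (h : Module.Basis (Fin 2 × Fin 2) A L) (μ ν : Fin 2) : ExteriorAlgebra A L :=
  ∑ γ', hUD h μ γ' * hUU h ν γ'

/-- The two-form `H̄^{μ'ν'} = h_γ^μ' ∧ h^{γν'}`. -/
def H2Bar (h : Module.Basis (Fin 2 × Fin 2) A L) (μ' ν' : Fin 2) : ExteriorAlgebra A L :=
  ∑ γ, hDU h γ μ' * hUU h γ ν'

/-- The operator `ω ↦ θ ∧ T ω`, where `T` acts on the spinor variables. -/
def wedgeOp (θ : ExteriorAlgebra A L) (T : SpinorPoly A →ₗ[A] SpinorPoly A) :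
    SpinorForm A L →ₗ[A] SpinorForm A L :=
  TensorProduct.map (LinearMap.mulLeft A θ) T

/-- The map `F ↦ θ T F` from polynomial-valued functions to polynomial-valued forms. -/
def formOp (θ : ExteriorAlgebra A L) (T : SpinorPoly A →ₗ[A] SpinorPoly A) :
    SpinorPoly A →ₗ[A] SpinorForm A L :=
  TensorProduct.mk A (ExteriorAlgebra A L) (SpinorPoly A) θ ∘ₗ T

/-- The operator `σ₋`: it is `i ȳ^α' h^α_α' ∂_α` on the components with `N > N̄`,
`i y^α h_α^α' ∂̄_α'` on those with `N < N̄`, and zero on those with `N = N̄`. -/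
def sigmaMinus (h : Module.Basis (Fin 2 × Fin 2) A L) : SpinorForm A L →ₗ[A] SpinorForm A L :=
  algebraMap ℂ A Complex.I •
    ∑ α, ∑ α',
      (wedgeOp (hUD h α α') (yBar A α' ∘ₗ dY A α ∘ₗ bidegProj A fun N Nb => N > Nb) +
        wedgeOp (hDU h α α') (y A α ∘ₗ dYBar A α' ∘ₗ bidegProj A fun N Nb => N < Nb))

variable (A L) in
/-- The bosonic `p`-forms valued in polynomials in `y`, `ȳ`. -/
def bosonicForms (p : ℕ) : Submodule A (SpinorForm A L) :=
  LinearMap.range (TensorProduct.map (⋀[A]^p L).subtype (bosonicProj A))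

/-- The `σ₋`-closed bosonic `p`-forms. -/
def cocycles (h : Module.Basis (Fin 2 × Fin 2) A L) (p : ℕ) : Submodule A (SpinorForm A L) :=
  bosonicForms A L p ⊓ LinearMap.ker (sigmaMinus h)

/-- The `σ₋`-exact bosonic `p`-forms. -/
def coboundaries (h : Module.Basis (Fin 2 × Fin 2) A L) : ℕ → Submodule A (SpinorForm A L)
  | 0 => ⊥
  | p + 1 => (bosonicForms A L p).map (sigmaMinus h)

/-- The bosonic cohomology `H^p(σ₋)`: the space of classes of `σ₋`-closed bosonic `p`-forms modulo
`σ₋`-exact ones, that is, the image of the cocycles in the quotient by the coboundaries. -/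
def cohomology (h : Module.Basis (Fin 2 × Fin 2) A L) (p : ℕ) :
    Submodule A (SpinorForm A L ⧸ coboundaries h p) :=
  (cocycles h p).map (coboundaries h p).mkQ

/-- The forms in `R` are `σ₋`-closed bosonic `p`-forms, and every class in `H^p(σ₋)` is
represented by exactly one of them. -/
def Represents (h : Module.Basis (Fin 2 × Fin 2) A L) (p : ℕ)
    (R : Submodule A (SpinorForm A L)) : Prop :=
  R ≤ cocycles h p ∧
    Set.BijOn (coboundaries h p).mkQ (R : Set (SpinorForm A L))
      (cohomology h p : Set (SpinorForm A L ⧸ coboundaries h p))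

/-! ## The representatives -/

variable (A L) in
/-- The span of the zero-forms `F_{α(n), α'(n)} y^{α(n)} ȳ^{α'(n)}`, `n = 0, 1, 2, …`. -/
def diagonalMultispinors : Submodule A (SpinorForm A L) :=
  Submodule.span A {ω | ∃ (n : ℕ) (F : (Fin n → Fin 2) → (Fin n → Fin 2) → A),
    IsSymmMultispinor F ∧ ω = (1 : ExteriorAlgebra A L) ⊗ₜ[A] multispinorPoly F}

/-- `φ = h^{μμ'} ∂_μ ∂̄_μ' F`. -/
def phi (h : Module.Basis (Fin 2 × Fin 2) A L) : SpinorPoly A →ₗ[A] SpinorForm A L :=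
  ∑ μ, ∑ μ', formOp (hUU h μ μ') (dY A μ ∘ₗ dYBar A μ')

/-- `φ^tr = h_{μμ'} y^μ ȳ^μ' F`. -/
def phiTr (h : Module.Basis (Fin 2 × Fin 2) A L) : SpinorPoly A →ₗ[A] SpinorForm A L :=
  ∑ μ, ∑ μ', formOp (hDD h μ μ') (y A μ ∘ₗ yBar A μ')

/-- The Weyl cocycle `W = H^{μν} ∂_μ ∂_ν C(y, 0) + H̄^{μ'ν'} ∂̄_μ' ∂̄_ν' C(0, ȳ)`. -/
def weyl (h : Module.Basis (Fin 2 × Fin 2) A L) : SpinorPoly A →ₗ[A] SpinorForm A L :=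
  ∑ μ, ∑ ν, (formOp (H2 h μ ν) (dY A μ ∘ₗ dY A ν ∘ₗ holomorphicPart A) +
    formOp (H2Bar h μ ν) (dYBar A μ ∘ₗ dYBar A ν ∘ₗ antiholomorphicPart A))

/-- The Fronsdal cocycle `E_A = (H^{μν} ∂_μ ∂_ν + H̄^{μ'ν'} ∂̄_μ' ∂̄_ν') C`. -/
def fronsdalA (h : Module.Basis (Fin 2 × Fin 2) A L) : SpinorPoly A →ₗ[A] SpinorForm A L :=
  ∑ μ, ∑ ν, (formOp (H2 h μ ν) (dY A μ ∘ₗ dY A ν) +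
    formOp (H2Bar h μ ν) (dYBar A μ ∘ₗ dYBar A ν))

/-- The Fronsdal cocycle `E_B = (H^{μν} y_μ y_ν + H̄^{μ'ν'} ȳ_μ' ȳ_ν') C`. -/
def fronsdalB (h : Module.Basis (Fin 2 × Fin 2) A L) : SpinorPoly A →ₗ[A] SpinorForm A L :=
  ∑ μ, ∑ ν, (formOp (H2 h μ ν) (yLow A μ ∘ₗ yLow A ν) +
    formOp (H2Bar h μ ν) (yBarLow A μ ∘ₗ yBarLow A ν))

end Forms

end

end HigherSpin

/-! ### Clebsch–Gordan calculus for two commuting pairs of spinor variables -/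

namespace HigherSpin

/-! Write `z` for `ȳ`. Above the diagonal `N = N̄` the operator `σ₋` shifts the bidegree by `(-1,
1)`, below it by `(1, -1)`, and it commutes with `sl₂ ⊕ sl₂` acting on undotted and dotted indices.
A one-form or three-form has a bispinor of coefficients, and a two-form has a pair of symmetric
tensors `U`, `V` (the coefficients of `H`, `H̄`). In a fixed bidegree these split into irreducible
parts, obtained by contracting with `y` or taking the antisymmetrised derivative: `covector_decomp`
does it for one index and `symm_decomp` for two. On these parts `σ₋` acts by explicit numbers, and
the theorem reduces to knowing which of them vanish.

`H⁰`: contraction shows that `σ₋` has no kernel off the diagonal (`mem_diagonal_of_sigmaCoef`).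

`H¹`: off the diagonal, closedness removes all parts but `z_j ∂_i g`, which is exact
(`gradient_of_closed`). The bidegrees `(n+1, n-1)` and `(n-1, n+1)` have the same target `(n, n)`,
but their images cannot cancel unless each vanishes (`eq_zero_of_symUV_eq_zero`). On the diagonal
every one-form is closed. Of its four parts two are exact, coming from either side, and the other
two are `φ` and `φ^tr` (`one_form_decomp`).

`H²`: in bidegree `(a, b)` with `a > b`, closedness kills two of the six parts and ties two others
together (`closed_parts`). What remains is exact for `b > 0` (`exists_eq_sym`). For `b = 0` there is
no one-form to start from, and a Weyl cocycle is left (`exists_eq_dy_dy`). Diagonal two-forms are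
exact (`exists_eq_sym_diagonal`), except in bidegree `(0, 0)`, where they are Weyl cocycles. The
pair `(n+1, n-1)`, `(n-1, n+1)` again has a common target, and this time images do cancel: two
further parts are allowed, and they are the Fronsdal cocycles. Once these are subtracted, both sides
are closed separately (`exists_fronsdal`).

Uniqueness: a double curl or a double contraction vanishes on exact forms in the relevant bidegrees
and is a nonzero multiple of `C_B` or `C_A` on the Fronsdal cocycles. Weyl cocycles live in
bidegrees which no bosonic one-form can reach (`weyl_add_fronsdal_exact`). -/

/-- Commuting operators `y`, `z` and derivatives `dy`, `dz`, two of each kind, on a vector space,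
subject to the canonical commutation relations. -/
structure WeylOps (k M : Type*) [Field k] [AddCommGroup M] [Module k M] where
  y : Fin 2 → M →ₗ[k] M
  z : Fin 2 → M →ₗ[k] M
  dy : Fin 2 → M →ₗ[k] M
  dz : Fin 2 → M →ₗ[k] M
  y_y : ∀ i j m, y i (y j m) = y j (y i m)
  z_z : ∀ i j m, z i (z j m) = z j (z i m)
  z_y : ∀ i j m, z i (y j m) = y j (z i m)
  dy_y : ∀ i j m, dy i (y j m) = (if i = j then m else 0) + y j (dy i m)
  dz_z : ∀ i j m, dz i (z j m) = (if i = j then m else 0) + z j (dz i m)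
  dy_z : ∀ i j m, dy i (z j m) = z j (dy i m)
  dz_y : ∀ i j m, dz i (y j m) = y j (dz i m)
  dy_dy : ∀ i j m, dy i (dy j m) = dy j (dy i m)
  dz_dz : ∀ i j m, dz i (dz j m) = dz j (dz i m)
  dz_dy : ∀ i j m, dz i (dy j m) = dy j (dz i m)

namespace WeylOps

variable {k M : Type*} [Field k] [AddCommGroup M] [Module k M] (W : WeylOps k M)

/-- Exchange of the two kinds of variables. -/
@[simps] def swap : WeylOps k M where
  y := W.z
  z := W.y
  dy := W.dz
  dz := W.dy
  y_y := W.z_z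
  z_z := W.y_y
  z_y i j m := (W.z_y j i m).symm
  dy_y := W.dz_z
  dz_z := W.dy_y
  dy_z := W.dz_y
  dz_y := W.dy_z
  dy_dy := W.dz_dz
  dz_dz := W.dy_dy
  dz_dy i j m := (W.dz_dy j i m).symm

/-- The variables `y` with their index lowered. -/
def yt (i : Fin 2) : M →ₗ[k] M := if i = 0 then W.y 1 else -W.y 0

/-- The variables `z` with their index lowered. -/
def zt (i : Fin 2) : M →ₗ[k] M := W.swap.yt i

/-- The contraction `y^α φ_α`. -/
def yDot (φ : Fin 2 → M) : M := W.y 0 (φ 0) + W.y 1 (φ 1)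

/-- The contraction `z^α φ_α`. -/
def zDot (φ : Fin 2 → M) : M := W.swap.yDot φ

/-- The antisymmetrized derivative of `φ` along `y`. -/
def yCurl (φ : Fin 2 → M) : M := W.dy 0 (φ 1) - W.dy 1 (φ 0)

/-- The antisymmetrized derivative of `φ` along `z`. -/
def zCurl (φ : Fin 2 → M) : M := W.swap.yCurl φ

/-- Homogeneity of degree `a` in `y`. -/
def HomY (a : k) (m : M) : Prop := W.y 0 (W.dy 0 m) + W.y 1 (W.dy 1 m) = a • m

/-- Homogeneity of degree `b` in `z`. -/
def HomZ (b : k) (m : M) : Prop := W.swap.HomY b m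

lemma yt_zero : W.yt 0 = W.y 1 := rfl
lemma yt_one : W.yt 1 = -W.y 0 := rfl
lemma zt_zero : W.zt 0 = W.z 1 := rfl
lemma zt_one : W.zt 1 = -W.z 0 := rfl
lemma zDot_def (φ : Fin 2 → M) : W.zDot φ = W.z 0 (φ 0) + W.z 1 (φ 1) := rfl
lemma zCurl_def (φ : Fin 2 → M) : W.zCurl φ = W.dz 0 (φ 1) - W.dz 1 (φ 0) := rfl
lemma homZ_def (b : k) (m : M) :
    W.HomZ b m ↔ W.z 0 (W.dz 0 m) + W.z 1 (W.dz 1 m) = b • m := Iff.rfl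

@[simp] lemma swap_yt : W.swap.yt = W.zt := rfl
@[simp] lemma swap_zt : W.swap.zt = W.yt := rfl
@[simp] lemma swap_yDot : W.swap.yDot = W.zDot := rfl
@[simp] lemma swap_zDot : W.swap.zDot = W.yDot := rfl
@[simp] lemma swap_yCurl : W.swap.yCurl = W.zCurl := rfl

lemma y10 (m : M) : W.y 1 (W.y 0 m) = W.y 0 (W.y 1 m) := W.y_y _ _ _
lemma dy10 (m : M) : W.dy 1 (W.dy 0 m) = W.dy 0 (W.dy 1 m) := W.dy_dy _ _ _
lemma dy_y00 (m : M) : W.dy 0 (W.y 0 m) = m + W.y 0 (W.dy 0 m) := by simp [W.dy_y]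
lemma dy_y11 (m : M) : W.dy 1 (W.y 1 m) = m + W.y 1 (W.dy 1 m) := by simp [W.dy_y]
lemma dy_y01 (m : M) : W.dy 0 (W.y 1 m) = W.y 1 (W.dy 0 m) := by simp [W.dy_y]
lemma dy_y10 (m : M) : W.dy 1 (W.y 0 m) = W.y 0 (W.dy 1 m) := by simp [W.dy_y]

variable {W}

lemma HomY.add {a : k} {m n : M} (hm : W.HomY a m) (hn : W.HomY a n) : W.HomY a (m + n) := by
  simp only [HomY, map_add, smul_add] at *
  rw [← hm, ← hn]; abel

lemma HomY.smul {a : k} {m : M} (c : k) (hm : W.HomY a m) : W.HomY a (c • m) := by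
  simp only [HomY, map_smul] at *
  rw [← smul_add, hm, smul_comm]

lemma HomY.neg {a : k} {m : M} (hm : W.HomY a m) : W.HomY a (-m) := by
  simpa using hm.smul (-1)

lemma HomY.sub {a : k} {m n : M} (hm : W.HomY a m) (hn : W.HomY a n) : W.HomY a (m - n) := by
  rw [sub_eq_add_neg]; exact hm.add hn.neg

lemma HomY.y {a : k} {m : M} (hm : W.HomY a m) (i : Fin 2) : W.HomY (a + 1) (W.y i m) := by
  have h := congrArg (W.y i) hm
  fin_cases i <;> simp only [Fin.zero_eta, Fin.mk_one, HomY, map_add, map_smul, y10, dy_y00,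
    dy_y01, dy_y10, dy_y11] at h ⊢ <;>
  linear_combination (norm := module) h

lemma HomY.dy {a : k} {m : M} (hm : W.HomY a m) (i : Fin 2) : W.HomY (a - 1) (W.dy i m) := by
  have h := congrArg (W.dy i) hm
  fin_cases i <;> simp only [Fin.zero_eta, Fin.mk_one, HomY, map_add, map_smul, dy10, dy_y00,
    dy_y01, dy_y10, dy_y11] at h ⊢ <;>
  linear_combination (norm := module) h

lemma HomY.z {a : k} {m : M} (hm : W.HomY a m) (i : Fin 2) : W.HomY a (W.z i m) := by
  have h := congrArg (W.z i) hm
  simpa only [HomY, map_add, map_smul, W.z_y, W.dy_z] using h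

lemma HomY.dz {a : k} {m : M} (hm : W.HomY a m) (i : Fin 2) : W.HomY a (W.dz i m) := by
  have h := congrArg (W.dz i) hm
  simpa only [HomY, map_add, map_smul, W.dz_y, W.dz_dy] using h

lemma HomY.yt {a : k} {m : M} (hm : W.HomY a m) (i : Fin 2) : W.HomY (a + 1) (W.yt i m) := by
  fin_cases i
  · exact hm.y 1
  · exact (hm.y 0).neg

lemma HomY.zt {a : k} {m : M} (hm : W.HomY a m) (i : Fin 2) : W.HomY a (W.zt i m) := by
  fin_cases i
  · exact hm.z 1
  · exact (hm.z 0).neg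

lemma HomY.yDot {a : k} {φ : Fin 2 → M} (h : ∀ i, W.HomY a (φ i)) : W.HomY (a + 1) (W.yDot φ) :=
  ((h 0).y 0).add ((h 1).y 1)

lemma HomY.yCurl {a : k} {φ : Fin 2 → M} (h : ∀ i, W.HomY a (φ i)) :
    W.HomY (a - 1) (W.yCurl φ) :=
  ((h 1).dy 0).sub ((h 0).dy 1)

variable (W)

/-- Homogeneity of degree `a` in `y` and `b` in `z`. -/
def Hom (a b : k) (m : M) : Prop := W.HomY a m ∧ W.HomZ b m

variable {W}

lemma Hom.swap {a b : k} {m : M} (h : W.Hom a b m) : W.swap.Hom b a m := ⟨h.2, h.1⟩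

lemma Hom.add {a b : k} {m n : M} (hm : W.Hom a b m) (hn : W.Hom a b n) : W.Hom a b (m + n) :=
  ⟨hm.1.add hn.1, HomY.add (W := W.swap) hm.2 hn.2⟩
lemma Hom.smul {a b : k} {m : M} (c : k) (hm : W.Hom a b m) : W.Hom a b (c • m) :=
  ⟨hm.1.smul c, HomY.smul (W := W.swap) c hm.2⟩
lemma Hom.sub {a b : k} {m n : M} (hm : W.Hom a b m) (hn : W.Hom a b n) : W.Hom a b (m - n) :=
  ⟨hm.1.sub hn.1, HomY.sub (W := W.swap) hm.2 hn.2⟩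
lemma Hom.y {a b : k} {m : M} (hm : W.Hom a b m) (i : Fin 2) : W.Hom (a + 1) b (W.y i m) :=
  ⟨hm.1.y i, HomY.z (W := W.swap) hm.2 i⟩
lemma Hom.dy {a b : k} {m : M} (hm : W.Hom a b m) (i : Fin 2) : W.Hom (a - 1) b (W.dy i m) :=
  ⟨hm.1.dy i, HomY.dz (W := W.swap) hm.2 i⟩
lemma Hom.yt {a b : k} {m : M} (hm : W.Hom a b m) (i : Fin 2) : W.Hom (a + 1) b (W.yt i m) :=
  ⟨hm.1.yt i, HomY.zt (W := W.swap) hm.2 i⟩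
lemma Hom.z {a b : k} {m : M} (hm : W.Hom a b m) (i : Fin 2) : W.Hom a (b + 1) (W.z i m) :=
  ⟨hm.1.z i, HomY.y (W := W.swap) hm.2 i⟩
lemma Hom.dz {a b : k} {m : M} (hm : W.Hom a b m) (i : Fin 2) : W.Hom a (b - 1) (W.dz i m) :=
  ⟨hm.1.dz i, HomY.dy (W := W.swap) hm.2 i⟩
lemma Hom.zt {a b : k} {m : M} (hm : W.Hom a b m) (i : Fin 2) : W.Hom a (b + 1) (W.zt i m) :=
  ⟨hm.1.zt i, HomY.yt (W := W.swap) hm.2 i⟩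
lemma Hom.yDot {a b : k} {φ : Fin 2 → M} (h : ∀ i, W.Hom a b (φ i)) :
    W.Hom (a + 1) b (W.yDot φ) := ((h 0).y 0).add ((h 1).y 1)
lemma Hom.zDot {a b : k} {φ : Fin 2 → M} (h : ∀ i, W.Hom a b (φ i)) :
    W.Hom a (b + 1) (W.zDot φ) := ((h 0).z 0).add ((h 1).z 1)
lemma Hom.yCurl {a b : k} {φ : Fin 2 → M} (h : ∀ i, W.Hom a b (φ i)) :
    W.Hom (a - 1) b (W.yCurl φ) := ((h 1).dy 0).sub ((h 0).dy 1)
lemma Hom.zCurl {a b : k} {φ : Fin 2 → M} (h : ∀ i, W.Hom a b (φ i)) :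
    W.Hom a (b - 1) (W.zCurl φ) := ((h 1).dz 0).sub ((h 0).dz 1)

lemma Hom.congr {a b a' b' : k} {m : M} (h : W.Hom a b m) (ha : a = a') (hb : b = b') :
    W.Hom a' b' m := by subst ha hb; exact h

variable (W)

/-! ### Contractions -/

lemma yDot_yt (m : M) : W.yDot (fun i => W.yt i m) = 0 := by
  simp [yDot, yt_zero, yt_one, y10]

lemma yCurl_dy (m : M) : W.yCurl (fun i => W.dy i m) = 0 := by
  simp [yCurl, dy10]

variable {W} in
lemma HomY.yDot_dy {a : k} {m : M} (h : W.HomY a m) : W.yDot (fun i => W.dy i m) = a • m := h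

variable {W} in
-- The Euler operator contributes `a` and the two commutators contribute `2`. Hence `m` can be
-- recovered from all `y_i m` as soon as `a + 2 ≠ 0`, which is how factors `yt` and `zt` are
-- cancelled later.
lemma HomY.yCurl_yt {a : k} {m : M} (h : W.HomY a m) :
    W.yCurl (fun i => W.yt i m) = -(a + 2) • m := by
  rw [HomY] at h
  simp only [WeylOps.yCurl, yt_zero, yt_one, LinearMap.neg_apply, map_neg, dy_y00, dy_y11]
  linear_combination (norm := module) -h

lemma yDot_add (φ ψ : Fin 2 → M) : W.yDot (fun i => φ i + ψ i) = W.yDot φ + W.yDot ψ := by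
  simp only [yDot, map_add]; abel
lemma yDot_sub (φ ψ : Fin 2 → M) : W.yDot (fun i => φ i - ψ i) = W.yDot φ - W.yDot ψ := by
  simp only [yDot, map_sub]; abel
lemma yDot_smul (c : k) (φ : Fin 2 → M) : W.yDot (fun i => c • φ i) = c • W.yDot φ := by
  simp only [yDot, map_smul, smul_add]
lemma yCurl_add (φ ψ : Fin 2 → M) : W.yCurl (fun i => φ i + ψ i) = W.yCurl φ + W.yCurl ψ := by
  simp only [yCurl, map_add]; abel
lemma yCurl_sub (φ ψ : Fin 2 → M) : W.yCurl (fun i => φ i - ψ i) = W.yCurl φ - W.yCurl ψ := by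
  simp only [yCurl, map_sub]; abel
lemma yCurl_smul (c : k) (φ : Fin 2 → M) : W.yCurl (fun i => c • φ i) = c • W.yCurl φ := by
  simp only [yCurl, map_smul, smul_sub]
@[simp] lemma yDot_zero : W.yDot (fun _ => 0) = 0 := by simp [yDot]
@[simp] lemma yCurl_zero : W.yCurl (fun _ => 0) = 0 := by simp [yCurl]

lemma zDot_add (φ ψ : Fin 2 → M) : W.zDot (fun i => φ i + ψ i) = W.zDot φ + W.zDot ψ :=
  W.swap.yDot_add φ ψ
lemma zDot_sub (φ ψ : Fin 2 → M) : W.zDot (fun i => φ i - ψ i) = W.zDot φ - W.zDot ψ :=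
  W.swap.yDot_sub φ ψ
lemma zDot_smul (c : k) (φ : Fin 2 → M) : W.zDot (fun i => c • φ i) = c • W.zDot φ :=
  W.swap.yDot_smul c φ
lemma zCurl_add (φ ψ : Fin 2 → M) : W.zCurl (fun i => φ i + ψ i) = W.zCurl φ + W.zCurl ψ :=
  W.swap.yCurl_add φ ψ
lemma zCurl_sub (φ ψ : Fin 2 → M) : W.zCurl (fun i => φ i - ψ i) = W.zCurl φ - W.zCurl ψ :=
  W.swap.yCurl_sub φ ψ
@[simp] lemma zDot_zero : W.zDot (fun _ => 0) = 0 := W.swap.yDot_zero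
@[simp] lemma zCurl_zero : W.zCurl (fun _ => 0) = 0 := W.swap.yCurl_zero

/-- Every covector valued polynomial is a gradient plus a multiple of `y`. -/
lemma covector_decomp {a : k} {φ : Fin 2 → M} (h : ∀ i, W.HomY a (φ i)) (i : Fin 2) :
    (a + 1) • φ i = W.dy i (W.yDot φ) - W.yt i (W.yCurl φ) := by
  have h0 := h 0
  have h1 := h 1
  simp only [HomY] at h0 h1
  -- After normal ordering the terms with the other component of `φ` cancel, and `φ i` plus its
  -- Euler operator remains.
  fin_cases i <;> simp only [Fin.zero_eta, Fin.mk_one, yDot, yCurl, yt_zero, yt_one, map_add,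
    map_sub, LinearMap.neg_apply, dy_y00, dy_y01, dy_y10, dy_y11]
  · linear_combination (norm := module) -h0
  · linear_combination (norm := module) -h1

lemma yDot_dy_comm (φ : Fin 2 → M) (i : Fin 2) :
    W.yDot (fun j => W.dy i (φ j)) = W.dy i (W.yDot φ) - φ i := by
  fin_cases i <;> simp [yDot, dy_y00, dy_y01, dy_y10, dy_y11] <;> abel

lemma yCurl_yt_comm (φ : Fin 2 → M) (i : Fin 2) :
    W.yCurl (fun j => W.yt i (φ j)) = W.yt i (W.yCurl φ) - φ i := by
  fin_cases i <;> simp [yCurl, yt_zero, yt_one, dy_y00, dy_y01, dy_y10, dy_y11] <;> abel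

lemma yDot_yt_comm (φ : Fin 2 → M) (i : Fin 2) :
    W.yDot (fun j => W.yt i (φ j)) = W.yt i (W.yDot φ) := by
  fin_cases i <;> simp [yDot, yt_zero, yt_one, y10]; abel

lemma yCurl_dy_comm (φ : Fin 2 → M) (i : Fin 2) :
    W.yCurl (fun j => W.dy i (φ j)) = W.dy i (W.yCurl φ) := by
  fin_cases i <;> simp [yCurl, dy10]

lemma yDot_zt_comm (φ : Fin 2 → M) (i : Fin 2) :
    W.yDot (fun j => W.zt i (φ j)) = W.zt i (W.yDot φ) := by
  fin_cases i <;> simp [yDot, zt_zero, zt_one, W.z_y]; abel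
lemma yDot_dz_comm (φ : Fin 2 → M) (i : Fin 2) :
    W.yDot (fun j => W.dz i (φ j)) = W.dz i (W.yDot φ) := by simp [yDot, W.dz_y]
lemma yCurl_zt_comm (φ : Fin 2 → M) (i : Fin 2) :
    W.yCurl (fun j => W.zt i (φ j)) = W.zt i (W.yCurl φ) := by
  fin_cases i <;> simp [yCurl, zt_zero, zt_one, W.dy_z]; abel
lemma yCurl_dz_comm (φ : Fin 2 → M) (i : Fin 2) :
    W.yCurl (fun j => W.dz i (φ j)) = W.dz i (W.yCurl φ) := by simp [yCurl, W.dz_dy]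
lemma yCurl_zDot (f : Fin 2 → Fin 2 → M) :
    W.yCurl (fun i => W.zDot (f i)) = W.zDot (fun j => W.yCurl (fun i => f i j)) := by
  simp [yCurl, zDot_def, W.dy_z]; abel
lemma yCurl_zCurl (f : Fin 2 → Fin 2 → M) :
    W.yCurl (fun i => W.zCurl (f i)) = W.zCurl (fun j => W.yCurl (fun i => f i j)) := by
  simp [yCurl, zCurl_def, W.dz_dy]; abel
lemma yDot_zCurl (f : Fin 2 → Fin 2 → M) :
    W.yDot (fun i => W.zCurl (f i)) = W.zCurl (fun j => W.yDot (fun i => f i j)) := by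
  simp [yDot, zCurl_def, W.dz_y]; abel
lemma yt_zt (i j : Fin 2) (m : M) : W.zt i (W.yt j m) = W.yt j (W.zt i m) := by
  fin_cases i <;> fin_cases j <;> simp [yt_zero, yt_one, zt_zero, zt_one, W.z_y]
lemma dy_zt (i j : Fin 2) (m : M) : W.dy i (W.zt j m) = W.zt j (W.dy i m) := by
  fin_cases j <;> simp [zt_zero, zt_one, W.dy_z]
lemma dz_yt (i j : Fin 2) (m : M) : W.dz i (W.yt j m) = W.yt j (W.dz i m) := by
  fin_cases j <;> simp [yt_zero, yt_one, W.dz_y]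
lemma zDot_zt (m : M) : W.zDot (fun i => W.zt i m) = 0 := W.swap.yDot_yt m
lemma zCurl_dz (m : M) : W.zCurl (fun i => W.dz i m) = 0 := W.swap.yCurl_dy m

end WeylOps

namespace WeylOps

variable {k M : Type*} [Field k] [AddCommGroup M] [Module k M] (W : WeylOps k M)

/-! ### Symmetrized derivatives and products -/

variable {W} in
lemma yDot_symDy {a : k} {F : Fin 2 → M} (h : ∀ i, W.HomY a (F i)) (γ : Fin 2) :
    W.yDot (fun α => W.dy α (F γ) + W.dy γ (F α)) = (a - 1) • F γ + W.dy γ (W.yDot F) := by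
  rw [yDot_add, (h γ).yDot_dy, yDot_dy_comm]
  module

lemma yDot_symYt (G : Fin 2 → M) (γ : Fin 2) :
    W.yDot (fun α => W.yt α (G γ) + W.yt γ (G α)) = W.yt γ (W.yDot G) := by
  rw [yDot_add, yDot_yt, yDot_yt_comm, zero_add]

lemma yCurl_symDy (F : Fin 2 → M) (γ : Fin 2) :
    W.yCurl (fun α => W.dy α (F γ) + W.dy γ (F α)) = W.dy γ (W.yCurl F) := by
  rw [yCurl_add, yCurl_dy, yCurl_dy_comm, zero_add]

variable {W} in
lemma yCurl_symYt {a : k} {G : Fin 2 → M} (h : ∀ i, W.HomY a (G i)) (γ : Fin 2) :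
    W.yCurl (fun α => W.yt α (G γ) + W.yt γ (G α)) = -(a + 3) • G γ + W.yt γ (W.yCurl G) := by
  rw [yCurl_add, (h γ).yCurl_yt, yCurl_yt_comm]
  module

variable {W} in
lemma yDot_yDot_symDy {a : k} {F : Fin 2 → M} (h : ∀ i, W.HomY a (F i)) :
    W.yDot (fun γ => W.yDot (fun α => W.dy α (F γ) + W.dy γ (F α))) = (2 * a) • W.yDot F := by
  simp only [yDot_symDy h]
  rw [yDot_add, yDot_smul, (HomY.yDot h).yDot_dy]
  module

lemma yDot_yDot_symYt (G : Fin 2 → M) :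
    W.yDot (fun γ => W.yDot (fun α => W.yt α (G γ) + W.yt γ (G α))) = 0 := by
  simp only [yDot_symYt, yDot_yt]

lemma yCurl_yCurl_symDy (F : Fin 2 → M) :
    W.yCurl (fun γ => W.yCurl (fun α => W.dy α (F γ) + W.dy γ (F α))) = 0 := by
  simp only [yCurl_symDy, yCurl_dy]

variable {W} in
lemma yCurl_yCurl_symYt {a : k} {G : Fin 2 → M} (h : ∀ i, W.HomY a (G i)) :
    W.yCurl (fun γ => W.yCurl (fun α => W.yt α (G γ) + W.yt γ (G α))) =
      -(2 * (a + 2)) • W.yCurl G := by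
  simp only [yCurl_symYt h]
  rw [yCurl_add, yCurl_smul, (HomY.yCurl h).yCurl_yt]
  module

variable {W} in
/-- A polynomial covector of degree at least two with vanishing symmetrized derivative is zero. -/
lemma eq_zero_of_symDy {a : k} {F : Fin 2 → M} (h : ∀ i, W.HomY a (F i)) (ha : 2 * a ≠ 0)
    (ha1 : a - 1 ≠ 0) (hF : ∀ α γ, W.dy α (F γ) + W.dy γ (F α) = 0) (γ : Fin 2) : F γ = 0 := by
  -- Two contractions leave `2a (y·F)`, and then one contraction leaves `(a - 1) F`. Degree one must
  -- be excluded: for `m` of degree zero, `F i = yt i m` is a genuine solution.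
  have h1 := yDot_yDot_symDy h
  have h2 := yDot_symDy h γ
  simp only [hF, yDot_zero] at h1 h2
  rw [(smul_eq_zero.1 h1.symm).resolve_left ha, map_zero, add_zero] at h2
  exact (smul_eq_zero.1 h2.symm).resolve_left ha1

variable {W} in
lemma eq_zero_of_symYt {a : k} {G : Fin 2 → M} (h : ∀ i, W.HomY a (G i)) (ha : 2 * (a + 2) ≠ 0)
    (ha1 : a + 3 ≠ 0) (hG : ∀ α γ, W.yt α (G γ) + W.yt γ (G α) = 0) (γ : Fin 2) : G γ = 0 := by
  have h1 := yCurl_yCurl_symYt h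
  have h2 := yCurl_symYt h γ
  simp only [hG, yCurl_zero] at h1 h2
  rw [(smul_eq_zero.1 h1.symm).resolve_left (neg_ne_zero.2 ha), map_zero, add_zero] at h2
  exact (smul_eq_zero.1 h2.symm).resolve_left (neg_ne_zero.2 ha1)

variable {W} in
-- A double contraction kills the `yt` terms and a double curl kills the `dy` terms, so the top and
-- bottom parts vanish separately. The middle part occurs in both sums; contraction followed by curl
-- yields only a proportionality there.
lemma symDy_add_symYt_eq_zero {n : k} {F G : Fin 2 → M} (hF : ∀ i, W.HomY (n + 1) (F i))
    (hG : ∀ i, W.HomY (n - 1) (G i)) (h2 : (2 : k) ≠ 0) (hn1 : n + 1 ≠ 0)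
    (h : ∀ α γ, W.dy α (F γ) + W.dy γ (F α) + (W.yt α (G γ) + W.yt γ (G α)) = 0) :
    W.yDot F = 0 ∧ W.yCurl G = 0 ∧ n • W.yCurl F = (n + 2) • W.yDot G := by
  have e1 : W.yDot F = 0 := by
    have h1 : W.yDot (fun γ => W.yDot fun α =>
      W.dy α (F γ) + W.dy γ (F α) + (W.yt α (G γ) + W.yt γ (G α))) = 0 := by simp [h]
    simp only [yDot_add _ (fun α => W.dy α _ + _) (fun α => W.yt α _ + _)] at h1
    rw [yDot_add, yDot_yDot_symDy hF, yDot_yDot_symYt, add_zero] at h1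
    exact (smul_eq_zero.1 h1).resolve_left (mul_ne_zero h2 hn1)
  have e2 : W.yCurl G = 0 := by
    have h1 : W.yCurl (fun γ => W.yCurl fun α =>
      W.dy α (F γ) + W.dy γ (F α) + (W.yt α (G γ) + W.yt γ (G α))) = 0 := by simp [h]
    simp only [yCurl_add _ (fun α => W.dy α _ + _) (fun α => W.yt α _ + _)] at h1
    rw [yCurl_add, yCurl_yCurl_symDy, yCurl_yCurl_symYt hG, zero_add] at h1
    refine (smul_eq_zero.1 h1).resolve_left (neg_ne_zero.2 (mul_ne_zero h2 ?_))
    convert hn1 using 1; ring_nf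
  refine ⟨e1, e2, ?_⟩
  have h3 : W.yCurl (fun γ => W.yDot fun α =>
      W.dy α (F γ) + W.dy γ (F α) + (W.yt α (G γ) + W.yt γ (G α))) = 0 := by simp [h]
  simp only [yDot_add _ (fun α => W.dy α _ + _) (fun α => W.yt α _ + _), yDot_symDy hF,
    yDot_symYt, e1] at h3
  have hG' : W.HomY n (W.yDot G) := by simpa using HomY.yDot hG
  simp only [map_zero, add_zero] at h3
  rw [yCurl_add, yCurl_smul, hG'.yCurl_yt] at h3
  linear_combination (norm := module) h3

/-! ### One-forms -/

/-- The undotted part of the two-form `D₊ f`. -/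
def symU (f : Fin 2 → Fin 2 → M) (α γ : Fin 2) : M :=
  W.dy α (W.zDot (f γ)) + W.dy γ (W.zDot (f α))

/-- The dotted part of the two-form `D₊ f`. -/
def symV (f : Fin 2 → Fin 2 → M) (β δ : Fin 2) : M :=
  W.zt β (W.yCurl fun i => f i δ) + W.zt δ (W.yCurl fun i => f i β)

variable {W}

lemma eq_zero_of_symU_eq_zero {a b : k} {f : Fin 2 → Fin 2 → M} (hf : ∀ i j, W.Hom a b (f i j))
    (ha : 2 * a ≠ 0) (ha1 : a - 1 ≠ 0) (h : ∀ α γ, W.symU f α γ = 0) (γ : Fin 2) :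
    W.zDot (f γ) = 0 :=
  eq_zero_of_symDy (fun i => (Hom.zDot (hf i)).1) ha ha1 h γ

lemma eq_zero_of_symV_eq_zero {a b : k} {f : Fin 2 → Fin 2 → M} (hf : ∀ i j, W.Hom a b (f i j))
    (hb : 2 * (b + 2) ≠ 0) (hb1 : b + 3 ≠ 0) (h : ∀ α γ, W.symV f α γ = 0) (δ : Fin 2) :
    W.yCurl (fun i => f i δ) = 0 :=
  eq_zero_of_symYt (W := W.swap) (G := fun δ => W.yCurl (fun i => f i δ))
    (fun j => (Hom.yCurl fun i => hf i j).2) hb hb1 h δ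

/-- Rules out cancellation between the two sides of the diagonal. The mixed scalars `x`, `x'` of
`f`, `f'` satisfy `n x = (n+2) x'` and `n x' = (n+2) x`, a system of determinant `-4(n+1)`. -/
lemma eq_zero_of_symUV_eq_zero {n : k} {f f' : Fin 2 → Fin 2 → M}
    (hf : ∀ i j, W.Hom (n + 1) (n - 1) (f i j)) (hf' : ∀ i j, W.Hom (n - 1) (n + 1) (f' i j))
    (h2 : (2 : k) ≠ 0) (hn : n ≠ 0) (hn1 : n + 1 ≠ 0) (hn2 : n + 2 ≠ 0)
    (hU : ∀ α γ, W.symU f α γ + W.swap.symV (fun i j => f' j i) α γ = 0)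
    (hV : ∀ α γ, W.symV f α γ + W.swap.symU (fun i j => f' j i) α γ = 0) :
    (∀ γ, W.zDot (f γ) = 0) ∧ ∀ δ, W.yCurl (fun i => f i δ) = 0 := by
  obtain ⟨a1, -, a3⟩ := symDy_add_symYt_eq_zero (W := W) (n := n) (F := fun γ => W.zDot (f γ))
    (G := fun γ => W.zCurl (f' γ)) (fun i => (Hom.zDot (hf i)).1)
    (fun i => (Hom.zCurl (hf' i)).1) h2 hn1 hU
  obtain ⟨-, b2, b3⟩ := symDy_add_symYt_eq_zero (W := W.swap) (n := n)
    (F := fun δ => W.yDot (fun i => f' i δ)) (G := fun δ => W.yCurl (fun i => f i δ))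
    (fun j => (Hom.yDot (fun i => hf' i j)).2) (fun j => (Hom.yCurl (fun i => hf i j)).2)
    h2 hn1 (fun α γ => by rw [← hV α γ, add_comm]; rfl)
  rw [swap_yCurl, swap_yDot, ← yCurl_zDot] at b3
  rw [swap_yCurl] at b2
  rw [yDot_zCurl] at a3
  have e : W.yCurl (fun γ => W.zDot (f γ)) = 0 := by
    have : (4 * (n + 1)) • W.yCurl (fun γ => W.zDot (f γ)) = 0 := by
      linear_combination (norm := module) -n • a3 - (n + 2) • b3
    refine (smul_eq_zero.1 this).resolve_left (mul_ne_zero ?_ hn1)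
    convert mul_ne_zero h2 h2 using 1; norm_num
  refine ⟨fun γ => ?_, fun δ => ?_⟩
  · have := W.covector_decomp (φ := fun γ => W.zDot (f γ)) (fun i => (Hom.zDot (hf i)).1) γ
    rw [a1, e, map_zero, map_zero, sub_zero] at this
    refine (smul_eq_zero.1 this).resolve_left ?_
    convert hn2 using 1; ring_nf
  · have := W.swap.covector_decomp (φ := fun δ => W.yCurl (fun i => f i δ))
      (fun j => (Hom.yCurl (fun i => hf i j)).2) δ
    rw [swap_yDot, swap_yCurl, b2, ← yCurl_zDot, e, map_zero, map_zero, sub_zero] at this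
    refine (smul_eq_zero.1 this).resolve_left ?_
    convert hn using 1; ring_nf

/-- A one-form with vanishing contraction and curl is a gradient. -/
lemma exists_eq_zt_dy {a b : k} {f : Fin 2 → Fin 2 → M} (hf : ∀ i j, W.Hom a b (f i j))
    (ha : a + 1 ≠ 0) (hb : b + 1 ≠ 0) (h1 : ∀ γ, W.zDot (f γ) = 0)
    (h2 : ∀ δ, W.yCurl (fun i => f i δ) = 0) :
    ∃ g, W.Hom (a + 1) (b - 1) g ∧ ∀ i j, f i j = W.zt j (W.dy i g) := by
  -- On `z_j ∂_i g` the curl in `z` gives the factor `-(b + 1)` and the contraction with `y` gives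
  -- `a + 1`; the witness divides by both.
  refine ⟨-((a + 1)⁻¹ * (b + 1)⁻¹) • W.yDot (fun i => W.zCurl (f i)),
    (Hom.yDot fun i => Hom.zCurl (hf i)).smul _, fun i j => ?_⟩
  have e1 := W.covector_decomp (φ := fun i => f i j) (fun i => (hf i j).1) i
  have e2 := W.swap.covector_decomp (φ := f i) (fun j => (hf i j).2) j
  have e3 := W.covector_decomp (φ := fun i => W.zCurl (f i)) (fun i => (Hom.zCurl (hf i)).1) i
  rw [swap_yDot, h1, map_zero, zero_sub, swap_yt, swap_yCurl] at e2
  rw [yCurl_zCurl] at e3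
  simp only [h2, zCurl_zero, map_zero, sub_zero] at e3
  rw [map_smul, map_smul, ← e3, map_smul]
  have : W.zt j (W.zCurl (f i)) = -(b + 1) • f i j := by
    linear_combination (norm := module) e2
  rw [this]
  match_scalars
  field_simp

/-- The decomposition of a one-form into its four irreducible parts. -/
lemma one_form_decomp {n : k} {f : Fin 2 → Fin 2 → M} (hf : ∀ i j, W.Hom n n (f i j))
    (hn : n + 1 ≠ 0) :
    ∃ F₁ F₂ g g', W.Hom (n + 1) (n + 1) F₁ ∧ W.Hom (n - 1) (n - 1) F₂ ∧
      W.Hom (n + 1) (n - 1) g ∧ W.Hom (n - 1) (n + 1) g' ∧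
      ∀ i j, f i j = W.dy i (W.dz j F₁) + W.yt i (W.zt j F₂) + W.zt j (W.dy i g) +
        W.yt i (W.dz j g') := by
  -- Each of the two indices is split by `covector_decomp`, at the cost of one factor `n + 1`; every
  -- curl brings a minus sign, so the mixed parts carry `-c`.
  set c := ((n + 1)⁻¹ * (n + 1)⁻¹) with hc
  refine ⟨c • W.yDot (fun i => W.zDot (f i)), c • W.yCurl (fun i => W.zCurl (f i)),
    -c • W.yDot (fun i => W.zCurl (f i)), -c • W.yCurl (fun i => W.zDot (f i)),
    (Hom.yDot fun i => Hom.zDot (hf i)).smul _, (Hom.yCurl fun i => Hom.zCurl (hf i)).smul _,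
    (Hom.yDot fun i => Hom.zCurl (hf i)).smul _, (Hom.yCurl fun i => Hom.zDot (hf i)).smul _,
    fun i j => ?_⟩
  have e2 := W.swap.covector_decomp (φ := f i) (fun j => (hf i j).2) j
  have e3 := W.covector_decomp (φ := fun i => W.zCurl (f i)) (fun i => (Hom.zCurl (hf i)).1) i
  have e4 := W.covector_decomp (φ := fun i => W.zDot (f i)) (fun i => (Hom.zDot (hf i)).1) i
  have e3' := congrArg (W.zt j) e3
  have e4' := congrArg (W.dz j) e4
  simp only [map_smul, map_sub, W.dz_dy, W.dz_yt, yt_zt, swap_dy, swap_yDot, swap_yt,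
    swap_yCurl] at *
  have : (n + 1) • (n + 1) • f i j = (n + 1) • (n + 1) •
      (W.dy i (W.dz j (c • W.yDot (fun i => W.zDot (f i)))) +
        W.yt i (W.zt j (c • W.yCurl (fun i => W.zCurl (f i)))) +
        W.zt j (W.dy i (-c • W.yDot (fun i => W.zCurl (f i)))) +
        W.yt i (W.dz j (-c • W.yCurl (fun i => W.zDot (f i))))) := by
    simp only [map_smul]
    rw [e2, smul_sub, e3', e4', hc]
    match_scalars <;> field_simp
  simpa only [map_smul, smul_right_inj hn] using this

end WeylOps

namespace WeylOps

variable {k M : Type*} [Field k] [AddCommGroup M] [Module k M] (W : WeylOps k M)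

/-! ### Two-forms -/

lemma dy_yt_symm (α γ : Fin 2) (m : M) :
    W.dy α (W.yt γ m) + W.dy γ (W.yt α m) = W.yt γ (W.dy α m) + W.yt α (W.dy γ m) := by
  fin_cases α <;> fin_cases γ <;>
    (simp [yt_zero, yt_one, dy_y00, dy_y01, dy_y10, dy_y11]; try abel)

lemma yt_comm (α γ : Fin 2) (m : M) : W.yt α (W.yt γ m) = W.yt γ (W.yt α m) := by
  fin_cases α <;> fin_cases γ <;> simp [yt_zero, yt_one, y10]

variable {W}

/-- The two orders differ by the antisymmetric part of `S`. A symmetric tensor therefore has only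
one part of middle degree. -/
lemma yCurl_yDot_symm {S : Fin 2 → Fin 2 → M} (hs : ∀ i j, S i j = S j i) :
    W.yCurl (fun γ => W.yDot (fun α => S α γ)) = W.yDot (fun γ => W.yCurl (fun α => S α γ)) := by
  simp only [yCurl, yDot, map_add, map_sub, dy_y00, dy_y01, dy_y10, dy_y11, hs 1 0]
  abel

/-- The decomposition of a symmetric tensor into its three irreducible parts. -/
lemma symm_decomp {a : k} {S : Fin 2 → Fin 2 → M} (hs : ∀ i j, S i j = S j i)
    (hS : ∀ i j, W.HomY a (S i j)) (h2 : (2 : k) ≠ 0) (α γ : Fin 2) :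
    (a * (a + 1) * (a + 2)) • S α γ =
      a • W.dy α (W.dy γ (W.yDot fun γ => W.yDot fun α => S α γ)) -
      (a + 1) • (W.yt γ (W.dy α (W.yDot fun γ => W.yCurl fun α => S α γ)) +
        W.yt α (W.dy γ (W.yDot fun γ => W.yCurl fun α => S α γ))) +
      (a + 2) • W.yt α (W.yt γ (W.yCurl fun γ => W.yCurl fun α => S α γ)) := by
  have e1 := fun α γ => W.covector_decomp (φ := fun α => S α γ) (fun i => hS i γ) α
  have e2 := W.covector_decomp (φ := fun γ => W.yDot fun α => S α γ)
    (fun i => HomY.yDot fun j => hS j i)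
  have e3 := W.covector_decomp (φ := fun γ => W.yCurl fun α => S α γ)
    (fun i => HomY.yCurl fun j => hS j i)
  rw [yCurl_yDot_symm hs] at e2
  set D := fun γ => W.yDot fun α => S α γ
  set C := fun γ => W.yCurl fun α => S α γ
  set a0 := W.yDot D
  set b0 := W.yDot C
  set c0 := W.yCurl C
  have key := fun α γ => congrArg (W.dy α) (e2 γ)
  have key' := fun α γ => congrArg (W.yt α) (e3 γ)
  simp only [map_smul, map_sub] at key key'
  have f1 : ∀ α γ, (a * (a + 1) * (a + 2)) • S α γ = a • (W.dy α (W.dy γ a0) - W.dy α (W.yt γ b0))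
      - (a + 2) • (W.yt α (W.dy γ b0) - W.yt α (W.yt γ c0)) := fun α γ => by
    linear_combination (norm := module) (a * (a + 2)) • e1 α γ + a • key α γ - (a + 2) • key' α γ
  -- The expression `f1` is not manifestly symmetric. Adding its transpose and reordering with
  -- `dy_yt_symm` gives twice the claim.
  have f2 := f1 γ α
  rw [hs γ α, W.yt_comm γ α, W.dy_dy γ α] at f2
  have f3 := W.dy_yt_symm α γ b0
  refine smul_right_injective M h2 ?_
  linear_combination (norm := module) f1 α γ + f2 - a • f3

/-- Modulo gradients a one-form has three parts `p`, `q`, `r`. The `r` part drops out of `U` since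
`z^β z_β = 0`, and in `symV_parts` the `p` part drops out of `V` since a gradient has no curl. Only
`q` feeds both. -/
lemma symU_parts {a b : k} {p q r : M} (hp : W.Hom (a + 1) (b + 1) p)
    (hq : W.Hom (a - 1) (b + 1) q) (s₁ s₂ s₃ : k) (α γ : Fin 2) :
    W.symU (fun i j => s₁ • W.dy i (W.dz j p) + s₂ • W.yt i (W.dz j q) + s₃ • W.yt i (W.zt j r))
      α γ = (2 * (b + 1) * s₁) • W.dy α (W.dy γ p) +
        ((b + 1) * s₂) • (W.yt γ (W.dy α q) + W.yt α (W.dy γ q)) := by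
  have h : ∀ i, W.zDot (fun j => s₁ • W.dy i (W.dz j p) + s₂ • W.yt i (W.dz j q) +
      s₃ • W.yt i (W.zt j r)) = ((b + 1) * s₁) • W.dy i p + ((b + 1) * s₂) • W.yt i q := fun i => by
    have e1 : W.zDot (fun j => W.dz j p) = (b + 1) • p := hp.2.yDot_dy
    have e2 : W.zDot (fun j => W.dz j q) = (b + 1) • q := hq.2.yDot_dy
    rw [zDot_add, zDot_add, zDot_smul, zDot_smul, zDot_smul]
    have c1 : W.zDot (fun j => W.dy i (W.dz j p)) = W.dy i (W.zDot fun j => W.dz j p) :=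
      W.swap.yDot_dz_comm _ i
    have c2 : W.zDot (fun j => W.yt i (W.dz j q)) = W.yt i (W.zDot fun j => W.dz j q) :=
      W.swap.yDot_zt_comm _ i
    have c3 : W.zDot (fun j => W.yt i (W.zt j r)) = W.yt i (W.zDot fun j => W.zt j r) :=
      W.swap.yDot_zt_comm _ i
    rw [c1, c2, c3, e1, e2, zDot_zt]
    simp only [map_smul, map_zero]
    module
  simp only [symU, h, map_add, map_smul]
  linear_combination (norm := module) ((b + 1) * s₂) • W.dy_yt_symm α γ q +
    ((b + 1) * s₁) • W.dy_dy γ α p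

lemma symV_parts {a b : k} {p q r : M} (hq : W.Hom (a - 1) (b + 1) q)
    (hr : W.Hom (a - 1) (b - 1) r) (s₁ s₂ s₃ : k) (β δ : Fin 2) :
    W.symV (fun i j => s₁ • W.dy i (W.dz j p) + s₂ • W.yt i (W.dz j q) + s₃ • W.yt i (W.zt j r))
      β δ = (-(a + 1) * s₂) • (W.zt δ (W.dz β q) + W.zt β (W.dz δ q)) +
        (-2 * (a + 1) * s₃) • W.zt β (W.zt δ r) := by
  have h : ∀ j, W.yCurl (fun i => s₁ • W.dy i (W.dz j p) + s₂ • W.yt i (W.dz j q) +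
      s₃ • W.yt i (W.zt j r)) = (-(a + 1) * s₂) • W.dz j q + (-(a + 1) * s₃) • W.zt j r :=
    fun j => by
    have e1 : W.yCurl (fun i => W.yt i (W.dz j q)) = _ := (hq.dz j).1.yCurl_yt
    have e2 : W.yCurl (fun i => W.yt i (W.zt j r)) = _ := (hr.zt j).1.yCurl_yt
    rw [yCurl_add, yCurl_add, yCurl_smul, yCurl_smul, yCurl_smul, yCurl_dy, e1, e2]
    module
  have c : W.zt δ (W.zt β r) = W.zt β (W.zt δ r) := W.swap.yt_comm _ _ _
  simp only [symV, h, map_add, map_smul, c]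
  module

variable {U V : Fin 2 → Fin 2 → M}

/-- Every two-form on the diagonal, of positive degree, is exact. -/
lemma exists_eq_sym_diagonal [CharZero k] {n : k} (hUs : ∀ i j, U i j = U j i)
    (hVs : ∀ i j, V i j = V j i)
    (hU : ∀ i j, W.Hom n n (U i j)) (hV : ∀ i j, W.Hom n n (V i j))
    (hn : n ≠ 0) (hn1 : n + 1 ≠ 0) (hn2 : n + 2 ≠ 0) :
    ∃ f f' : Fin 2 → Fin 2 → M, (∀ i j, W.Hom (n + 1) (n - 1) (f i j)) ∧
      (∀ i j, W.Hom (n - 1) (n + 1) (f' i j)) ∧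
      (∀ α γ, U α γ = W.symU f α γ + W.swap.symV (fun i j => f' j i) α γ) ∧
      (∀ β δ, V β δ = W.symV f β δ + W.swap.symU (fun i j => f' j i) β δ) := by
  have dU := symm_decomp hUs (fun i j => (hU i j).1) two_ne_zero
  have dV := symm_decomp (W := W.swap) hVs (fun i j => (hV i j).2) two_ne_zero
  have ha : W.Hom (n + 1 + 1) n (W.yDot fun γ => W.yDot fun α => U α γ) :=
    Hom.yDot fun i => Hom.yDot fun j => hU j i
  have hb : W.Hom (n - 1 + 1) n (W.yDot fun γ => W.yCurl fun α => U α γ) :=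
    Hom.yDot fun i => Hom.yCurl fun j => hU j i
  have hc : W.Hom (n - 1 - 1) n (W.yCurl fun γ => W.yCurl fun α => U α γ) :=
    Hom.yCurl fun i => Hom.yCurl fun j => hU j i
  have ha' : W.Hom n (n + 1 + 1) (W.zDot fun γ => W.zDot fun α => V α γ) :=
    Hom.zDot fun i => Hom.zDot fun j => hV j i
  have hb' : W.Hom n (n - 1 + 1) (W.zDot fun γ => W.zCurl fun α => V α γ) :=
    Hom.zDot fun i => Hom.zCurl fun j => hV j i
  have hc' : W.Hom n (n - 1 - 1) (W.zCurl fun γ => W.zCurl fun α => V α γ) :=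
    Hom.zCurl fun i => Hom.zCurl fun j => hV j i
  simp only [swap_yDot, swap_yCurl, swap_yt, swap_dy] at dV
  set a := W.yDot fun γ => W.yDot fun α => U α γ
  set b := W.yDot fun γ => W.yCurl fun α => U α γ
  set c := W.yCurl fun γ => W.yCurl fun α => U α γ
  set a' := W.zDot fun γ => W.zDot fun α => V α γ
  set b' := W.zDot fun γ => W.zCurl fun α => V α γ
  set c' := W.zCurl fun γ => W.zCurl fun α => V α γ
  -- The outer parts `a`, `c'` are produced from above the diagonal and `a'`, `c` from below. The
  -- middle parts `b`, `b'` receive contributions from both sides through the matrix with rows `(n,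
  -- -(n+2))`, `(-(n+2), n)`. Its determinant is `-4(n+1)`, and inverting it gives `p` and `q`.
  set s := (2 * n * (n + 1) * (n + 2))⁻¹ with hs
  set p := (4 * (n + 1) * (n + 2))⁻¹ with hp
  set q := (4 * n * (n + 1))⁻¹ with hq
  have hx : W.Hom (n - 1 + 1) (n - 1 + 1) (p • b + q • b') :=
    ((hb.congr rfl (by ring)).smul p).add ((hb'.congr (by ring) rfl).smul q)
  have hx' : W.Hom (n - 1 + 1) (n - 1 + 1) (p • b' + q • b) :=
    ((hb'.congr (by ring) rfl).smul p).add ((hb.congr rfl (by ring)).smul q)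
  have h2n : n * (n + 1) * (n + 2) ≠ 0 := mul_ne_zero (mul_ne_zero hn hn1) hn2
  refine ⟨fun i j => s • W.dy i (W.dz j a) + (1 : k) • W.yt i (W.dz j (p • b + q • b')) +
      (-s) • W.yt i (W.zt j c'),
    fun i j => s • W.dz j (W.dy i a') + (1 : k) • W.zt j (W.dy i (p • b' + q • b)) +
      (-s) • W.zt j (W.yt i c), fun i j => ?_, fun i j => ?_, fun α γ => ?_, fun β δ => ?_⟩
  · exact ((((ha.dz j).dy i).congr (by ring) rfl).smul s).add
      ((((hx.dz j).yt i).congr (by ring) (by ring)).smul 1) |>.add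
      ((((hc'.zt j).yt i).congr rfl (by ring)).smul (-s))
  · exact ((((ha'.dy i).dz j).congr rfl (by ring)).smul s).add
      ((((hx'.dy i).zt j).congr (by ring) (by ring)).smul 1) |>.add
      ((((hc.yt i).zt j).congr (by ring) rfl).smul (-s))
  · rw [symU_parts (a := n + 1) (b := n - 1) (ha.congr rfl (by ring))
      (hx.congr (by ring) rfl)]
    have := symV_parts (W := W.swap) (a := n + 1) (b := n - 1) (p := a') (q := p • b' + q • b)
      (r := c) (hx'.swap.congr (by ring) rfl) (hc.swap.congr (by ring) rfl) s 1 (-s) α γ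
    simp only [swap_yt, swap_zt, swap_dz, swap_dy] at this ⊢
    rw [this]
    refine smul_right_injective M h2n ?_
    beta_reduce
    rw [dU]
    simp only [map_add, map_smul, hs, hp, hq]
    match_scalars <;> field_simp <;> ring
  · rw [symV_parts (a := n + 1) (b := n - 1)
      (hx.congr (by ring) rfl) (hc'.congr (by ring) rfl)]
    have := symU_parts (W := W.swap) (a := n + 1) (b := n - 1) (p := a') (q := p • b' + q • b)
      (r := c) (ha'.swap.congr rfl (by ring)) (hx'.swap.congr (by ring) rfl) s 1 (-s) β δ
    simp only [swap_yt, swap_zt, swap_dz, swap_dy] at this ⊢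
    rw [this]
    refine smul_right_injective M h2n ?_
    beta_reduce
    rw [dV]
    simp only [map_add, map_smul, hs, hp, hq]
    match_scalars <;> field_simp <;> ring

variable (W) in
/-- The components of the three-form `D₊ (U, V)`. -/
def threeForm (U V : Fin 2 → Fin 2 → M) (γ φ : Fin 2) : M :=
  W.zt φ (W.yCurl fun α => U α γ) - W.dy γ (W.zDot fun β => V β φ)

/-- The consequences of closedness for the irreducible parts of a two-form. -/
lemma closed_parts {a b : k} (hVs : ∀ i j, V i j = V j i)
    (hU : ∀ i j, W.Hom a b (U i j)) (hV : ∀ i j, W.Hom a b (V i j))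
    (ha : a ≠ 0) (hb2 : b + 2 ≠ 0) (h : ∀ γ φ, W.threeForm U V γ φ = 0) :
    W.yCurl (fun γ => W.yCurl fun α => U α γ) = 0 ∧ W.zDot (fun γ => W.zDot fun α => V α γ) = 0 ∧
    (b + 2) • W.yDot (fun γ => W.yCurl fun α => U α γ) +
      a • W.zDot (fun γ => W.zCurl fun α => V α γ) = 0 := by
  set C := fun γ => W.yCurl fun α => U α γ with hC
  set B := fun φ => W.zDot fun β => V β φ with hB
  have hCh : ∀ i, W.Hom (a - 1) b (C i) := fun i => Hom.yCurl fun j => hU j i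
  have hBh : ∀ i, W.Hom a (b + 1) (B i) := fun i => Hom.zDot fun j => hV j i
  have h' : ∀ γ φ, W.zt φ (C γ) = W.dy γ (B φ) := fun γ φ => sub_eq_zero.1 (h γ φ)
  have hBC : W.zCurl B = W.zDot (fun γ => W.zCurl fun α => V α γ) :=
    yCurl_yDot_symm (W := W.swap) hVs
  -- The curl in `γ` removes the gradient term of the three-form. In `e2`, dually, the contraction
  -- in `φ` removes the `zt` term.
  have e1 : W.yCurl C = 0 := by
    have h1 : ∀ φ, W.zt φ (W.yCurl C) = 0 := fun φ => by
      rw [← yCurl_zt_comm]; simp only [h', yCurl_dy]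
    have h2 : W.zCurl (fun φ => W.zt φ (W.yCurl C)) = _ :=
      HomY.yCurl_yt (W := W.swap) (Hom.yCurl hCh).2
    simp only [h1, zCurl_zero] at h2
    exact (smul_eq_zero.1 h2.symm).resolve_left (neg_ne_zero.2 hb2)
  have e2 : W.zDot B = 0 := by
    have h1 : ∀ γ, W.dy γ (W.zDot B) = 0 := fun γ => by
      have : W.zDot (fun φ => W.dy γ (B φ)) = W.dy γ (W.zDot B) := W.swap.yDot_dz_comm B γ
      rw [← this]; simp only [← h', zDot_zt]
    have h2 := (Hom.zDot hBh).1.yDot_dy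
    simp only [h1, yDot_zero] at h2
    exact (smul_eq_zero.1 h2.symm).resolve_left ha
  refine ⟨e1, e2, ?_⟩
  rw [← hBC]
  have f1 := W.covector_decomp (fun i => (hCh i).1)
  have f2 := W.swap.covector_decomp (φ := B) (fun i => (hBh i).2)
  simp only [swap_yDot, swap_yCurl, swap_yt, e2, e1, map_zero, sub_zero, zero_sub] at f1 f2
  -- Both middle parts enter through the same operator `zt φ ∘ dy γ`, so closedness constrains one
  -- combination of them; the operator has no kernel as `a` and `b + 2` are nonzero.
  have f3 : ∀ γ φ, W.zt φ (W.dy γ ((b + 2) • W.yDot C + a • W.zCurl B)) = 0 := fun γ φ => by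
    have g1 := congrArg (W.zt φ) (f1 γ)
    have g2 := congrArg (W.dy γ) (f2 φ)
    simp only [map_smul, map_neg, dy_zt] at g1 g2
    simp only [map_add, map_smul]
    linear_combination (norm := module) -(b + 2) • g1 + a • g2 + (a * (b + 2)) • h' γ φ
  have hh : W.Hom a b ((b + 2) • W.yDot C + a • W.zCurl B) :=
    (((Hom.yDot hCh).congr (by ring) rfl).smul _).add (((Hom.zCurl hBh).congr rfl (by ring)).smul _)
  have f4 : ∀ γ, W.dy γ ((b + 2) • W.yDot C + a • W.zCurl B) = 0 := fun γ => by
    have h2 := HomY.yCurl_yt (W := W.swap) (hh.dy γ).2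
    simp only [swap_yt, f3, yCurl_zero] at h2
    exact (smul_eq_zero.1 h2.symm).resolve_left (neg_ne_zero.2 hb2)
  have h2 := hh.1.yDot_dy
  simp only [f4, yDot_zero] at h2
  exact (smul_eq_zero.1 h2.symm).resolve_left ha

/-- Closed two-forms off the diagonal, of positive degree in both variables, are exact. -/
lemma exists_eq_sym [CharZero k] {a b : k} (hUs : ∀ i j, U i j = U j i)
    (hVs : ∀ i j, V i j = V j i)
    (hU : ∀ i j, W.Hom a b (U i j)) (hV : ∀ i j, W.Hom a b (V i j))
    (ha : a ≠ 0) (ha1 : a + 1 ≠ 0) (ha2 : a + 2 ≠ 0) (hb : b ≠ 0) (hb1 : b + 1 ≠ 0)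
    (hb2 : b + 2 ≠ 0) (h : ∀ γ φ, W.threeForm U V γ φ = 0) :
    ∃ f : Fin 2 → Fin 2 → M, (∀ i j, W.Hom (a + 1) (b - 1) (f i j)) ∧
      (∀ α γ, U α γ = W.symU f α γ) ∧ (∀ β δ, V β δ = W.symV f β δ) := by
  obtain ⟨h1, h2, h3⟩ := closed_parts hVs hU hV ha hb2 h
  have dU := symm_decomp hUs (fun i j => (hU i j).1) two_ne_zero
  have dV := symm_decomp (W := W.swap) hVs (fun i j => (hV i j).2) two_ne_zero
  have hp : W.Hom (a + 1 + 1) b (W.yDot fun γ => W.yDot fun α => U α γ) :=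
    Hom.yDot fun i => Hom.yDot fun j => hU j i
  have hq : W.Hom (a - 1 + 1) b (W.yDot fun γ => W.yCurl fun α => U α γ) :=
    Hom.yDot fun i => Hom.yCurl fun j => hU j i
  have hr : W.Hom a (b - 1 - 1) (W.zCurl fun γ => W.zCurl fun α => V α γ) :=
    Hom.zCurl fun i => Hom.zCurl fun j => hV j i
  simp only [swap_yDot, swap_yCurl, swap_yt, swap_dy] at dV
  rw [h1] at dU
  rw [h2] at dV
  set p := W.yDot fun γ => W.yDot fun α => U α γ
  set q := W.yDot fun γ => W.yCurl fun α => U α γ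
  set q' := W.zDot fun γ => W.zCurl fun α => V α γ
  set r := W.zCurl fun γ => W.zCurl fun α => V α γ
  -- The single part `q` of a one-form has to produce the middle parts of both `U` and `V`;
  -- closedness supplies exactly the required ratio.
  have hq' : q' = (-(a⁻¹ * (b + 2))) • q := by
    refine smul_right_injective M ha ?_
    beta_reduce
    rw [smul_smul, mul_neg, ← mul_assoc, mul_inv_cancel₀ ha]
    linear_combination (norm := module) h3
  -- Comparison of `symm_decomp` with `symU_parts` fixes `s₁` and `s₂`, and with `symV_parts` fixes
  -- `s₃`. Every denominator contains `b`, so the construction breaks down at `b = 0`.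
  set s₁ := (2 * b * (a + 1) * (a + 2))⁻¹ with hs₁
  set s₂ := -(a * b * (a + 2))⁻¹ with hs₂
  set s₃ := -(2 * (a + 2) * b * (b + 1))⁻¹ with hs₃
  refine ⟨fun i j => s₁ • W.dy i (W.dz j p) + s₂ • W.yt i (W.dz j q) + s₃ • W.yt i (W.zt j r),
    fun i j => ?_, fun α γ => ?_, fun β δ => ?_⟩
  · exact ((((hp.dz j).dy i).congr (by ring) rfl).smul _).add
      ((((hq.dz j).yt i).congr (by ring) (by ring)).smul _) |>.add
      ((((hr.zt j).yt i).congr rfl (by ring)).smul _)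
  · rw [symU_parts (a := a + 1) (b := b - 1) (hp.congr rfl (by ring))
      (hq.congr (by ring) (by ring))]
    refine smul_right_injective M (mul_ne_zero (mul_ne_zero ha ha1) ha2) ?_
    beta_reduce
    rw [dU]
    simp only [map_zero, hs₁, hs₂]
    match_scalars <;> field_simp <;> ring
  · rw [symV_parts (a := a + 1) (b := b - 1)
      (hq.congr (by ring) (by ring)) (hr.congr (by ring) (by ring))]
    refine smul_right_injective M (mul_ne_zero (mul_ne_zero hb hb1) hb2) ?_
    beta_reduce
    rw [dV, hq']
    simp only [map_zero, map_smul, hs₂, hs₃]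
    match_scalars <;> field_simp <;> ring

/-- Closed two-forms off the diagonal, of degree zero in `z`, are Weyl cocycles. -/
lemma exists_eq_dy_dy [CharZero k] {a : k} (hUs : ∀ i j, U i j = U j i)
    (hVs : ∀ i j, V i j = V j i)
    (hU : ∀ i j, W.Hom a 0 (U i j)) (hV : ∀ i j, W.Hom a 0 (V i j))
    (hneg : ∀ c m, W.Hom c (-1) m → m = 0)
    (ha : a ≠ 0) (ha1 : a + 1 ≠ 0) (ha2 : a + 2 ≠ 0) (h : ∀ γ φ, W.threeForm U V γ φ = 0) :
    (∃ p, W.Hom (a + 2) 0 p ∧ ∀ α γ, U α γ = W.dy α (W.dy γ p)) ∧ ∀ β δ, V β δ = 0 := by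
  obtain ⟨h1, h2, h3⟩ := closed_parts hVs hU hV ha (by norm_num) h
  have dU := symm_decomp hUs (fun i j => (hU i j).1) two_ne_zero
  -- This curl has degree `-1` in `z`. Through `h3` its vanishing also removes the middle part of
  -- `U`.
  have hz : ∀ γ, W.zCurl (fun α => V α γ) = 0 := fun γ => hneg a _
    ((Hom.zCurl fun j => hV j γ).congr rfl (by ring))
  simp only [hz, zDot_zero, smul_zero, add_zero] at h3
  rw [h1, (smul_eq_zero.1 h3).resolve_left (by norm_num)] at dU
  refine ⟨⟨((a + 1)⁻¹ * (a + 2)⁻¹) • W.yDot fun γ => W.yDot fun α => U α γ,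
    ((Hom.yDot fun i => Hom.yDot fun j => hU j i).congr (by ring) rfl).smul _,
    fun α γ => ?_⟩, fun β δ => ?_⟩
  · refine smul_right_injective M (mul_ne_zero (mul_ne_zero ha ha1) ha2) ?_
    beta_reduce
    rw [dU]
    simp only [map_zero, map_smul]
    match_scalars; field_simp
  · have hB : ∀ δ, W.zDot (fun β => V β δ) = 0 := fun δ => by
      have := W.swap.covector_decomp (φ := fun δ => W.zDot (fun β => V β δ))
        (fun i => (Hom.zDot fun j => hV j i).2) δ
      have e : W.zCurl (fun δ => W.zDot (fun β => V β δ)) = _ :=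
        yCurl_yDot_symm (W := W.swap) hVs
      simp only [swap_yCurl, hz, yDot_zero] at e
      rw [swap_yDot, swap_yCurl, e, h2, map_zero, map_zero, sub_zero] at this
      exact (smul_eq_zero.1 this).resolve_left (by norm_num)
    have := W.swap.covector_decomp (φ := fun β => V β δ) (fun i => (hV i δ).2) β
    rw [swap_yDot, swap_yCurl, hB, hz, map_zero, map_zero, sub_zero] at this
    exact (smul_eq_zero.1 this).resolve_left (by norm_num)

variable {U' V' : Fin 2 → Fin 2 → M}

/-- Closedness of a pair of two-forms on both sides of the diagonal couples only two pairs of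
irreducible parts. -/
lemma closed_pair_parts {n : k} (hV : ∀ i j, W.Hom (n + 1) (n - 1) (V i j))
    (hU : ∀ i j, W.Hom (n + 1) (n - 1) (U i j))
    (hU' : ∀ i j, W.Hom (n - 1) (n + 1) (U' i j)) (hV' : ∀ i j, W.Hom (n - 1) (n + 1) (V' i j))
    (hn1 : n + 1 ≠ 0)
    (h : ∀ γ φ, W.threeForm U V γ φ - W.swap.threeForm V' U' φ γ = 0) :
    W.zDot (fun φ => W.zDot fun β => V β φ) = W.yDot (fun φ => W.yDot fun β => U' β φ) ∧
    W.yCurl (fun φ => W.yCurl fun β => U β φ) = W.zCurl (fun φ => W.zCurl fun β => V' β φ) := by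
  simp only [threeForm, swap_zt, swap_yCurl, swap_zDot, swap_dy] at h
  set C := fun γ => W.yCurl fun α => U α γ with hC
  set B := fun φ => W.zDot fun β => V β φ with hB
  set C' := fun φ => W.zCurl fun α => V' α φ with hC'
  set B' := fun γ => W.yDot fun β => U' β γ with hB'
  have hCh : ∀ i, W.Hom (n + 1 - 1) (n - 1) (C i) := fun i => Hom.yCurl fun j => hU j i
  have hBh : ∀ i, W.Hom (n + 1) (n - 1 + 1) (B i) := fun i => Hom.zDot fun j => hV j i
  have hCh' : ∀ i, W.Hom (n - 1) (n + 1 - 1) (C' i) := fun i => Hom.zCurl fun j => hV' j i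
  have hBh' : ∀ i, W.Hom (n - 1 + 1) (n + 1) (B' i) := fun i => Hom.yDot fun j => hU' j i
  change ∀ γ φ, W.zt φ (C γ) - W.dy γ (B φ) - (W.yt γ (C' φ) - W.dz φ (B' γ)) = 0 at h
  have zc : ∀ (F : Fin 2 → M) (γ : Fin 2),
    W.zDot (fun φ => W.dy γ (F φ)) = W.dy γ (W.zDot F) := fun F γ => W.swap.yDot_dz_comm F γ
  have zc' : ∀ (F : Fin 2 → M) (γ : Fin 2),
    W.zDot (fun φ => W.yt γ (F φ)) = W.yt γ (W.zDot F) := fun F γ => W.swap.yDot_zt_comm F γ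
  have zd : ∀ (F : Fin 2 → M) (γ : Fin 2),
    W.zCurl (fun φ => W.dy γ (F φ)) = W.dy γ (W.zCurl F) := fun F γ => W.swap.yCurl_dz_comm F γ
  have zd' : ∀ (F : Fin 2 → M) (γ : Fin 2),
    W.zCurl (fun φ => W.yt γ (F φ)) = W.yt γ (W.zCurl F) := fun F γ => W.swap.yCurl_zt_comm F γ
  refine ⟨?_, ?_⟩
  -- Contraction with `z` kills the `zt` term and contraction with `y` then kills the `yt` term. The
  -- two double contractions are left with the same factor `n + 1`; the second half does this with
  -- curls.
  · have h1 : ∀ γ, (n + 1) • B' γ - W.dy γ (W.zDot B) - W.yt γ (W.zDot C') = 0 := fun γ => by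
      have e : W.zDot (fun φ => W.zt φ (C γ) - W.dy γ (B φ) - (W.yt γ (C' φ) - W.dz φ (B' γ)))
        = 0 := by simp [h]
      have e' : W.zDot (fun φ => W.dz φ (B' γ)) = _ := (hBh' γ).2.yDot_dy
      rw [zDot_sub, zDot_sub, zDot_sub, zDot_zt, zc, zc', e'] at e
      linear_combination (norm := module) e
    have e : W.yDot (fun γ => (n + 1) • B' γ - W.dy γ (W.zDot B) - W.yt γ (W.zDot C')) = 0 := by
      simp [h1]
    rw [yDot_sub, yDot_sub, yDot_smul, (Hom.zDot hBh).1.yDot_dy, yDot_yt] at e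
    refine smul_right_injective M hn1 ?_
    linear_combination (norm := module) -e
  · have h1 : ∀ γ, (n + 1) • C γ + W.dy γ (W.zCurl B) + W.yt γ (W.zCurl C') = 0 := fun γ => by
      have e : W.zCurl (fun φ => W.zt φ (C γ) - W.dy γ (B φ) - (W.yt γ (C' φ) - W.dz φ (B' γ)))
        = 0 := by simp [h]
      have e' : W.zCurl (fun φ => W.zt φ (C γ)) = _ :=
        HomY.yCurl_yt (W := W.swap) (hCh γ).2
      rw [zCurl_sub, zCurl_sub, zCurl_sub, zCurl_dz, zd, zd', e'] at e
      linear_combination (norm := module) -e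
    have e : W.yCurl (fun γ => (n + 1) • C γ + W.dy γ (W.zCurl B) + W.yt γ (W.zCurl C')) = 0 := by
      simp [h1]
    rw [yCurl_add, yCurl_add, yCurl_smul, yCurl_dy, (Hom.zCurl hCh').1.yCurl_yt] at e
    refine smul_right_injective M hn1 ?_
    linear_combination (norm := module) e

/-- With the two scalars gone, the curl of `U` is a gradient and the contraction of `V` is a
multiple of `z`. The three-form then has a single irreducible part. -/
lemma threeForm_eq_of_parts {n : k} (hV : ∀ i j, W.Hom (n + 1) (n - 1) (V i j))
    (hU : ∀ i j, W.Hom (n + 1) (n - 1) (U i j)) (hn1 : n + 1 ≠ 0)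
    (hz : W.zDot (fun φ => W.zDot fun β => V β φ) = 0)
    (hy : W.yCurl (fun φ => W.yCurl fun β => U β φ) = 0) :
    ∃ β, W.Hom (n + 1) (n - 1) β ∧ ∀ γ φ, W.threeForm U V γ φ = W.dy γ (W.zt φ β) := by
  have hCh : ∀ i, W.Hom (n + 1 - 1) (n - 1) (W.yCurl fun α => U α i) :=
    fun i => Hom.yCurl fun j => hU j i
  have hBh : ∀ i, W.Hom (n + 1) (n - 1 + 1) (W.zDot fun β => V β i) :=
    fun i => Hom.zDot fun j => hV j i
  have f1 := W.covector_decomp (fun i => (hCh i).1)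
  have f2 := W.swap.covector_decomp (φ := fun i => W.zDot fun β => V β i) (fun i => (hBh i).2)
  rw [hy] at f1
  rw [swap_yDot, hz] at f2
  refine ⟨(n + 1)⁻¹ • (W.yDot (fun γ => W.yCurl fun α => U α γ) +
    W.zCurl (fun φ => W.zDot fun β => V β φ)),
    (((Hom.yDot hCh).congr (by ring) rfl).add ((Hom.zCurl hBh).congr rfl (by ring))).smul _,
    fun γ φ => ?_⟩
  have g1 := congrArg (W.zt φ) (f1 γ)
  have g2 := congrArg (W.dy γ) (f2 φ)
  simp only [map_smul, map_neg, dy_zt, map_zero, sub_zero, zero_sub, swap_yt, swap_yCurl] at g1 g2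
  refine smul_right_injective M hn1 ?_
  simp only [threeForm, map_smul, map_add, dy_zt, smul_inv_smul₀ hn1]
  linear_combination (norm := module) g1 - g2

/-- The three-form from above is `∂_γ z_φ β` and the one from below is `y_γ ∂̄_φ β'`. These are
different irreducible parts, told apart by contraction with `y`, so they cannot cancel. -/
lemma closed_of_pair {n : k} (hV : ∀ i j, W.Hom (n + 1) (n - 1) (V i j))
    (hU : ∀ i j, W.Hom (n + 1) (n - 1) (U i j))
    (hU' : ∀ i j, W.Hom (n - 1) (n + 1) (U' i j)) (hV' : ∀ i j, W.Hom (n - 1) (n + 1) (V' i j))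
    (hn1 : n + 1 ≠ 0)
    (h : ∀ γ φ, W.threeForm U V γ φ - W.swap.threeForm V' U' φ γ = 0)
    (hz : W.zDot (fun φ => W.zDot fun β => V β φ) = 0)
    (hy : W.yCurl (fun φ => W.yCurl fun β => U β φ) = 0)
    (hz' : W.zCurl (fun φ => W.zCurl fun β => V' β φ) = 0)
    (hy' : W.yDot (fun φ => W.yDot fun β => U' β φ) = 0) :
    (∀ γ φ, W.threeForm U V γ φ = 0) ∧ ∀ γ φ, W.swap.threeForm V' U' φ γ = 0 := by
  obtain ⟨β, hβ, e⟩ := threeForm_eq_of_parts hV hU hn1 hz hy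
  obtain ⟨β', -, e'⟩ := threeForm_eq_of_parts (W := W.swap) (fun i j => (hU' i j).swap)
    (fun i j => (hV' i j).swap) hn1 hy' hz'
  have h1 : ∀ φ, W.zt φ β = 0 := fun φ => by
    have : W.yDot (fun γ => W.dy γ (W.zt φ β) - W.dz φ (W.yt γ β')) = 0 := by
      have h' := h
      simp only [e, e'] at h'
      simp only [swap_dy, swap_zt] at h'
      simp [h']
    rw [yDot_sub, (hβ.zt φ).1.yDot_dy, yDot_dz_comm, yDot_yt, map_zero, sub_zero] at this
    exact (smul_eq_zero.1 this).resolve_left hn1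
  have h2 : ∀ γ φ, W.threeForm U V γ φ = 0 := fun γ φ => by rw [e, h1, map_zero]
  exact ⟨h2, fun γ φ => by simpa [h2] using h γ φ⟩

end WeylOps
end HigherSpin

open scoped TensorProduct
namespace HigherSpin
noncomputable section

/-! ### The polynomial model: bidegrees, bosonic and diagonal polynomials -/

section Polynomials
variable {A : Type*} [CommRing A]

@[simp] lemma y_apply (i : Fin 2) (f : SpinorPoly A) :
    y A i f = MvPolynomial.X (Sum.inl i) * f := rfl
@[simp] lemma yBar_apply (i : Fin 2) (f : SpinorPoly A) :
    yBar A i f = MvPolynomial.X (Sum.inr i) * f := rfl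
@[simp] lemma dY_apply (i : Fin 2) (f : SpinorPoly A) :
    dY A i f = MvPolynomial.pderiv (Sum.inl i) f := rfl
@[simp] lemma dYBar_apply (i : Fin 2) (f : SpinorPoly A) :
    dYBar A i f = MvPolynomial.pderiv (Sum.inr i) f := rfl

lemma pderiv_comm (i j : Fin 2 ⊕ Fin 2) (f : SpinorPoly A) :
    MvPolynomial.pderiv i (MvPolynomial.pderiv j f) =
      MvPolynomial.pderiv j (MvPolynomial.pderiv i f) := by
  ext m
  simp only [MvPolynomial.coeff_pderiv]
  rw [add_right_comm]
  by_cases h : i = j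
  · subst h; rfl
  · simp [h, Ne.symm h]; ring

lemma pderiv_X_mul (i j : Fin 2 ⊕ Fin 2) (f : SpinorPoly A) :
    MvPolynomial.pderiv i (MvPolynomial.X j * f) =
      (if i = j then f else 0) + MvPolynomial.X j * MvPolynomial.pderiv i f := by
  rw [MvPolynomial.pderiv_mul, MvPolynomial.pderiv_X]
  by_cases h : i = j
  · subst h; simp
  · simp [h, Ne.symm h]

lemma bidegProj_monomial (P : ℕ → ℕ → Prop)
    (m : Fin 2 ⊕ Fin 2 →₀ ℕ) (c : A) [Decidable (P (degY m) (degYBar m))] :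
    bidegProj A P (MvPolynomial.monomial m c) =
      if P (degY m) (degYBar m) then MvPolynomial.monomial m c else 0 := by
  classical
  have h : MvPolynomial.monomial m c = c • MvPolynomial.basisMonomials (Fin 2 ⊕ Fin 2) A m := by
    simp [MvPolynomial.smul_monomial]
  rw [h, map_smul, bidegProj, Module.Basis.constr_basis]
  split_ifs <;> simp

lemma coeff_bidegProj (P : ℕ → ℕ → Prop) (m : Fin 2 ⊕ Fin 2 →₀ ℕ)
    [Decidable (P (degY m) (degYBar m))] (f : SpinorPoly A) :
    (bidegProj A P f).coeff m = if P (degY m) (degYBar m) then f.coeff m else 0 := by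
  classical
  induction f using MvPolynomial.induction_on' with
  | monomial u a =>
    rw [bidegProj_monomial]
    by_cases h : u = m
    · subst h
      split_ifs <;> simp
    · split_ifs <;> simp [h]
  | add p q hp hq =>
    rw [map_add, MvPolynomial.coeff_add, hp, hq]
    split_ifs <;> simp

lemma bidegProj_bidegProj (P Q : ℕ → ℕ → Prop) (f : SpinorPoly A) :
    bidegProj A P (bidegProj A Q f) = bidegProj A (fun N Nb => P N Nb ∧ Q N Nb) f := by
  classical
  ext m
  simp only [coeff_bidegProj]
  split_ifs <;> tauto

lemma bidegProj_comm (P Q : ℕ → ℕ → Prop) (f : SpinorPoly A) :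
    bidegProj A P (bidegProj A Q f) = bidegProj A Q (bidegProj A P f) := by
  classical
  ext m
  simp only [coeff_bidegProj]
  split_ifs <;> rfl

variable (A) in
/-- The projection onto bidegree `(a, b)`. -/
def homProj (a b : ℤ) : SpinorPoly A →ₗ[A] SpinorPoly A :=
  bidegProj A fun N Nb => (N : ℤ) = a ∧ (Nb : ℤ) = b

lemma degY_add (m m' : Fin 2 ⊕ Fin 2 →₀ ℕ) : degY (m + m') = degY m + degY m' := by
  simp [degY]; ring
lemma degYBar_add (m m' : Fin 2 ⊕ Fin 2 →₀ ℕ) : degYBar (m + m') = degYBar m + degYBar m' := by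
  simp [degYBar]; ring
lemma degY_inl (i : Fin 2) : degY (Finsupp.single (Sum.inl i) 1) = 1 := by
  fin_cases i <;> simp [degY, Finsupp.single_apply]
lemma degY_inr (i : Fin 2) : degY (Finsupp.single (Sum.inr i) 1) = 0 := by
  fin_cases i <;> simp [degY]
lemma degYBar_inl (i : Fin 2) : degYBar (Finsupp.single (Sum.inl i) 1) = 0 := by
  fin_cases i <;> simp [degYBar]
lemma degYBar_inr (i : Fin 2) : degYBar (Finsupp.single (Sum.inr i) 1) = 1 := by
  fin_cases i <;> simp [degYBar, Finsupp.single_apply]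

lemma coeff_X_mul_shift (P Q : ℕ → ℕ → Prop) (j : Fin 2 ⊕ Fin 2)
    (h : ∀ m, P (degY (Finsupp.single j 1 + m)) (degYBar (Finsupp.single j 1 + m)) ↔
      Q (degY m) (degYBar m)) (f : SpinorPoly A) :
    bidegProj A P (MvPolynomial.X j * f) = MvPolynomial.X j * bidegProj A Q f := by
  classical
  induction f using MvPolynomial.induction_on' with
  | monomial u a =>
    rw [MvPolynomial.X, MvPolynomial.monomial_mul, bidegProj_monomial, bidegProj_monomial]
    simp only [h]
    split_ifs
    · rw [MvPolynomial.monomial_mul]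
    · simp
  | add p q hp hq => rw [mul_add, map_add, map_add, hp, hq, mul_add]

lemma pderiv_shift (P Q : ℕ → ℕ → Prop) (j : Fin 2 ⊕ Fin 2)
    (h : ∀ m, Q (degY (m + Finsupp.single j 1)) (degYBar (m + Finsupp.single j 1)) ↔
      P (degY m) (degYBar m)) (f : SpinorPoly A) :
    bidegProj A P (MvPolynomial.pderiv j f) = MvPolynomial.pderiv j (bidegProj A Q f) := by
  classical
  ext m
  rw [coeff_bidegProj, MvPolynomial.coeff_pderiv, MvPolynomial.coeff_pderiv, coeff_bidegProj]
  simp only [h]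
  split_ifs <;> simp

/-- Bidegrees are integers here so that shifts may leave the positive range, where the projection is
zero; no truncated subtraction intervenes. -/
lemma homProj_y (a b : ℤ) (i : Fin 2) (f : SpinorPoly A) :
    homProj A a b (y A i f) = y A i (homProj A (a - 1) b f) :=
  coeff_X_mul_shift _ _ _ (fun m => by
    rw [degY_add, degYBar_add, degY_inl, degYBar_inl]; push_cast; omega) f

lemma homProj_yBar (a b : ℤ) (i : Fin 2) (f : SpinorPoly A) :
    homProj A a b (yBar A i f) = yBar A i (homProj A a (b - 1) f) :=
  coeff_X_mul_shift _ _ _ (fun m => by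
    rw [degY_add, degYBar_add, degY_inr, degYBar_inr]; push_cast; omega) f

lemma homProj_dY (a b : ℤ) (i : Fin 2) (f : SpinorPoly A) :
    homProj A a b (dY A i f) = dY A i (homProj A (a + 1) b f) :=
  pderiv_shift _ _ _ (fun m => by
    rw [degY_add, degYBar_add, degY_inl, degYBar_inl]; push_cast; omega) f

lemma homProj_dYBar (a b : ℤ) (i : Fin 2) (f : SpinorPoly A) :
    homProj A a b (dYBar A i f) = dYBar A i (homProj A a (b + 1) f) :=
  pderiv_shift _ _ _ (fun m => by
    rw [degY_add, degYBar_add, degY_inr, degYBar_inr]; push_cast; omega) f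

lemma eq_zero_of_homProj {f : SpinorPoly A} (h : ∀ a b : ℤ, homProj A a b f = 0) : f = 0 := by
  classical
  ext m
  have := congrArg (MvPolynomial.coeff m) (h (degY m) (degYBar m))
  rwa [homProj, coeff_bidegProj, if_pos ⟨rfl, rfl⟩] at this

/-- Asking for all large cutoffs lets two polynomials share one cutoff in the induction. -/
lemma exists_eq_sum_homProj (f : SpinorPoly A) :
    ∃ M : ℕ, ∀ M' ≥ M, f = ∑ a ∈ Finset.range M', ∑ b ∈ Finset.range M', homProj A a b f := by
  classical
  induction f using MvPolynomial.induction_on' with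
  | monomial u c =>
    refine ⟨degY u + degYBar u + 1, fun M hM => ?_⟩
    rw [Finset.sum_eq_single (degY u), Finset.sum_eq_single (degYBar u), homProj,
      bidegProj_monomial, if_pos ⟨rfl, rfl⟩]
    · intro b _ hb
      rw [homProj, bidegProj_monomial, if_neg]
      rintro ⟨-, h⟩; omega
    · intro h; rw [Finset.mem_range] at h; omega
    · intro b _ hb
      refine Finset.sum_eq_zero fun b' _ => ?_
      rw [homProj, bidegProj_monomial, if_neg]
      rintro ⟨h, -⟩; omega
    · intro h; rw [Finset.mem_range] at h; omega
  | add p q hp hq =>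
    obtain ⟨M, h⟩ := hp
    obtain ⟨M', h'⟩ := hq
    refine ⟨max M M', fun K hK => ?_⟩
    simp only [map_add, Finset.sum_add_distrib]
    rw [← h K (le_trans (le_max_left _ _) hK), ← h' K (le_trans (le_max_right _ _) hK)]

lemma homProj_bidegProj (P : ℕ → ℕ → Prop) (a b : ℤ) (f : SpinorPoly A) :
    homProj A a b (bidegProj A P f) = bidegProj A P (homProj A a b f) := bidegProj_comm _ _ _

lemma mem_bosonicPoly {f : SpinorPoly A} : f ∈ bosonicPoly A ↔ bosonicProj A f = f := by
  refine ⟨?_, fun h => ⟨f, h⟩⟩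
  rintro ⟨g, rfl⟩
  rw [bosonicProj, bidegProj_bidegProj]
  simp only [and_self]

variable [Algebra ℂ A]

variable (A) in
/-- The action of the spinor variables and derivatives on polynomials. -/
@[simps] def polyOps : WeylOps ℂ (SpinorPoly A) where
  y i := (y A i).restrictScalars ℂ
  z i := (yBar A i).restrictScalars ℂ
  dy i := (dY A i).restrictScalars ℂ
  dz i := (dYBar A i).restrictScalars ℂ
  y_y i j m := by simp only [LinearMap.coe_restrictScalars, y_apply]; ring
  z_z i j m := by simp only [LinearMap.coe_restrictScalars, yBar_apply]; ring
  z_y i j m := by simp only [LinearMap.coe_restrictScalars, y_apply, yBar_apply]; ring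
  dy_y i j m := by
    simp only [LinearMap.coe_restrictScalars, y_apply, dY_apply, pderiv_X_mul, Sum.inl.injEq]
  dz_z i j m := by
    simp only [LinearMap.coe_restrictScalars, yBar_apply, dYBar_apply, pderiv_X_mul, Sum.inr.injEq]
  dy_z i j m := by simp
  dz_y i j m := by simp
  dy_dy i j m := by simp [pderiv_comm (Sum.inl i)]
  dz_dz i j m := by simp [pderiv_comm (Sum.inr i)]
  dz_dy i j m := by simp [pderiv_comm (Sum.inr i)]

lemma coeff_X_mul_pderiv (i : Fin 2 ⊕ Fin 2) (f : SpinorPoly A) (m : Fin 2 ⊕ Fin 2 →₀ ℕ) :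
    (MvPolynomial.X i * MvPolynomial.pderiv i f).coeff m = (m i : ℂ) • f.coeff m := by
  classical
  induction f using MvPolynomial.induction_on' with
  | monomial u a =>
    rw [MvPolynomial.X_mul_pderiv_monomial, MvPolynomial.coeff_smul, MvPolynomial.coeff_monomial]
    split_ifs with h
    · subst h; rw [Nat.cast_smul_eq_nsmul]
    · simp
  | add p q hp hq => rw [map_add, mul_add, MvPolynomial.coeff_add, hp, hq, MvPolynomial.coeff_add,
      smul_add]

/-- The Euler operator is diagonal on monomials. Only complex scalars are cancelled, so `A` may have
zero divisors. -/
lemma homY_iff (a : ℂ) (f : SpinorPoly A) :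
    (polyOps A).HomY a f ↔ ∀ m, f.coeff m ≠ 0 → (degY m : ℂ) = a := by
  rw [WeylOps.HomY, MvPolynomial.ext_iff]
  refine forall_congr' fun m => ?_
  simp only [polyOps_y, polyOps_dy, LinearMap.coe_restrictScalars, y_apply, dY_apply,
    MvPolynomial.coeff_add, coeff_X_mul_pderiv, MvPolynomial.coeff_smul, ← add_smul]
  rw [← sub_eq_zero, ← sub_smul, smul_eq_zero, sub_eq_zero, degY, Fin.sum_univ_two]
  push_cast
  tauto

lemma homZ_iff (a : ℂ) (f : SpinorPoly A) :
    (polyOps A).HomZ a f ↔ ∀ m, f.coeff m ≠ 0 → (degYBar m : ℂ) = a := by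
  rw [WeylOps.homZ_def, MvPolynomial.ext_iff]
  refine forall_congr' fun m => ?_
  simp only [polyOps_z, polyOps_dz, LinearMap.coe_restrictScalars, yBar_apply, dYBar_apply,
    MvPolynomial.coeff_add, coeff_X_mul_pderiv, MvPolynomial.coeff_smul, ← add_smul]
  rw [← sub_eq_zero, ← sub_smul, smul_eq_zero, sub_eq_zero, degYBar, Fin.sum_univ_two]
  push_cast
  tauto

lemma hom_iff (a b : ℤ) (f : SpinorPoly A) :
    (polyOps A).Hom a b f ↔ ∀ m, f.coeff m ≠ 0 → (degY m : ℤ) = a ∧ (degYBar m : ℤ) = b := by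
  rw [WeylOps.Hom, homY_iff, homZ_iff]
  simp only [← forall_and]
  refine forall_congr' fun m => ?_
  rw [← Int.cast_natCast, ← Int.cast_natCast (degYBar m), Int.cast_inj, Int.cast_inj]

lemma homProj_hom (a b : ℤ) (f : SpinorPoly A) : (polyOps A).Hom a b (homProj A a b f) := by
  classical
  rw [hom_iff]
  intro m hm
  rw [homProj, coeff_bidegProj] at hm
  by_contra h
  simp [h] at hm

lemma bidegProj_of_hom {a b : ℤ} {f : SpinorPoly A} (hf : (polyOps A).Hom a b f)
    {P : ℕ → ℕ → Prop} (h : ∀ N Nb : ℕ, (N : ℤ) = a → (Nb : ℤ) = b → P N Nb) :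
    bidegProj A P f = f := by
  classical
  ext m
  rw [coeff_bidegProj]
  rw [hom_iff] at hf
  by_cases hm : f.coeff m = 0
  · simp [hm]
  · rw [if_pos (h _ _ (hf m hm).1 (hf m hm).2)]

lemma bidegProj_of_hom_not {a b : ℤ} {f : SpinorPoly A} (hf : (polyOps A).Hom a b f)
    {P : ℕ → ℕ → Prop} (h : ∀ N Nb : ℕ, (N : ℤ) = a → (Nb : ℤ) = b → ¬ P N Nb) :
    bidegProj A P f = 0 := by
  classical
  ext m
  rw [coeff_bidegProj]
  rw [hom_iff] at hf
  by_cases hm : f.coeff m = 0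
  · simp [hm]
  · rw [if_neg (h _ _ (hf m hm).1 (hf m hm).2), MvPolynomial.coeff_zero]

lemma homProj_of_hom {a b : ℤ} {f : SpinorPoly A} (hf : (polyOps A).Hom a b f) :
    homProj A a b f = f := bidegProj_of_hom hf fun _ _ h h' => ⟨h, h'⟩

lemma eq_zero_of_hom_neg {a b : ℤ} {f : SpinorPoly A} (hf : (polyOps A).Hom a b f)
    (h : a < 0 ∨ b < 0) : f = 0 := by
  rw [← homProj_of_hom hf]
  exact bidegProj_of_hom_not hf fun _ _ h h' => by omega

lemma homProj_gt (a b : ℤ) (f : SpinorPoly A) :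
    homProj A a b (bidegProj A (fun N Nb => N > Nb) f) = if a > b then homProj A a b f else 0 := by
  rw [homProj_bidegProj]
  split_ifs with h
  · exact bidegProj_of_hom (homProj_hom a b f) fun _ _ _ _ => by omega
  · exact bidegProj_of_hom_not (homProj_hom a b f) fun _ _ _ _ => by omega

lemma homProj_lt (a b : ℤ) (f : SpinorPoly A) :
    homProj A a b (bidegProj A (fun N Nb => N < Nb) f) = if a < b then homProj A a b f else 0 := by
  rw [homProj_bidegProj]
  split_ifs with h
  · exact bidegProj_of_hom (homProj_hom a b f) fun _ _ _ _ => by omega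
  · exact bidegProj_of_hom_not (homProj_hom a b f) fun _ _ _ _ => by omega

lemma mem_bosonicPoly_of_hom {a b : ℤ} {f : SpinorPoly A} (hf : (polyOps A).Hom a b f)
    (h : Even (a - b)) : f ∈ bosonicPoly A :=
  mem_bosonicPoly.2 (bidegProj_of_hom hf fun N Nb h1 h2 => by
    rw [grading, Int.natAbs_even, h1, h2]; exact h)

lemma homProj_bosonic {f : SpinorPoly A} (hf : f ∈ bosonicPoly A) {a b : ℤ} (h : ¬ Even (a - b)) :
    homProj A a b f = 0 := by
  rw [← mem_bosonicPoly.1 hf, bosonicProj, homProj_bidegProj]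
  refine bidegProj_of_hom_not (homProj_hom a b f) fun N Nb h1 h2 => ?_
  rw [grading, Int.natAbs_even, h1, h2]; exact h

lemma mem_bosonicPoly_iff {f : SpinorPoly A} :
    f ∈ bosonicPoly A ↔ ∀ a b : ℤ, ¬ Even (a - b) → homProj A a b f = 0 := by
  refine ⟨fun h a b => homProj_bosonic h, fun h => ?_⟩
  rw [mem_bosonicPoly, ← sub_eq_zero]
  refine eq_zero_of_homProj fun a b => ?_
  rw [map_sub, bosonicProj, homProj_bidegProj]
  by_cases hab : Even (a - b)
  · rw [bidegProj_of_hom (homProj_hom a b f), sub_self]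
    intro N Nb h1 h2
    rw [grading, Int.natAbs_even, h1, h2]; exact hab
  · simp [h a b hab]

lemma mem_diagonalPoly_of_hom {a : ℂ} {f : SpinorPoly A} (hf : (polyOps A).Hom a a f) :
    f ∈ diagonalPoly A := by
  have h1 := hf.1
  have h2 := hf.2
  rw [WeylOps.HomY] at h1
  rw [WeylOps.homZ_def] at h2
  rw [diagonalPoly, LinearMap.mem_ker, LinearMap.sub_apply, Fin.sum_univ_two, Fin.sum_univ_two]
  exact sub_eq_zero.2 (h1.trans h2.symm)

lemma homProj_diagonal {f : SpinorPoly A} (hf : f ∈ diagonalPoly A) {a b : ℤ} (h : a ≠ b) :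
    homProj A a b f = 0 := by
  rw [diagonalPoly, LinearMap.mem_ker] at hf
  have h3 := congrArg (homProj A a b) hf
  simp only [Fin.sum_univ_two, LinearMap.sub_apply, LinearMap.add_apply, LinearMap.comp_apply,
    map_sub, map_add, homProj_y, homProj_yBar, homProj_dY, homProj_dYBar, sub_add_cancel,
    map_zero] at h3
  have h1 := (homProj_hom a b f).1
  have h2 := (homProj_hom a b f).2
  rw [WeylOps.HomY] at h1
  rw [WeylOps.homZ_def] at h2
  have h4 : (a : ℂ) • homProj A a b f - (b : ℂ) • homProj A a b f = 0 := by
    rw [← h1, ← h2]; exact h3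
  rw [← sub_smul] at h4
  refine (smul_eq_zero.1 h4).resolve_left (sub_ne_zero.2 ?_)
  exact_mod_cast h

lemma mem_diagonalPoly_iff {f : SpinorPoly A} :
    f ∈ diagonalPoly A ↔ ∀ a b : ℤ, a ≠ b → homProj A a b f = 0 := by
  refine ⟨fun h a b => homProj_diagonal h, fun h => ?_⟩
  obtain ⟨M, hM⟩ := exists_eq_sum_homProj f
  rw [hM M le_rfl]
  refine Submodule.sum_mem _ fun a _ => Submodule.sum_mem _ fun b _ => ?_
  by_cases hab : (a : ℤ) = b
  · rw [hab]; exact mem_diagonalPoly_of_hom (homProj_hom _ _ _)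
  · rw [h _ _ hab]; exact zero_mem _

lemma diagonalPoly_le_bosonicPoly : diagonalPoly A ≤ bosonicPoly A := fun f hf =>
  mem_bosonicPoly_iff.2 fun a b h => homProj_diagonal hf (by rintro rfl; simp at h)

lemma bidegProj_gt_diagonal {f : SpinorPoly A} (hf : f ∈ diagonalPoly A) :
    bidegProj A (fun N Nb => N > Nb) f = 0 :=
  eq_zero_of_homProj fun a b => by
    rw [homProj_gt]
    split_ifs with h
    · exact homProj_diagonal hf (by omega)
    · rfl

lemma bidegProj_lt_diagonal {f : SpinorPoly A} (hf : f ∈ diagonalPoly A) :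
    bidegProj A (fun N Nb => N < Nb) f = 0 :=
  eq_zero_of_homProj fun a b => by
    rw [homProj_lt]
    split_ifs with h
    · exact homProj_diagonal hf (by omega)
    · rfl

end Polynomials

/-! ### Components of forms in the vierbein basis -/

section FormComponents
variable {A : Type*} [CommRing A] {L : Type*} [AddCommGroup L] [Module A L]
  (h : Module.Basis (Fin 2 × Fin 2) A L)

lemma hUU_anticomm (α β γ δ : Fin 2) : hUU h α β * hUU h γ δ = -(hUU h γ δ * hUU h α β) :=
  eq_neg_of_add_eq_zero_left (ExteriorAlgebra.ι_add_mul_swap _ _)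

lemma hUU_anticomm_mul (α β γ δ : Fin 2) (x : ExteriorAlgebra A L) :
    hUU h α β * (hUU h γ δ * x) = -(hUU h γ δ * (hUU h α β * x)) := by
  rw [← mul_assoc, hUU_anticomm, neg_mul, mul_assoc]

lemma hUU_sq (α β : Fin 2) : hUU h α β * hUU h α β = 0 := ExteriorAlgebra.ι_sq_zero _

lemma hUU_sq_mul (α β : Fin 2) (x : ExteriorAlgebra A L) :
    hUU h α β * (hUU h α β * x) = 0 := by
  rw [← mul_assoc, hUU_sq, zero_mul]

lemma H2_eq (μ ν : Fin 2) :
    H2 h μ ν = hUU h μ 0 * hUU h ν 1 - hUU h μ 1 * hUU h ν 0 := by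
  simp [H2, hUD, eps, sub_eq_neg_add]

lemma H2Bar_eq (μ ν : Fin 2) :
    H2Bar h μ ν = hUU h 0 μ * hUU h 1 ν - hUU h 1 μ * hUU h 0 ν := by
  simp [H2Bar, hDU, eps, sub_eq_neg_add]

/-- The three-forms dual to the vierbein. -/
def H3 (α β : Fin 2) : ExteriorAlgebra A L :=
  if α = 0 then -(hUU h 1 β * (hUU h 0 0 * hUU h 0 1)) else hUU h 0 β * (hUU h 1 0 * hUU h 1 1)

/-- The one-form with components `f`. -/
def oneForm (f : Fin 2 → Fin 2 → SpinorPoly A) : SpinorForm A L :=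
  ∑ α, ∑ β, hUU h α β ⊗ₜ[A] f α β

/-- The two-form with undotted components `U` and dotted components `V`. -/
def twoForm (U V : Fin 2 → Fin 2 → SpinorPoly A) : SpinorForm A L :=
  ∑ α, ∑ β, (H2 h α β ⊗ₜ[A] U α β + H2Bar h α β ⊗ₜ[A] V α β)

/-- The three-form with components `f`. -/
def triForm (f : Fin 2 → Fin 2 → SpinorPoly A) : SpinorForm A L :=
  ∑ α, ∑ β, H3 h α β ⊗ₜ[A] f α β

/-- The Fierz rearrangement: a product of two vierbeins is antisymmetric under exchange of index
pairs, hence symmetric in one kind of index and proportional to `ε` in the other. The factor `4`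
clears denominators. -/
lemma sum_mul_tmul_one (g : Fin 2 → Fin 2 → Fin 2 → Fin 2 → SpinorPoly A) :
    ∑ γ, ∑ δ, ∑ α, ∑ β, (hUU h α β * hUU h γ δ) ⊗ₜ[A] ((4 : ℕ) • g α β γ δ) =
      twoForm h (fun α γ => g α 0 γ 1 - g α 1 γ 0 + (g γ 0 α 1 - g γ 1 α 0))
        (fun β δ => g 0 β 1 δ - g 1 β 0 δ + (g 0 δ 1 β - g 1 δ 0 β)) := by
  simp only [twoForm, H2_eq, H2Bar_eq, Fin.sum_univ_two, hUU_sq, hUU_anticomm h 0 1 0 0,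
    hUU_anticomm h 1 0 0 0, hUU_anticomm h 1 0 0 1, hUU_anticomm h 1 1 0 0,
    hUU_anticomm h 1 1 0 1, hUU_anticomm h 1 1 1 0, TensorProduct.sub_tmul, TensorProduct.neg_tmul,
    TensorProduct.tmul_add, TensorProduct.tmul_sub, TensorProduct.tmul_smul,
    TensorProduct.zero_tmul]
  module

/-- Three-forms are again bispinors, so wedging with a vierbein keeps only the `ε`-contraction of
its undotted index with `U` and of its dotted index with `V`. -/
lemma sum_mul_tmul_two {U V : Fin 2 → Fin 2 → Fin 2 → Fin 2 → SpinorPoly A}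
    (hU : ∀ α β γ δ, U α β γ δ = U α β δ γ) (hV : ∀ α β γ δ, V α β γ δ = V α β δ γ) :
    ∑ γ, ∑ δ, ((∑ α, ∑ β, (hUU h α β * H2 h γ δ) ⊗ₜ[A] U α β γ δ) +
      ∑ α, ∑ β, (hUU h α β * H2Bar h γ δ) ⊗ₜ[A] V α β γ δ) =
      triForm h (fun γ φ => (2 : ℕ) • (U 0 φ 1 γ - U 1 φ 0 γ - (V γ 0 1 φ - V γ 1 0 φ))) := by
  simp only [triForm, H3, H2_eq, H2Bar_eq, Fin.sum_univ_two, hUU_sq, hUU_sq_mul, mul_sub,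
    hUU_anticomm h 0 1 0 0,
    hUU_anticomm h 1 0 0 0, hUU_anticomm h 1 0 0 1, hUU_anticomm h 1 1 0 0,
    hUU_anticomm h 1 1 0 1, hUU_anticomm h 1 1 1 0, hUU_anticomm_mul h 0 1 0 0,
    hUU_anticomm_mul h 1 0 0 0, hUU_anticomm_mul h 1 0 0 1, hUU_anticomm_mul h 1 1 0 0,
    hUU_anticomm_mul h 1 1 0 1, hUU_anticomm_mul h 1 1 1 0, mul_neg, mul_zero, neg_zero, neg_neg,
    TensorProduct.sub_tmul, TensorProduct.neg_tmul,
    TensorProduct.tmul_sub, TensorProduct.tmul_smul,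
    TensorProduct.zero_tmul, hU _ _ 1 0, hV _ _ 1 0, if_true, one_ne_zero, if_false]
  module

/-! ### Components -/

/-- Evaluation of a form on a linear functional of the exterior algebra. -/
def evalForm (F : ExteriorAlgebra A L →ₗ[A] A) : SpinorForm A L →ₗ[A] SpinorPoly A :=
  (TensorProduct.lid A (SpinorPoly A)).toLinearMap ∘ₗ F.rTensor (SpinorPoly A)

@[simp] lemma evalForm_tmul (F : ExteriorAlgebra A L →ₗ[A] A) (θ : ExteriorAlgebra A L)
    (f : SpinorPoly A) : evalForm F (θ ⊗ₜ f) = F θ • f := by simp [evalForm]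

/-- The contraction with the dual basis. -/
def contr (a : Fin 2 × Fin 2) : ExteriorAlgebra A L →ₗ[A] ExteriorAlgebra A L :=
  CliffordAlgebra.contractLeft (Q := (0 : QuadraticForm A L)) (h.coord a)

lemma contr_hUU_mul (a : Fin 2 × Fin 2) (α β : Fin 2) (x : ExteriorAlgebra A L) :
    contr h a (hUU h α β * x) = (if (α, β) = a then x else 0) - hUU h α β * contr h a x := by
  have := CliffordAlgebra.contractLeft_ι_mul (Q := (0 : QuadraticForm A L))
    (d := h.coord a) (h (α, β)) x
  rw [Module.Basis.coord_apply, Module.Basis.repr_self, Finsupp.single_apply] at this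
  rw [contr]
  refine this.trans ?_
  split_ifs <;> simp <;> rfl

lemma contr_one (a : Fin 2 × Fin 2) : contr h a 1 = 0 :=
  CliffordAlgebra.contractLeft_one (Q := (0 : QuadraticForm A L)) _

lemma contr_hUU (a : Fin 2 × Fin 2) (α β : Fin 2) :
    contr h a (hUU h α β) = if (α, β) = a then 1 else 0 := by
  have := contr_hUU_mul h a α β 1
  rw [mul_one] at this
  rw [this, contr_one, mul_zero, sub_zero]

variable (A L) in
/-- The projection of the exterior algebra onto scalars. -/
def scalarPart : ExteriorAlgebra A L →ₗ[A] A := ExteriorAlgebra.algebraMapInv.toLinearMap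

lemma scalarPart_one : scalarPart A L 1 = 1 := map_one ExteriorAlgebra.algebraMapInv

lemma oneForm_eq_zero {f : Fin 2 → Fin 2 → SpinorPoly A} (hf : oneForm h f = 0) (i j : Fin 2) :
    f i j = 0 := by
  have := congrArg (evalForm (scalarPart A L ∘ₗ contr h (i, j))) hf
  simp only [oneForm, map_sum, evalForm_tmul, LinearMap.comp_apply, contr_hUU] at this
  fin_cases i <;> fin_cases j <;> simpa [scalarPart_one] using this

/-- Contractions with pairs of dual basis vectors read off the coefficients. The components `U 0 1`
and `V 0 1` appear only through their sum and difference, which is one place where `2` must be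
invertible. -/
lemma twoForm_eq_zero [Algebra ℂ A] {U V : Fin 2 → Fin 2 → SpinorPoly A}
    (hU : ∀ i j, U i j = U j i) (hV : ∀ i j, V i j = V j i) (hf : twoForm h U V = 0) (i j : Fin 2) :
    U i j = 0 ∧ V i j = 0 := by
  have key := fun a b => congrArg (evalForm (scalarPart A L ∘ₗ contr h b ∘ₗ contr h a)) hf
  simp only [twoForm, map_add, evalForm_tmul, LinearMap.comp_apply, H2_eq, H2Bar_eq,
    map_sub, contr_hUU_mul, contr_hUU, Fin.sum_univ_two, map_zero] at key
  have k1 := key (0, 0) (0, 1)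
  have k2 := key (1, 0) (1, 1)
  have k3 := key (0, 0) (1, 1)
  have k4 := key (0, 1) (1, 0)
  have k5 := key (0, 0) (1, 0)
  have k6 := key (0, 1) (1, 1)
  simp [contr_hUU, contr_one, scalarPart_one, hU 1 0, hV 1 0, add_smul] at k1 k2 k3 k4 k5 k6
  have d : ∀ x : SpinorPoly A, x + x = 0 → x = 0 := fun x hx => by
    rw [← two_smul ℂ] at hx
    exact (smul_eq_zero.1 hx).resolve_left two_ne_zero
  have e3 : U 0 1 + V 0 1 = 0 := d _ (by linear_combination k3)
  have e4 : V 0 1 - U 0 1 = 0 := d _ (by linear_combination k4)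
  have e5 : V 0 1 = 0 := d _ (by linear_combination e3 + e4)
  have e6 : U 0 1 = 0 := by linear_combination e3 - e5
  fin_cases i <;> fin_cases j
  · exact ⟨d _ k1, d _ k5⟩
  · exact ⟨e6, e5⟩
  · exact ⟨(hU 1 0).trans e6, (hV 1 0).trans e5⟩
  · exact ⟨d _ k2, d _ k6⟩

lemma triForm_eq_zero {f : Fin 2 → Fin 2 → SpinorPoly A} (hf : triForm h f = 0) (i j : Fin 2) :
    f i j = 0 := by
  have key := fun a b c =>
    congrArg (evalForm (scalarPart A L ∘ₗ contr h c ∘ₗ contr h b ∘ₗ contr h a)) hf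
  have k1 := key (0, 0) (1, 0) (1, 1)
  have k2 := key (0, 1) (1, 0) (1, 1)
  have k3 := key (1, 0) (0, 0) (0, 1)
  have k4 := key (1, 1) (0, 0) (0, 1)
  simp [triForm, H3, contr_hUU_mul, contr_hUU, scalarPart_one] at k1 k2 k3 k4
  fin_cases i <;> fin_cases j <;> assumption

/-! ### Bosonic forms -/

lemma tmul_mem_bosonicForms {p : ℕ} {θ : ExteriorAlgebra A L} (hθ : θ ∈ ⋀[A]^p L)
    {f : SpinorPoly A} (hf : f ∈ bosonicPoly A) : θ ⊗ₜ[A] f ∈ bosonicForms A L p := by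
  obtain ⟨g, rfl⟩ := hf
  exact ⟨(⟨θ, hθ⟩ : ⋀[A]^p L) ⊗ₜ g, by simp⟩

lemma bosonicForms_le {p : ℕ} {S : Submodule A (SpinorForm A L)}
    (H : ∀ θ ∈ ⋀[A]^p L, ∀ f ∈ bosonicPoly A, θ ⊗ₜ[A] f ∈ S) : bosonicForms A L p ≤ S := by
  rintro _ ⟨t, rfl⟩
  induction t with
  | zero => simp
  | tmul θ f => exact H θ θ.2 _ ⟨f, rfl⟩
  | add x y hx hy => rw [map_add]; exact add_mem hx hy

lemma hUU_mem (α β : Fin 2) : hUU h α β ∈ ⋀[A]^1 L := by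
  rw [ExteriorAlgebra.exteriorPower, pow_one]; exact ⟨_, rfl⟩

lemma hUU_mul_mem {p : ℕ} (α β : Fin 2) {θ : ExteriorAlgebra A L} (hθ : θ ∈ ⋀[A]^p L) :
    hUU h α β * θ ∈ ⋀[A]^(p + 1) L := by
  rw [ExteriorAlgebra.exteriorPower, pow_succ']
  exact Submodule.mul_mem_mul ⟨_, rfl⟩ hθ

lemma hUU_mul_hUU_mem (α β γ δ : Fin 2) : hUU h α β * hUU h γ δ ∈ ⋀[A]^2 L :=
  hUU_mul_mem h α β (hUU_mem h γ δ)

lemma oneForm_mem {f : Fin 2 → Fin 2 → SpinorPoly A} (hf : ∀ i j, f i j ∈ bosonicPoly A) :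
    oneForm h f ∈ bosonicForms A L 1 :=
  Submodule.sum_mem _ fun i _ => Submodule.sum_mem _ fun j _ =>
    tmul_mem_bosonicForms (hUU_mem h i j) (hf i j)

lemma twoForm_mem {U V : Fin 2 → Fin 2 → SpinorPoly A} (hU : ∀ i j, U i j ∈ bosonicPoly A)
    (hV : ∀ i j, V i j ∈ bosonicPoly A) : twoForm h U V ∈ bosonicForms A L 2 := by
  refine Submodule.sum_mem _ fun i _ => Submodule.sum_mem _ fun j _ => add_mem
    (tmul_mem_bosonicForms ?_ (hU i j)) (tmul_mem_bosonicForms ?_ (hV i j))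
  · rw [H2_eq]; exact sub_mem (hUU_mul_hUU_mem h _ _ _ _) (hUU_mul_hUU_mem h _ _ _ _)
  · rw [H2Bar_eq]; exact sub_mem (hUU_mul_hUU_mem h _ _ _ _) (hUU_mul_hUU_mem h _ _ _ _)

lemma exists_zeroForm {ω : SpinorForm A L} (hω : ω ∈ bosonicForms A L 0) :
    ∃ f ∈ bosonicPoly A, ω = 1 ⊗ₜ f := by
  have : bosonicForms A L 0 ≤ (bosonicPoly A).map (TensorProduct.mk A _ _ 1) := by
    refine bosonicForms_le fun θ hθ f hf => ?_
    rw [ExteriorAlgebra.exteriorPower, pow_zero] at hθ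
    obtain ⟨a, rfl⟩ := Submodule.mem_one.1 hθ
    refine ⟨a • f, Submodule.smul_mem _ _ hf, ?_⟩
    rw [Algebra.algebraMap_eq_smul_one, TensorProduct.smul_tmul]; rfl
  obtain ⟨f, hf, e⟩ := this hω
  exact ⟨f, hf, e.symm⟩

lemma zeroForm_mem {g : SpinorPoly A} (hg : g ∈ bosonicPoly A) :
    (1 : ExteriorAlgebra A L) ⊗ₜ[A] g ∈ bosonicForms A L 0 := by
  refine tmul_mem_bosonicForms ?_ hg
  rw [ExteriorAlgebra.exteriorPower, pow_zero]; exact Submodule.one_le.1 le_rfl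

lemma oneForm_zero : oneForm h (fun _ _ => 0) = 0 := by simp [oneForm]

lemma oneForm_add (f g : Fin 2 → Fin 2 → SpinorPoly A) :
    oneForm h (fun i j => f i j + g i j) = oneForm h f + oneForm h g := by
  simp only [oneForm, TensorProduct.tmul_add, Finset.sum_add_distrib]

lemma oneForm_sub (f g : Fin 2 → Fin 2 → SpinorPoly A) :
    oneForm h (fun i j => f i j - g i j) = oneForm h f - oneForm h g := by
  simp only [oneForm, TensorProduct.tmul_sub, Finset.sum_sub_distrib]

lemma oneForm_smul (c : A) (f : Fin 2 → Fin 2 → SpinorPoly A) :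
    oneForm h (fun i j => c • f i j) = c • oneForm h f := by
  simp only [oneForm, TensorProduct.tmul_smul, Finset.smul_sum]

lemma twoForm_add (U V U' V' : Fin 2 → Fin 2 → SpinorPoly A) :
    twoForm h (fun i j => U i j + U' i j) (fun i j => V i j + V' i j) =
      twoForm h U V + twoForm h U' V' := by
  simp only [twoForm, TensorProduct.tmul_add, Finset.sum_add_distrib]
  abel

lemma twoForm_sub (U V U' V' : Fin 2 → Fin 2 → SpinorPoly A) :
    twoForm h (fun i j => U i j - U' i j) (fun i j => V i j - V' i j) =
      twoForm h U V - twoForm h U' V' := by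
  simp only [twoForm, TensorProduct.tmul_sub, Finset.sum_add_distrib, Finset.sum_sub_distrib]
  abel

lemma twoForm_smul (c : A) (U V : Fin 2 → Fin 2 → SpinorPoly A) :
    twoForm h (fun i j => c • U i j) (fun i j => c • V i j) = c • twoForm h U V := by
  simp only [twoForm, TensorProduct.tmul_smul, ← smul_add, Finset.smul_sum]

lemma exists_tmul_one {θ : ExteriorAlgebra A L} (hθ : θ ∈ LinearMap.range (ExteriorAlgebra.ι A)) :
    ∃ c : Fin 2 → Fin 2 → A, θ = ∑ α, ∑ β, c α β • hUU h α β := by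
  obtain ⟨x, rfl⟩ := hθ
  refine ⟨fun α β => h.repr x (α, β), ?_⟩
  conv_lhs => rw [← h.sum_repr x]
  simp only [map_sum, map_smul, Fintype.sum_prod_type]
  rfl

lemma exists_oneForm {ω : SpinorForm A L} (hω : ω ∈ bosonicForms A L 1) :
    ∃ f : Fin 2 → Fin 2 → SpinorPoly A, (∀ i j, f i j ∈ bosonicPoly A) ∧ ω = oneForm h f := by
  let S : Submodule A (SpinorForm A L) :=
    { carrier := {ω | ∃ f : Fin 2 → Fin 2 → SpinorPoly A, (∀ i j, f i j ∈ bosonicPoly A) ∧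
        ω = oneForm h f}
      add_mem' := by
        rintro _ _ ⟨f, hf, rfl⟩ ⟨g, hg, rfl⟩
        exact ⟨_, fun i j => add_mem (hf i j) (hg i j), (oneForm_add h f g).symm⟩
      zero_mem' := ⟨fun _ _ => 0, fun _ _ => zero_mem _, by simp [oneForm]⟩
      smul_mem' := by
        rintro c _ ⟨f, hf, rfl⟩
        exact ⟨_, fun i j => Submodule.smul_mem _ c (hf i j), (oneForm_smul h c f).symm⟩ }
  refine (bosonicForms_le (S := S) fun θ hθ f hf => ?_) hω
  rw [ExteriorAlgebra.exteriorPower, pow_one] at hθ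
  obtain ⟨c, rfl⟩ := exists_tmul_one h hθ
  exact ⟨fun α β => c α β • f, fun i j => Submodule.smul_mem _ _ hf, by
    simp only [oneForm, TensorProduct.sum_tmul, TensorProduct.smul_tmul]⟩

lemma exists_twoForm [Algebra ℂ A] {ω : SpinorForm A L} (hω : ω ∈ bosonicForms A L 2) :
    ∃ U V : Fin 2 → Fin 2 → SpinorPoly A, (∀ i j, U i j ∈ bosonicPoly A) ∧
      (∀ i j, V i j ∈ bosonicPoly A) ∧ (∀ i j, U i j = U j i) ∧ (∀ i j, V i j = V j i) ∧
      ω = twoForm h U V := by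
  let S : Submodule A (SpinorForm A L) :=
    { carrier := {ω | ∃ U V : Fin 2 → Fin 2 → SpinorPoly A, (∀ i j, U i j ∈ bosonicPoly A) ∧
        (∀ i j, V i j ∈ bosonicPoly A) ∧ (∀ i j, U i j = U j i) ∧ (∀ i j, V i j = V j i) ∧
        ω = twoForm h U V}
      add_mem' := by
        rintro _ _ ⟨U, V, a, b, c, d, rfl⟩ ⟨U', V', a', b', c', d', rfl⟩
        exact ⟨_, _, fun i j => add_mem (a i j) (a' i j), fun i j => add_mem (b i j) (b' i j),
          fun i j => by rw [c, c'], fun i j => by rw [d, d'], (twoForm_add h U V U' V').symm⟩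
      zero_mem' := ⟨fun _ _ => 0, fun _ _ => 0, fun _ _ => zero_mem _, fun _ _ => zero_mem _,
        fun _ _ => rfl, fun _ _ => rfl, by simp [twoForm]⟩
      smul_mem' := by
        rintro k _ ⟨U, V, a, b, c, d, rfl⟩
        exact ⟨_, _, fun i j => Submodule.smul_mem _ k (a i j),
          fun i j => Submodule.smul_mem _ k (b i j), fun i j => by rw [c], fun i j => by rw [d],
          (twoForm_smul h k U V).symm⟩ }
  refine (bosonicForms_le (S := S) fun θ hθ f hf => ?_) hω
  rw [ExteriorAlgebra.exteriorPower, pow_two] at hθ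
  induction hθ using Submodule.mul_induction_on' with
  | add x _ y _ hx hy => rw [TensorProduct.add_tmul]; exact add_mem hx hy
  | mem_mul_mem x hx y hy =>
    obtain ⟨c, rfl⟩ := exists_tmul_one h hx
    obtain ⟨d, rfl⟩ := exists_tmul_one h hy
    -- The scalar `1/4` absorbs the factor `4` of the Fierz identity.
    have := sum_mul_tmul_one h (fun α β γ δ =>
      (4⁻¹ : ℂ) • (c α β * d γ δ) • f)
    have e : ∀ g : SpinorPoly A, (4 : ℕ) • (4⁻¹ : ℂ) • g = g := fun g => by
      rw [← Nat.cast_smul_eq_nsmul ℂ, smul_smul]; norm_num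
    simp only [e] at this
    have e' : (((∑ α, ∑ β, c α β • hUU h α β) * ∑ α, ∑ β, d α β • hUU h α β) ⊗ₜ[A] f :
        SpinorForm A L) = ∑ γ, ∑ δ, ∑ α, ∑ β, (hUU h α β * hUU h γ δ) ⊗ₜ[A]
          ((c α β * d γ δ) • f) := by
      simp only [← TensorProduct.smul_tmul, ← TensorProduct.sum_tmul, Finset.mul_sum,
        Finset.sum_mul, smul_mul_smul_comm]
    rw [e', this]
    have hs : ∀ (z : ℂ) (a : A), z • a • f ∈ bosonicPoly A := fun z a => by
      rw [← algebraMap_smul A z]; exact Submodule.smul_mem _ _ (Submodule.smul_mem _ _ hf)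
    exact ⟨_, _, fun i j => add_mem (sub_mem (hs _ _) (hs _ _)) (sub_mem (hs _ _) (hs _ _)),
      fun i j => add_mem (sub_mem (hs _ _) (hs _ _)) (sub_mem (hs _ _) (hs _ _)),
      fun i j => add_comm _ _, fun i j => add_comm _ _, rfl⟩

end FormComponents

/-! ### Bidegree projections and the coefficients of `σ₋` -/

section Projections
variable {A : Type*} [CommRing A] [Algebra ℂ A]

open WeylOps

lemma homProj_smul (a b : ℤ) (c : ℂ) (m : SpinorPoly A) :
    homProj A a b (c • m) = c • homProj A a b m :=
  ((homProj A a b).restrictScalars ℂ).map_smul c m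

lemma homProj_polyOps_y (a b : ℤ) (i : Fin 2) (m : SpinorPoly A) :
    homProj A a b ((polyOps A).y i m) = (polyOps A).y i (homProj A (a - 1) b m) :=
  homProj_y a b i m
lemma homProj_polyOps_z (a b : ℤ) (i : Fin 2) (m : SpinorPoly A) :
    homProj A a b ((polyOps A).z i m) = (polyOps A).z i (homProj A a (b - 1) m) :=
  homProj_yBar a b i m
lemma homProj_polyOps_dy (a b : ℤ) (i : Fin 2) (m : SpinorPoly A) :
    homProj A a b ((polyOps A).dy i m) = (polyOps A).dy i (homProj A (a + 1) b m) :=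
  homProj_dY a b i m
lemma homProj_polyOps_dz (a b : ℤ) (i : Fin 2) (m : SpinorPoly A) :
    homProj A a b ((polyOps A).dz i m) = (polyOps A).dz i (homProj A a (b + 1) m) :=
  homProj_dYBar a b i m

lemma homProj_yt (a b : ℤ) (i : Fin 2) (m : SpinorPoly A) :
    homProj A a b ((polyOps A).yt i m) = (polyOps A).yt i (homProj A (a - 1) b m) := by
  fin_cases i
  · exact homProj_polyOps_y a b 1 m
  · exact (map_neg _ _).trans (congrArg Neg.neg (homProj_polyOps_y a b 0 m))
lemma homProj_zt (a b : ℤ) (i : Fin 2) (m : SpinorPoly A) :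
    homProj A a b ((polyOps A).zt i m) = (polyOps A).zt i (homProj A a (b - 1) m) := by
  fin_cases i
  · exact homProj_polyOps_z a b 1 m
  · exact (map_neg _ _).trans (congrArg Neg.neg (homProj_polyOps_z a b 0 m))

lemma homProj_yDot (a b : ℤ) (φ : Fin 2 → SpinorPoly A) :
    homProj A a b ((polyOps A).yDot φ) = (polyOps A).yDot fun i => homProj A (a - 1) b (φ i) := by
  simp only [yDot, map_add, homProj_polyOps_y]
lemma homProj_zDot (a b : ℤ) (φ : Fin 2 → SpinorPoly A) :
    homProj A a b ((polyOps A).zDot φ) = (polyOps A).zDot fun i => homProj A a (b - 1) (φ i) := by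
  simp only [zDot_def, map_add, homProj_polyOps_z]
lemma homProj_yCurl (a b : ℤ) (φ : Fin 2 → SpinorPoly A) :
    homProj A a b ((polyOps A).yCurl φ) =
      (polyOps A).yCurl fun i => homProj A (a + 1) b (φ i) := by
  simp only [yCurl, map_sub, homProj_polyOps_dy]
lemma homProj_zCurl (a b : ℤ) (φ : Fin 2 → SpinorPoly A) :
    homProj A a b ((polyOps A).zCurl φ) =
      (polyOps A).zCurl fun i => homProj A a (b + 1) (φ i) := by
  simp only [zCurl_def, map_sub, homProj_polyOps_dz]

lemma homProj_symU (a b : ℤ) (f : Fin 2 → Fin 2 → SpinorPoly A) (α γ : Fin 2) :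
    homProj A a b ((polyOps A).symU f α γ) =
      (polyOps A).symU (fun i j => homProj A (a + 1) (b - 1) (f i j)) α γ := by
  simp only [symU, map_add, homProj_polyOps_dy, homProj_zDot]
lemma homProj_symV (a b : ℤ) (f : Fin 2 → Fin 2 → SpinorPoly A) (α γ : Fin 2) :
    homProj A a b ((polyOps A).symV f α γ) =
      (polyOps A).symV (fun i j => homProj A (a + 1) (b - 1) (f i j)) α γ := by
  simp only [symV, map_add, homProj_zt, homProj_yCurl]
lemma homProj_swap_symU (a b : ℤ) (f : Fin 2 → Fin 2 → SpinorPoly A) (α γ : Fin 2) :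
    homProj A a b ((polyOps A).swap.symU f α γ) =
      (polyOps A).swap.symU (fun i j => homProj A (a - 1) (b + 1) (f i j)) α γ := by
  simp only [symU, map_add, swap_dy, swap_zDot, homProj_polyOps_dz, homProj_yDot]
lemma homProj_swap_symV (a b : ℤ) (f : Fin 2 → Fin 2 → SpinorPoly A) (α γ : Fin 2) :
    homProj A a b ((polyOps A).swap.symV f α γ) =
      (polyOps A).swap.symV (fun i j => homProj A (a - 1) (b + 1) (f i j)) α γ := by
  simp only [symV, map_add, swap_zt, swap_yCurl, homProj_yt, homProj_zCurl]
lemma homProj_threeForm (a b : ℤ) (U V : Fin 2 → Fin 2 → SpinorPoly A) (α γ : Fin 2) :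
    homProj A a b ((polyOps A).threeForm U V α γ) =
      (polyOps A).threeForm (fun i j => homProj A (a + 1) (b - 1) (U i j))
        (fun i j => homProj A (a + 1) (b - 1) (V i j)) α γ := by
  simp only [threeForm, map_sub, homProj_zt, homProj_yCurl, homProj_polyOps_dy, homProj_zDot]
lemma homProj_swap_threeForm (a b : ℤ) (U V : Fin 2 → Fin 2 → SpinorPoly A) (α γ : Fin 2) :
    homProj A a b ((polyOps A).swap.threeForm U V α γ) =
      (polyOps A).swap.threeForm (fun i j => homProj A (a - 1) (b + 1) (U i j))
        (fun i j => homProj A (a - 1) (b + 1) (V i j)) α γ := by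
  simp only [threeForm, map_sub, swap_zt, swap_yCurl, swap_dy, swap_zDot, homProj_yt,
    homProj_zCurl, homProj_polyOps_dz, homProj_yDot]

variable (A) in
/-- The part of a polynomial with `N > N̄`. -/
def gtProj : SpinorPoly A →ₗ[A] SpinorPoly A := bidegProj A fun N Nb => N > Nb

variable (A) in
/-- The part of a polynomial with `N < N̄`. -/
def ltProj : SpinorPoly A →ₗ[A] SpinorPoly A := bidegProj A fun N Nb => N < Nb

lemma homProj_gtProj (a b : ℤ) (f : SpinorPoly A) :
    homProj A a b (gtProj A f) = if a > b then homProj A a b f else 0 := homProj_gt a b f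
lemma homProj_ltProj (a b : ℤ) (f : SpinorPoly A) :
    homProj A a b (ltProj A f) = if a < b then homProj A a b f else 0 := homProj_lt a b f
lemma gtProj_of_hom {a b : ℤ} {f : SpinorPoly A} (hf : (polyOps A).Hom a b f) :
    gtProj A f = if a > b then f else 0 := by
  split_ifs with h
  · exact bidegProj_of_hom hf fun _ _ _ _ => by omega
  · exact bidegProj_of_hom_not hf fun _ _ _ _ => by omega
lemma ltProj_of_hom {a b : ℤ} {f : SpinorPoly A} (hf : (polyOps A).Hom a b f) :
    ltProj A f = if a < b then f else 0 := by
  split_ifs with h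
  · exact bidegProj_of_hom hf fun _ _ _ _ => by omega
  · exact bidegProj_of_hom_not hf fun _ _ _ _ => by omega

lemma smul_mem_of_complex (S : Submodule A (SpinorPoly A)) (c : ℂ) {f : SpinorPoly A}
    (hf : f ∈ S) : c • f ∈ S := by
  rw [← algebraMap_smul A c]; exact S.smul_mem _ hf

variable (A) in
/-- The coefficient of `h^{αβ'}` in `σ₋` of a polynomial. -/
def sigmaCoef (α β : Fin 2) : SpinorPoly A →ₗ[ℂ] SpinorPoly A :=
  Complex.I • ((polyOps A).zt β ∘ₗ (polyOps A).dy α ∘ₗ (gtProj A).restrictScalars ℂ +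
    (polyOps A).yt α ∘ₗ (polyOps A).dz β ∘ₗ (ltProj A).restrictScalars ℂ)

lemma sigmaCoef_apply (α β : Fin 2) (f : SpinorPoly A) :
    sigmaCoef A α β f = Complex.I • ((polyOps A).zt β ((polyOps A).dy α (gtProj A f)) +
      (polyOps A).yt α ((polyOps A).dz β (ltProj A f))) := rfl

lemma sigmaCoef_of_gt {a b : ℤ} {f : SpinorPoly A} (hf : (polyOps A).Hom a b f) (h : a > b)
    (α β : Fin 2) :
    sigmaCoef A α β f = Complex.I • (polyOps A).zt β ((polyOps A).dy α f) := by
  rw [sigmaCoef_apply, gtProj_of_hom hf, ltProj_of_hom hf, if_pos h, if_neg (by omega)]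
  simp

lemma sigmaCoef_of_lt {a b : ℤ} {f : SpinorPoly A} (hf : (polyOps A).Hom a b f) (h : a < b)
    (α β : Fin 2) :
    sigmaCoef A α β f = Complex.I • (polyOps A).yt α ((polyOps A).dz β f) := by
  rw [sigmaCoef_apply, gtProj_of_hom hf, ltProj_of_hom hf, if_pos h, if_neg (by omega)]
  simp

lemma sigmaCoef_of_eq {a : ℤ} {f : SpinorPoly A} (hf : (polyOps A).Hom a a f) (α β : Fin 2) :
    sigmaCoef A α β f = 0 := by
  simp [sigmaCoef_apply, gtProj_of_hom hf, ltProj_of_hom hf]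

lemma hom_zt_dy {a b : ℤ} {f : SpinorPoly A} (hf : (polyOps A).Hom a b f) (α β : Fin 2) :
    (polyOps A).Hom ((a - 1 : ℤ) : ℂ) ((b + 1 : ℤ) : ℂ)
      ((polyOps A).zt β ((polyOps A).dy α f)) :=
  ((hf.dy α).zt β).congr (by push_cast; ring) (by push_cast; ring)

lemma hom_yt_dz {a b : ℤ} {f : SpinorPoly A} (hf : (polyOps A).Hom a b f) (α β : Fin 2) :
    (polyOps A).Hom ((a + 1 : ℤ) : ℂ) ((b - 1 : ℤ) : ℂ)
      ((polyOps A).yt α ((polyOps A).dz β f)) :=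
  ((hf.dz β).yt α).congr (by push_cast; ring) (by push_cast; ring)

lemma bosonic_induction {p : SpinorPoly A → Prop} (h0 : p 0)
    (hadd : ∀ f g, p f → p g → p (f + g))
    (hom : ∀ (a b : ℤ) f, Even (a - b) → (polyOps A).Hom a b f → p f) {f : SpinorPoly A}
    (hf : f ∈ bosonicPoly A) : p f := by
  obtain ⟨M, hM⟩ := exists_eq_sum_homProj f
  rw [hM M le_rfl]
  refine Finset.sum_induction _ p hadd h0 fun a _ => Finset.sum_induction _ p hadd h0 fun b _ => ?_
  by_cases hab : Even ((a : ℤ) - b)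
  · exact hom a b _ hab (homProj_hom _ _ _)
  · rw [homProj_bosonic hf hab]; exact h0

lemma sigmaCoef_mem {f : SpinorPoly A} (hf : f ∈ bosonicPoly A) (α β : Fin 2) :
    sigmaCoef A α β f ∈ bosonicPoly A := by
  refine bosonic_induction (p := fun f => sigmaCoef A α β f ∈ bosonicPoly A) (by simp)
    (fun f g h1 h2 => by rw [map_add]; exact add_mem h1 h2) (fun a b f hab hf => ?_) hf
  rcases lt_trichotomy a b with h | rfl | h
  · rw [sigmaCoef_of_lt hf h]
    refine smul_mem_of_complex _ _ (mem_bosonicPoly_of_hom (hom_yt_dz hf α β) ?_)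
    have : a + 1 - (b - 1) = a - b + 2 := by ring
    rw [this]; exact hab.add even_two
  · rw [sigmaCoef_of_eq hf]; exact zero_mem _
  · rw [sigmaCoef_of_gt hf h]
    refine smul_mem_of_complex _ _ (mem_bosonicPoly_of_hom (hom_zt_dy hf α β) ?_)
    have : a - 1 - (b + 1) = a - b - 2 := by ring
    rw [this]; exact hab.sub even_two

/-- Together with anticommuting vierbeins this gives `σ₋² = 0`. One application changes `N - N̄` by
two; as the difference is even, a component stays on its side or lands on the diagonal, where `σ₋`
vanishes, and never jumps across. -/
lemma sigmaCoef_comm {f : SpinorPoly A} (hf : f ∈ bosonicPoly A) (α β γ δ : Fin 2) :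
    sigmaCoef A α β (sigmaCoef A γ δ f) = sigmaCoef A γ δ (sigmaCoef A α β f) := by
  refine bosonic_induction
    (p := fun f => sigmaCoef A α β (sigmaCoef A γ δ f) = sigmaCoef A γ δ (sigmaCoef A α β f))
    (by simp) (fun f g h1 h2 => by simp only [map_add, h1, h2]) (fun a b f hab hf => ?_) hf
  have hab' := Int.even_iff.1 hab
  have hzz : ∀ (f : SpinorPoly A), (polyOps A).zt β ((polyOps A).zt δ f) =
    (polyOps A).zt δ ((polyOps A).zt β f) := (polyOps A).swap.yt_comm β δ
  rcases lt_trichotomy a b with h | rfl | h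
  · rw [sigmaCoef_of_lt hf h, sigmaCoef_of_lt hf h, map_smul, map_smul]
    rcases eq_or_ne (a + 1) (b - 1) with e | e
    · have h1 := hom_yt_dz hf γ δ
      have h2 := hom_yt_dz hf α β
      rw [e] at h1 h2
      rw [sigmaCoef_of_eq h1, sigmaCoef_of_eq h2]
    · rw [sigmaCoef_of_lt (hom_yt_dz hf γ δ) (by omega),
        sigmaCoef_of_lt (hom_yt_dz hf α β) (by omega), dz_yt, dz_yt, yt_comm,
        (polyOps A).dz_dz β δ]
  · simp only [sigmaCoef_of_eq hf, map_zero]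
  · rw [sigmaCoef_of_gt hf h, sigmaCoef_of_gt hf h, map_smul, map_smul]
    rcases eq_or_ne (a - 1) (b + 1) with e | e
    · have h1 := hom_zt_dy hf γ δ
      have h2 := hom_zt_dy hf α β
      rw [e] at h1 h2
      rw [sigmaCoef_of_eq h1, sigmaCoef_of_eq h2]
    · rw [sigmaCoef_of_gt (hom_zt_dy hf γ δ) (by omega),
        sigmaCoef_of_gt (hom_zt_dy hf α β) (by omega), dy_zt, dy_zt, hzz,
        (polyOps A).dy_dy α γ]

end Projections

/-! ### Bidegree projections of forms -/

section FormProj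
variable {A : Type*} [CommRing A] {L : Type*} [AddCommGroup L] [Module A L]
  (h : Module.Basis (Fin 2 × Fin 2) A L)

/-- The projection of a form onto bidegree `(a, b)`. -/
def formProj (a b : ℤ) : SpinorForm A L →ₗ[A] SpinorForm A L :=
  (homProj A a b).lTensor (ExteriorAlgebra A L)

lemma formProj_tmul (a b : ℤ) (θ : ExteriorAlgebra A L) (f : SpinorPoly A) :
    formProj a b (θ ⊗ₜ[A] f) = θ ⊗ₜ homProj A a b f := rfl

lemma formProj_oneForm (a b : ℤ) (f : Fin 2 → Fin 2 → SpinorPoly A) :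
    formProj a b (oneForm h f) = oneForm h fun i j => homProj A a b (f i j) := by
  simp only [oneForm, map_sum, formProj_tmul]

lemma formProj_twoForm (a b : ℤ) (U V : Fin 2 → Fin 2 → SpinorPoly A) :
    formProj a b (twoForm h U V) =
      twoForm h (fun i j => homProj A a b (U i j)) (fun i j => homProj A a b (V i j)) := by
  simp only [twoForm, map_sum, map_add, formProj_tmul]

lemma exists_eq_sum_formProj (ω : SpinorForm A L) :
    ∃ M : ℕ, ∀ M' ≥ M, ω = ∑ a ∈ Finset.range M', ∑ b ∈ Finset.range M', formProj a b ω := by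
  induction ω using TensorProduct.induction_on with
  | zero => exact ⟨0, fun _ _ => by simp⟩
  | tmul θ f =>
    obtain ⟨M, hM⟩ := exists_eq_sum_homProj f
    refine ⟨M, fun M' h' => ?_⟩
    simp only [formProj_tmul, ← TensorProduct.tmul_sum]
    rw [← hM M' h']
  | add x y hx hy =>
    obtain ⟨M, hM⟩ := hx
    obtain ⟨M', hM'⟩ := hy
    refine ⟨max M M', fun K hK => ?_⟩
    simp only [map_add, Finset.sum_add_distrib]
    rw [← hM K (le_trans (le_max_left _ _) hK), ← hM' K (le_trans (le_max_right _ _) hK)]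

end FormProj

/-! ### The operator `σ₋` in components, and reduction to pairs of mirror bidegrees -/

section Sigma
variable {A : Type*} [CommRing A] [Algebra ℂ A] {L : Type*} [AddCommGroup L] [Module A L]
  (h : Module.Basis (Fin 2 × Fin 2) A L)
open WeylOps

lemma sigmaMinus_tmul (θ : ExteriorAlgebra A L) (g : SpinorPoly A) :
    sigmaMinus h (θ ⊗ₜ g) = ∑ α, ∑ β, (hUU h α β * θ) ⊗ₜ[A] sigmaCoef A α β g := by
  simp only [sigmaMinus, sigmaCoef_apply, Fin.sum_univ_two, LinearMap.smul_apply,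
    LinearMap.add_apply, wedgeOp, TensorProduct.map_tmul, hUD, hDU, eps, LinearMap.mulLeft_apply,
    LinearMap.comp_apply, gtProj, ltProj, yt_zero, yt_one, zt_zero, zt_one, polyOps_y, polyOps_z,
    polyOps_dy, polyOps_dz, LinearMap.coe_restrictScalars, LinearMap.neg_apply,
    ← algebraMap_smul A Complex.I, TensorProduct.tmul_smul]
  simp [neg_mul, TensorProduct.neg_tmul, TensorProduct.tmul_add,
    TensorProduct.tmul_neg]
  module

lemma sigmaMinus_mem {p : ℕ} {ω : SpinorForm A L} (hω : ω ∈ bosonicForms A L p) :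
    sigmaMinus h ω ∈ bosonicForms A L (p + 1) := by
  refine (bosonicForms_le (S := (bosonicForms A L (p + 1)).comap (sigmaMinus h))
    fun θ hθ f hf => ?_) hω
  rw [Submodule.mem_comap, sigmaMinus_tmul]
  exact Submodule.sum_mem _ fun i _ => Submodule.sum_mem _ fun j _ =>
    tmul_mem_bosonicForms (hUU_mul_mem h i j hθ) (sigmaCoef_mem hf i j)

lemma sigmaMinus_sigmaMinus {p : ℕ} {ω : SpinorForm A L} (hω : ω ∈ bosonicForms A L p) :
    sigmaMinus h (sigmaMinus h ω) = 0 := by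
  refine (bosonicForms_le (S := LinearMap.ker (sigmaMinus h ∘ₗ sigmaMinus h))
    fun θ hθ f hf => ?_) hω
  have hc := sigmaCoef_comm hf
  rw [LinearMap.mem_ker, LinearMap.comp_apply, sigmaMinus_tmul]
  simp only [map_sum]
  simp only [sigmaMinus_tmul, Fin.sum_univ_two]
  simp only [hUU_sq_mul, hUU_anticomm_mul h 0 1 0 0,
    hUU_anticomm_mul h 1 0 0 0, hUU_anticomm_mul h 1 0 0 1, hUU_anticomm_mul h 1 1 0 0,
    hUU_anticomm_mul h 1 1 0 1, hUU_anticomm_mul h 1 1 1 0, hc 0 1 0 0, hc 1 0 0 0, hc 1 0 0 1,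
    hc 1 1 0 0, hc 1 1 0 1, hc 1 1 1 0, TensorProduct.neg_tmul, TensorProduct.zero_tmul]
  abel

lemma coboundaries_le_cocycles (p : ℕ) : coboundaries h p ≤ cocycles h p := by
  cases p with
  | zero => exact bot_le
  | succ p =>
    rintro _ ⟨ω, hω, rfl⟩
    exact ⟨sigmaMinus_mem h hω, sigmaMinus_sigmaMinus h hω⟩

/-- Since `R` is a submodule, unique representation only requires that `R` meet the coboundaries in
zero. -/
lemma represents_of {p : ℕ} {R : Submodule A (SpinorForm A L)} (h1 : R ≤ cocycles h p)
    (h2 : cocycles h p ≤ R ⊔ coboundaries h p) (h3 : ∀ r ∈ R, r ∈ coboundaries h p → r = 0) :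
    Represents h p R := by
  refine ⟨h1, fun r hr => ⟨r, h1 hr, rfl⟩, fun r hr r' hr' e => ?_, ?_⟩
  · rw [← sub_eq_zero]
    exact h3 _ (sub_mem hr hr') ((Submodule.Quotient.eq _).1 e)
  · rintro _ ⟨ω, hω, rfl⟩
    obtain ⟨r, hr, b, hb, rfl⟩ := Submodule.mem_sup.1 (h2 hω)
    refine ⟨r, hr, ?_⟩
    have e : (coboundaries h p).mkQ b = 0 := (Submodule.Quotient.mk_eq_zero _).2 hb
    rw [map_add, e, add_zero]

/-- A form lies in a submodule if the sums of its components of mirror bidegrees do. -/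
lemma mem_of_formProj_add {S : Submodule A (SpinorForm A L)} {ω : SpinorForm A L}
    (H : ∀ a b : ℤ, 0 ≤ b → b ≤ a → formProj a b ω + formProj b a ω ∈ S) : ω ∈ S := by
  obtain ⟨M, hM⟩ := exists_eq_sum_formProj ω
  -- Summing over all mirror pairs counts `ω` twice. The pairing is needed because near the diagonal
  -- closedness constrains only the sum of the images of mirror components.
  have h2 : (2 : A) • ω ∈ S := by
    have : (2 : A) • ω = ∑ a ∈ Finset.range M, ∑ b ∈ Finset.range M,
        (formProj (a : ℤ) (b : ℤ) ω + formProj (b : ℤ) (a : ℤ) ω) := by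
      simp only [Finset.sum_add_distrib]
      rw [Finset.sum_comm (f := fun a b : ℕ => formProj (b : ℤ) (a : ℤ) ω), ← hM M le_rfl, two_smul]
    rw [this]
    refine Submodule.sum_mem _ fun a _ => Submodule.sum_mem _ fun b _ => ?_
    rcases le_total b a with h | h
    · exact H a b (by omega) (by omega)
    · rw [add_comm]; exact H b a (by omega) (by omega)
  have h3 := S.smul_mem (algebraMap ℂ A 2⁻¹) h2
  rw [smul_smul, ← map_ofNat (algebraMap ℂ A) 2, ← map_mul] at h3
  norm_num at h3
  exact h3

lemma sigmaMinus_zeroForm (g : SpinorPoly A) :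
    sigmaMinus h ((1 : ExteriorAlgebra A L) ⊗ₜ g) = oneForm h fun i j => sigmaCoef A i j g := by
  rw [sigmaMinus_tmul]; simp only [mul_one]; rfl

/-- The part below the diagonal appears with the two kinds of variables exchanged; `f` is transposed
because `swap` puts the dotted index first. -/
lemma sigmaMinus_oneForm (f : Fin 2 → Fin 2 → SpinorPoly A) :
    sigmaMinus h (oneForm h f) = twoForm h
      (fun α γ => (Complex.I / 4) • ((polyOps A).symU (fun i j => gtProj A (f i j)) α γ +
        (polyOps A).swap.symV (fun i j => ltProj A (f j i)) α γ))
      (fun β δ => (Complex.I / 4) • ((polyOps A).symV (fun i j => gtProj A (f i j)) β δ +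
        (polyOps A).swap.symU (fun i j => ltProj A (f j i)) β δ)) := by
  have e : ∀ g : SpinorPoly A, (4 : ℕ) • (4⁻¹ : ℂ) • g = g := fun g => by
    rw [← Nat.cast_smul_eq_nsmul ℂ, smul_smul]; norm_num
  have := sum_mul_tmul_one h fun α β γ δ => (4⁻¹ : ℂ) • sigmaCoef A α β (f γ δ)
  simp only [e] at this
  rw [oneForm]
  simp only [map_sum, sigmaMinus_tmul]
  rw [this]
  congr 1
  · ext1 α; ext1 γ
    simp only [sigmaCoef_apply, symU, symV, zt_zero, zt_one, swap_zt, swap_yCurl, zDot_def,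
      zCurl_def, LinearMap.neg_apply, map_add, map_sub, (polyOps A).dy_z]
    module
  · ext1 β; ext1 δ
    simp only [sigmaCoef_apply, symU, symV, yt_zero, yt_one, swap_dy, swap_zDot, yDot,
      yCurl, LinearMap.neg_apply, map_add, map_sub, (polyOps A).dz_y]
    module

lemma sigmaMinus_twoForm {U V : Fin 2 → Fin 2 → SpinorPoly A} (hU : ∀ i j, U i j = U j i)
    (hV : ∀ i j, V i j = V j i) :
    sigmaMinus h (twoForm h U V) = triForm h fun γ φ => (2 * Complex.I) •
      ((polyOps A).threeForm (fun i j => gtProj A (U i j)) (fun i j => gtProj A (V i j)) γ φ -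
      (polyOps A).swap.threeForm (fun i j => ltProj A (V i j)) (fun i j => ltProj A (U i j))
        φ γ) := by
  have := sum_mul_tmul_two h (U := fun α β γ δ => sigmaCoef A α β (U γ δ))
    (V := fun α β γ δ => sigmaCoef A α β (V γ δ)) (fun _ _ _ _ => by rw [hU])
    (fun _ _ _ _ => by rw [hV])
  rw [twoForm]
  simp only [map_sum, map_add, sigmaMinus_tmul]
  rw [this]
  congr 1
  ext1 γ; ext1 φ
  simp only [sigmaCoef_apply, threeForm, swap_zt, swap_yCurl, swap_dy, swap_zDot]
  simp only [zt_zero, zt_one, yt_zero, yt_one, zDot_def, yDot, yCurl, zCurl_def,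
    LinearMap.neg_apply, map_add, map_sub, (polyOps A).dy_z, (polyOps A).dz_y]
  module

end Sigma

/-! ### Generating polynomials of symmetric multispinors -/

section Multispinors
variable {A : Type*} [CommRing A]

/-- The exponent of the monomial `y^{α₁} ⋯ y^{αₙ} ȳ^{α'₁} ⋯ ȳ^{α'ₘ}`. -/
def indexExponent {n m : ℕ} (a : Fin n → Fin 2) (b : Fin m → Fin 2) : Fin 2 ⊕ Fin 2 →₀ ℕ :=
  ∑ i, Finsupp.single (Sum.inl (a i)) 1 + ∑ j, Finsupp.single (Sum.inr (b j)) 1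

lemma multispinorPoly_eq {n m : ℕ} (F : (Fin n → Fin 2) → (Fin m → Fin 2) → A) :
    multispinorPoly F = ∑ a, ∑ b, MvPolynomial.monomial (indexExponent a b) (F a b) := by
  refine Finset.sum_congr rfl fun a _ => Finset.sum_congr rfl fun b _ => ?_
  simp only [indexExponent, MvPolynomial.X]
  rw [← MvPolynomial.monomial_sum_one, ← MvPolynomial.monomial_sum_one, MvPolynomial.monomial_mul,
    MvPolynomial.C_mul_monomial, mul_one, mul_one]

lemma degY_sum {ι : Type*} (s : Finset ι) (f : ι → Fin 2 ⊕ Fin 2 →₀ ℕ) :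
    degY (∑ i ∈ s, f i) = ∑ i ∈ s, degY (f i) := by
  simp only [degY, Finsupp.finsetSum_apply]
  exact Finset.sum_comm
lemma degYBar_sum {ι : Type*} (s : Finset ι) (f : ι → Fin 2 ⊕ Fin 2 →₀ ℕ) :
    degYBar (∑ i ∈ s, f i) = ∑ i ∈ s, degYBar (f i) := by
  simp only [degYBar, Finsupp.finsetSum_apply]
  exact Finset.sum_comm

lemma degY_indexExponent {n m : ℕ} (a : Fin n → Fin 2) (b : Fin m → Fin 2) :
    degY (indexExponent a b) = n := by
  simp [indexExponent, degY_add, degY_sum, degY_inl, degY_inr]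
lemma degYBar_indexExponent {n m : ℕ} (a : Fin n → Fin 2) (b : Fin m → Fin 2) :
    degYBar (indexExponent a b) = m := by
  simp [indexExponent, degYBar_add, degYBar_sum, degYBar_inl, degYBar_inr]

lemma exists_sum_single (s : Fin 2 → Fin 2 ⊕ Fin 2) {n p q : ℕ} (h : n = p + q) :
    ∃ a : Fin n → Fin 2, ∑ i, Finsupp.single (s (a i)) 1 =
      Finsupp.single (s 0) p + Finsupp.single (s 1) q := by
  subst h
  refine ⟨Fin.append (fun _ => 0) (fun _ => 1), ?_⟩
  simp [Fin.sum_univ_add]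

lemma exists_indexExponent (m : Fin 2 ⊕ Fin 2 →₀ ℕ) :
    ∃ (a : Fin (degY m) → Fin 2) (b : Fin (degYBar m) → Fin 2), indexExponent a b = m := by
  obtain ⟨a, ha⟩ := exists_sum_single Sum.inl (n := degY m) (Fin.sum_univ_two _)
  obtain ⟨b, hb⟩ := exists_sum_single Sum.inr (n := degYBar m) (Fin.sum_univ_two _)
  refine ⟨a, b, ?_⟩
  rw [indexExponent, ha, hb]
  ext i
  rcases i with i | i <;> fin_cases i <;> simp

variable [Algebra ℂ A]

/-- The coefficient `c` is spread evenly over all index strings with exponent `m`; the exponent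
ignores the order of indices, so the resulting tensor is symmetric. -/
lemma exists_multispinor (m : Fin 2 ⊕ Fin 2 →₀ ℕ) (c : A) :
    ∃ F : (Fin (degY m) → Fin 2) → (Fin (degYBar m) → Fin 2) → A,
      IsSymmMultispinor F ∧ multispinorPoly F = MvPolynomial.monomial m c := by
  classical
  obtain ⟨a₀, b₀, h₀⟩ := exists_indexExponent m
  set S : Finset ((Fin (degY m) → Fin 2) × (Fin (degYBar m) → Fin 2)) :=
    Finset.univ.filter fun x => indexExponent x.1 x.2 = m with hS
  have hpos : (S.card : ℂ) ≠ 0 := by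
    have : (a₀, b₀) ∈ S := by simp [hS, h₀]
    exact_mod_cast (Finset.card_pos.2 ⟨_, this⟩).ne'
  refine ⟨fun a b => if indexExponent a b = m then (S.card : ℂ)⁻¹ • c else 0, ?_, ?_⟩
  · intro π τ a b
    have : indexExponent (a ∘ π) (b ∘ τ) = indexExponent a b := by
      simp only [indexExponent, Function.comp_apply]
      rw [Equiv.sum_comp π fun i => (Finsupp.single (Sum.inl (a i)) 1 : Fin 2 ⊕ Fin 2 →₀ ℕ),
        Equiv.sum_comp τ fun i => (Finsupp.single (Sum.inr (b i)) 1 : Fin 2 ⊕ Fin 2 →₀ ℕ)]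
    simp only [this]
  · rw [multispinorPoly_eq, ← Fintype.sum_prod_type' (f := fun a b =>
      MvPolynomial.monomial (indexExponent a b) (if indexExponent a b = m then _ else _))]
    have : ∀ x : (Fin (degY m) → Fin 2) × (Fin (degYBar m) → Fin 2),
        MvPolynomial.monomial (indexExponent x.1 x.2)
          (if indexExponent x.1 x.2 = m then (S.card : ℂ)⁻¹ • c else 0) =
        if indexExponent x.1 x.2 = m then MvPolynomial.monomial m ((S.card : ℂ)⁻¹ • c) else 0 := by
      intro x
      split_ifs with h
      · rw [h]
      · simp
    simp only [this]
    rw [← Finset.sum_filter, Finset.sum_const, ← map_nsmul, ← Nat.cast_smul_eq_nsmul ℂ,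
      smul_inv_smul₀ hpos]

lemma monomial_mem_diagonalPoly {m : Fin 2 ⊕ Fin 2 →₀ ℕ} (hm : degY m = degYBar m) (c : A) :
    MvPolynomial.monomial m c ∈ diagonalPoly A := by
  classical
  refine mem_diagonalPoly_iff.2 fun a b hab => ?_
  rw [homProj, bidegProj_monomial, if_neg]
  rintro ⟨h1, h2⟩
  omega

lemma diagonalMultispinors_eq (L : Type*) [AddCommGroup L] [Module A L] :
    diagonalMultispinors A L =
      (diagonalPoly A).map (TensorProduct.mk A (ExteriorAlgebra A L) (SpinorPoly A) 1) := by
  classical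
  refine le_antisymm (Submodule.span_le.2 ?_) ?_
  · rintro _ ⟨n, F, -, rfl⟩
    refine ⟨_, ?_, rfl⟩
    rw [multispinorPoly_eq]
    exact Submodule.sum_mem _ fun a _ => Submodule.sum_mem _ fun b _ =>
      monomial_mem_diagonalPoly (by rw [degY_indexExponent, degYBar_indexExponent]) _
  · rintro _ ⟨f, hf, rfl⟩
    rw [f.as_sum, map_sum]
    refine Submodule.sum_mem _ fun m hm => ?_
    have hd : degY m = degYBar m := by
      by_contra hne
      have h0 := congrArg (MvPolynomial.coeff m) (homProj_diagonal hf
        (a := degY m) (b := degYBar m) (by exact_mod_cast hne))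
      rw [homProj, coeff_bidegProj, if_pos ⟨rfl, rfl⟩] at h0
      exact MvPolynomial.mem_support_iff.1 hm h0
    obtain ⟨F, hF, e⟩ := exists_multispinor m (f.coeff m)
    rw [← e]
    refine Submodule.subset_span ?_
    -- The multispinor must be generalised before rewriting by `hd`, since the lengths of its two
    -- index strings are the two degrees being identified.
    clear e
    revert F
    rw [← hd]
    exact fun F hF => ⟨_, F, hF, rfl⟩

end Multispinors

/-! ### The cohomology `H⁰` and `H¹` -/

section ZeroOne
variable {A : Type*} [CommRing A] [Algebra ℂ A] {L : Type*} [AddCommGroup L] [Module A L]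
  (h : Module.Basis (Fin 2 × Fin 2) A L)
open WeylOps

/-- Contraction with `y` annihilates the `f'` term and turns the other into `a z_j f`; the factor
`z_j` is then removed by a curl. -/
lemma WeylOps.eq_zero_of_zt_dy_add {M : Type*} [AddCommGroup M] [Module ℂ M] {W : WeylOps ℂ M}
    {a b : ℂ} {f f' : M} (hf : W.Hom a b f) (ha : a ≠ 0) (hb : b + 2 ≠ 0)
    (H : ∀ i j, W.zt j (W.dy i f) + W.yt i (W.dz j f') = 0) : f = 0 := by
  have h1 : ∀ j, W.zt j f = 0 := fun j => by
    have e : W.yDot (fun i => W.dy i (W.zt j f) + W.yt i (W.dz j f')) = 0 := by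
      simp only [dy_zt, H, yDot_zero]
    rw [yDot_add, (hf.zt j).1.yDot_dy, yDot_yt, add_zero] at e
    exact (smul_eq_zero.1 e).resolve_left ha
  have h2 := HomY.yCurl_yt (W := W.swap) hf.2
  simp only [swap_yt, h1, yCurl_zero] at h2
  exact (smul_eq_zero.1 h2.symm).resolve_left (neg_ne_zero.2 hb)

lemma homProj_sigmaCoef (a b : ℤ) (α β : Fin 2) (f : SpinorPoly A) :
    homProj A a b (sigmaCoef A α β f) = Complex.I •
      ((polyOps A).zt β ((polyOps A).dy α (homProj A (a + 1) (b - 1) (gtProj A f))) +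
      (polyOps A).yt α ((polyOps A).dz β (homProj A (a - 1) (b + 1) (ltProj A f)))) := by
  rw [sigmaCoef_apply, homProj_smul, map_add, homProj_zt, homProj_polyOps_dy, homProj_yt,
    homProj_polyOps_dz]

lemma mem_diagonal_of_sigmaCoef {f : SpinorPoly A} (hf : ∀ i j, sigmaCoef A i j f = 0) :
    f ∈ diagonalPoly A := by
  refine mem_diagonalPoly_iff.2 fun a b hab => ?_
  by_cases hneg : a < 0 ∨ b < 0
  · exact eq_zero_of_hom_neg (homProj_hom a b f) hneg
  rw [not_or, not_lt, not_lt] at hneg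
  -- Bidegree `(c, d)` of `σ₋ f` receives `(c+1, d-1)` from above the diagonal and `(c-1, d+1)` from
  -- below.
  have key : ∀ c d i j, (polyOps A).zt j ((polyOps A).dy i (homProj A (c + 1) (d - 1) (gtProj A f)))
      + (polyOps A).yt i ((polyOps A).dz j (homProj A (c - 1) (d + 1) (ltProj A f))) = 0 :=
    fun c d i j => by
      have := homProj_sigmaCoef c d i j f
      rw [hf, map_zero] at this
      exact (smul_eq_zero.1 this.symm).resolve_left Complex.I_ne_zero
  have cb : ∀ n : ℤ, 0 ≤ n → (n : ℂ) + 2 ≠ 0 := fun n hn => by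
    exact_mod_cast (by omega : n + 2 ≠ 0)
  rcases lt_or_gt_of_ne hab with h | h
  · have k1 := key (a + 1) (b - 1)
    rw [add_sub_cancel_right, sub_add_cancel] at k1
    have e : homProj A a b (ltProj A f) = homProj A a b f := by rw [homProj_ltProj, if_pos h]
    rw [e] at k1
    exact eq_zero_of_zt_dy_add (W := (polyOps A).swap) (homProj_hom a b f).swap
      (by exact_mod_cast (by omega : b ≠ 0)) (cb a hneg.1) fun i j => by
        rw [← k1 j i, add_comm]; rfl
  · have k1 := key (a - 1) (b + 1)
    rw [add_sub_cancel_right, sub_add_cancel] at k1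
    have e : homProj A a b (gtProj A f) = homProj A a b f := by rw [homProj_gtProj, if_pos h]
    rw [e] at k1
    exact eq_zero_of_zt_dy_add (W := (polyOps A)) (homProj_hom a b f)
      (by exact_mod_cast (by omega : a ≠ 0)) (cb b hneg.2) k1

theorem represents_zero : Represents h 0 (diagonalMultispinors A L) := by
  rw [diagonalMultispinors_eq]
  refine represents_of h ?_ ?_ fun r _ hr => (Submodule.mem_bot A).1 hr
  · rintro _ ⟨f, hf, rfl⟩
    refine ⟨tmul_mem_bosonicForms ?_ (diagonalPoly_le_bosonicPoly hf), LinearMap.mem_ker.2 ?_⟩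
    · rw [ExteriorAlgebra.exteriorPower, pow_zero]; exact Submodule.one_le.1 le_rfl
    · rw [TensorProduct.mk_apply, sigmaMinus_zeroForm]
      have e1 : gtProj A f = 0 := bidegProj_gt_diagonal hf
      have e2 : ltProj A f = 0 := bidegProj_lt_diagonal hf
      simp [sigmaCoef_apply, e1, e2, oneForm]
  · rintro ω ⟨hω, hc⟩
    obtain ⟨f, -, rfl⟩ := exists_zeroForm hω
    refine Submodule.mem_sup_left ⟨f, mem_diagonal_of_sigmaCoef fun i j => ?_, rfl⟩
    have hc := LinearMap.mem_ker.1 hc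
    rw [sigmaMinus_zeroForm] at hc
    exact oneForm_eq_zero h hc i j

/-! ### One-forms -/

lemma phi_eq (F : SpinorPoly A) :
    phi h F = oneForm h fun i j => (polyOps A).dy i ((polyOps A).dz j F) := by
  simp [phi, oneForm, formOp]

lemma phiTr_eq (F : SpinorPoly A) :
    phiTr h F = oneForm h fun i j => (polyOps A).yt i ((polyOps A).zt j F) := by
  simp [phiTr, oneForm, formOp, hDD, eps, yt, zt, TensorProduct.tmul_neg]
  abel

lemma dy_dz_mem_diagonal {F : SpinorPoly A} (hF : F ∈ diagonalPoly A) (i j : Fin 2) :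
    (polyOps A).dy i ((polyOps A).dz j F) ∈ diagonalPoly A :=
  mem_diagonalPoly_iff.2 fun a b hab => by
    rw [homProj_polyOps_dy, homProj_polyOps_dz, homProj_diagonal hF (by omega)]; simp

lemma yt_zt_mem_diagonal {F : SpinorPoly A} (hF : F ∈ diagonalPoly A) (i j : Fin 2) :
    (polyOps A).yt i ((polyOps A).zt j F) ∈ diagonalPoly A :=
  mem_diagonalPoly_iff.2 fun a b hab => by
    rw [homProj_yt, homProj_zt, homProj_diagonal hF (by omega)]; simp

lemma WeylOps.symU_zero {k M : Type*} [Field k] [AddCommGroup M] [Module k M] (W : WeylOps k M)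
    (α γ : Fin 2) : W.symU (fun _ _ => 0) α γ = 0 := by simp [symU]
lemma WeylOps.symV_zero {k M : Type*} [Field k] [AddCommGroup M] [Module k M] (W : WeylOps k M)
    (α γ : Fin 2) : W.symV (fun _ _ => 0) α γ = 0 := by simp [symV]

lemma oneForm_mem_cocycles {f : Fin 2 → Fin 2 → SpinorPoly A}
    (hf : ∀ i j, f i j ∈ diagonalPoly A) : oneForm h f ∈ cocycles h 1 := by
  refine ⟨oneForm_mem h fun i j => diagonalPoly_le_bosonicPoly (hf i j), LinearMap.mem_ker.2 ?_⟩
  have e1 : ∀ i j, gtProj A (f i j) = 0 := fun i j => bidegProj_gt_diagonal (hf i j)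
  have e2 : ∀ i j, ltProj A (f i j) = 0 := fun i j => bidegProj_lt_diagonal (hf i j)
  rw [sigmaMinus_oneForm]
  simp [e1, e2, symU, symV, twoForm]

/-- The four parts of a diagonal one-form are independent: the double contraction sees only `F₁`,
the double curl only `F₂`, each with the factor `(n + 1)²`. -/
lemma WeylOps.trace_parts_eq_zero {M : Type*} [AddCommGroup M] [Module ℂ M] {W : WeylOps ℂ M}
    {n : ℂ} {F₁ F₂ g g' : M} (h1 : W.Hom (n + 1) (n + 1) F₁) (h2 : W.Hom (n - 1) (n - 1) F₂)
    (hn : n + 1 ≠ 0)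
    (H : ∀ i j, W.dy i (W.dz j F₁) + W.yt i (W.zt j F₂) =
      W.zt j (W.dy i g) + W.yt i (W.dz j g')) : F₁ = 0 ∧ F₂ = 0 := by
  have zc : ∀ (F : Fin 2 → M) (γ : Fin 2),
    W.zDot (fun φ => W.dy γ (F φ)) = W.dy γ (W.zDot F) := fun F γ => W.swap.yDot_dz_comm F γ
  have zc' : ∀ (F : Fin 2 → M) (γ : Fin 2),
    W.zDot (fun φ => W.yt γ (F φ)) = W.yt γ (W.zDot F) := fun F γ => W.swap.yDot_zt_comm F γ
  have zd : ∀ (F : Fin 2 → M) (γ : Fin 2),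
    W.zCurl (fun φ => W.dy γ (F φ)) = W.dy γ (W.zCurl F) := fun F γ => W.swap.yCurl_dz_comm F γ
  have zd' : ∀ (F : Fin 2 → M) (γ : Fin 2),
    W.zCurl (fun φ => W.yt γ (F φ)) = W.yt γ (W.zCurl F) := fun F γ => W.swap.yCurl_zt_comm F γ
  constructor
  · have e : W.yDot (fun i => W.zDot fun j => W.dy i (W.dz j F₁) + W.yt i (W.zt j F₂)) =
        W.yDot (fun i => W.zDot fun j => W.zt j (W.dy i g) + W.yt i (W.dz j g')) := by
      simp only [H]
    have e1 : W.zDot (fun j => W.dz j F₁) = (n + 1) • F₁ := h1.2.yDot_dy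
    simp only [zDot_add, zc, zc', zDot_zt, yDot_add, yDot_yt, e1, map_smul, yDot_smul,
      h1.1.yDot_dy, map_zero, yDot_zero, add_zero] at e
    exact (smul_eq_zero.1 ((smul_eq_zero.1 e).resolve_left hn)).resolve_left hn
  · have e : W.yCurl (fun i => W.zCurl fun j => W.dy i (W.dz j F₁) + W.yt i (W.zt j F₂)) =
        W.yCurl (fun i => W.zCurl fun j => W.zt j (W.dy i g) + W.yt i (W.dz j g')) := by
      simp only [H]
    have e1 : W.zCurl (fun j => W.zt j F₂) = -(n - 1 + 2) • F₂ := h2.2.yCurl_yt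
    have e2 : ∀ i, W.zCurl (fun j => W.zt j (W.dy i g)) = W.dy i (W.zCurl fun j => W.zt j g) :=
      fun i => by simp only [← dy_zt, zd]
    have hn' : -(n - 1 + 2) ≠ 0 := by rw [neg_ne_zero]; convert hn using 1; ring_nf
    simp only [zCurl_add, e2, zd, zd', zCurl_dz, yCurl_dy, e1, map_smul, yCurl_smul,
      h2.1.yCurl_yt, map_zero, add_zero, zero_add] at e
    exact (smul_eq_zero.1 ((smul_eq_zero.1 e).resolve_left hn')).resolve_left hn'

/-- The bidegree `(0, 0)` component of `F₁` stays undetermined because the mixed derivative kills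
it; hence the weaker conclusion for `F₁`. -/
lemma phi_add_phiTr_exact {F₁ F₂ g : SpinorPoly A} (h1 : F₁ ∈ diagonalPoly A)
    (h2 : F₂ ∈ diagonalPoly A)
    (H : ∀ i j, (polyOps A).dy i ((polyOps A).dz j F₁) + (polyOps A).yt i ((polyOps A).zt j F₂) =
      sigmaCoef A i j g) :
    (∀ i j, (polyOps A).dy i ((polyOps A).dz j F₁) = 0) ∧ F₂ = 0 := by
  have key : ∀ n : ℤ, 0 ≤ n → homProj A (n + 1) (n + 1) F₁ = 0 ∧ homProj A (n - 1) (n - 1) F₂ = 0 :=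
    fun n hn => by
      refine trace_parts_eq_zero (W := polyOps A) (n := n)
        (g := Complex.I • homProj A (n + 1) (n - 1) (gtProj A g))
        (g' := Complex.I • homProj A (n - 1) (n + 1) (ltProj A g))
        ((homProj_hom _ _ _).congr (by push_cast; ring) (by push_cast; ring))
        ((homProj_hom _ _ _).congr (by push_cast; ring) (by push_cast; ring))
        (by exact_mod_cast (by omega : n + 1 ≠ 0)) fun i j => ?_
      have := congrArg (homProj A n n) (H i j)
      rw [map_add, homProj_sigmaCoef, homProj_polyOps_dy, homProj_polyOps_dz, homProj_yt,
        homProj_zt, smul_add] at this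
      simpa only [map_smul] using this
  refine ⟨fun i j => eq_zero_of_homProj fun a b => ?_, eq_zero_of_homProj fun a b => ?_⟩
  · by_cases hab : a = b
    · subst hab
      by_cases ha : 0 ≤ a
      · rw [homProj_polyOps_dy, homProj_polyOps_dz, (key a ha).1]; simp
      · exact eq_zero_of_hom_neg (homProj_hom a a _) (by omega)
    · exact homProj_diagonal (dy_dz_mem_diagonal h1 i j) hab
  · by_cases hab : a = b
    · subst hab
      by_cases ha : 0 ≤ a
      · have := (key (a + 1) (by omega)).2
        rwa [add_sub_cancel_right] at this
      · exact eq_zero_of_hom_neg (homProj_hom a a _) (by omega)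
    · exact homProj_diagonal h2 hab

lemma phi_add_phiTr_eq_zero {F₁ F₂ g : SpinorPoly A} (h1 : F₁ ∈ diagonalPoly A)
    (h2 : F₂ ∈ diagonalPoly A)
    (H : phi h F₁ + phiTr h F₂ = sigmaMinus h ((1 : ExteriorAlgebra A L) ⊗ₜ g)) :
    phi h F₁ = 0 ∧ phiTr h F₂ = 0 := by
  rw [phi_eq, phiTr_eq, ← oneForm_add, sigmaMinus_zeroForm, ← sub_eq_zero, ← oneForm_sub] at H
  obtain ⟨e1, e2⟩ := phi_add_phiTr_exact (g := g) h1 h2 fun i j =>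
    sub_eq_zero.1 (oneForm_eq_zero h H i j)
  rw [phi_eq, e2, map_zero]
  simp only [e1, oneForm_zero, and_self]

lemma disjoint_phi_phiTr :
    Disjoint ((diagonalPoly A).map (phi h)) ((diagonalPoly A).map (phiTr h)) := by
  rw [Submodule.disjoint_def]
  rintro _ ⟨F₁, h1, rfl⟩ ⟨F₂, h2, e⟩
  refine (phi_add_phiTr_eq_zero h (g := 0) h1 (neg_mem h2) ?_).1
  rw [map_neg, e, add_neg_cancel]; simp

/-- The mirror pairs of components of a closed one-form off the diagonal are gradients. -/
lemma WeylOps.gradient_of_closed {M : Type*} [AddCommGroup M] [Module ℂ M] {W : WeylOps ℂ M}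
    {a b : ℤ} {f f' : Fin 2 → Fin 2 → M} (hf : ∀ i j, W.Hom a b (f i j))
    (hf' : ∀ i j, W.Hom b a (f' i j)) (hb : 0 ≤ b) (hab : b + 2 ≤ a)
    (hU : ∀ α γ, W.symU f α γ + (if a = b + 2 then W.swap.symV (fun i j => f' j i) α γ else 0) = 0)
    (hV : ∀ α γ, W.symV f α γ + (if a = b + 2 then W.swap.symU (fun i j => f' j i) α γ else 0) = 0) :
    ∃ g, W.Hom (a + 1) (b - 1) g ∧ ∀ i j, f i j = W.zt j (W.dy i g) := by
  suffices H : (∀ γ, W.zDot (f γ) = 0) ∧ ∀ δ, W.yCurl (fun i => f i δ) = 0 from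
    exists_eq_zt_dy hf (by exact_mod_cast (by omega : a + 1 ≠ 0))
      (by exact_mod_cast (by omega : b + 1 ≠ 0)) H.1 H.2
  -- Only at this distance from the diagonal do the mirror components `(a, b)` and `(b, a)` have the
  -- same target. In both cases `a ≥ 2`, so the exceptional degree one of `eq_zero_of_symDy` does
  -- not occur.
  by_cases hab' : a = b + 2
  · simp only [if_pos hab'] at hU hV
    refine eq_zero_of_symUV_eq_zero (n := ((b + 1 : ℤ) : ℂ)) (f' := f')
      (fun i j => (hf i j).congr ?_ ?_) (fun i j => (hf' i j).congr ?_ ?_) two_ne_zero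
      (by exact_mod_cast (by omega : b + 1 ≠ 0)) (by exact_mod_cast (by omega : b + 1 + 1 ≠ 0))
      (by exact_mod_cast (by omega : b + 1 + 2 ≠ 0)) hU hV
    all_goals subst hab'; push_cast; ring
  · simp only [if_neg hab', add_zero] at hU hV
    exact ⟨eq_zero_of_symU_eq_zero hf (by exact_mod_cast (by omega : 2 * a ≠ 0))
      (by exact_mod_cast (by omega : a - 1 ≠ 0)) hU,
      eq_zero_of_symV_eq_zero hf (by exact_mod_cast (by omega : 2 * (b + 2) ≠ 0))
      (by exact_mod_cast (by omega : b + 3 ≠ 0)) hV⟩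

lemma sigmaMinus_zeroForm_gt {a b : ℤ} {g : SpinorPoly A} (hg : (polyOps A).Hom a b g)
    (hab : a > b) :
    sigmaMinus h ((1 : ExteriorAlgebra A L) ⊗ₜ (-Complex.I • g)) =
      oneForm h fun i j => (polyOps A).zt j ((polyOps A).dy i g) := by
  rw [sigmaMinus_zeroForm]
  simp only [sigmaCoef_of_gt (hg.smul _) hab, map_smul, smul_smul]
  simp

lemma sigmaMinus_zeroForm_lt {a b : ℤ} {g : SpinorPoly A} (hg : (polyOps A).Hom a b g)
    (hab : a < b) :
    sigmaMinus h ((1 : ExteriorAlgebra A L) ⊗ₜ (-Complex.I • g)) =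
      oneForm h fun i j => (polyOps A).yt i ((polyOps A).dz j g) := by
  rw [sigmaMinus_zeroForm]
  simp only [sigmaCoef_of_lt (hg.smul _) hab, map_smul, smul_smul]
  simp

lemma oneForm_gradient_mem {a b : ℤ} {g : SpinorPoly A} (hg : (polyOps A).Hom a b g)
    (hab : a > b) (he : Even (a - b)) :
    (oneForm h fun i j => (polyOps A).zt j ((polyOps A).dy i g)) ∈ coboundaries h 1 := by
  rw [← sigmaMinus_zeroForm_gt h hg hab]
  exact ⟨_, zeroForm_mem (smul_mem_of_complex _ _ (mem_bosonicPoly_of_hom hg he)), rfl⟩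

lemma oneForm_gradient_mem' {a b : ℤ} {g : SpinorPoly A} (hg : (polyOps A).Hom a b g)
    (hab : a < b) (he : Even (a - b)) :
    (oneForm h fun i j => (polyOps A).yt i ((polyOps A).dz j g)) ∈ coboundaries h 1 := by
  rw [← sigmaMinus_zeroForm_lt h hg hab]
  exact ⟨_, zeroForm_mem (smul_mem_of_complex _ _ (mem_bosonicPoly_of_hom hg he)), rfl⟩

lemma closed_oneForm_components {f : Fin 2 → Fin 2 → SpinorPoly A}
    (hc : sigmaMinus h (oneForm h f) = 0) (a b : ℤ) (α γ : Fin 2) :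
    (polyOps A).symU (fun i j => homProj A (a + 1) (b - 1) (gtProj A (f i j))) α γ +
      (polyOps A).swap.symV (fun i j => homProj A (a - 1) (b + 1) (ltProj A (f j i))) α γ = 0 ∧
    (polyOps A).symV (fun i j => homProj A (a + 1) (b - 1) (gtProj A (f i j))) α γ +
      (polyOps A).swap.symU (fun i j => homProj A (a - 1) (b + 1) (ltProj A (f j i))) α γ = 0 := by
  rw [sigmaMinus_oneForm] at hc
  have := twoForm_eq_zero h (fun i j => by simp only [symU, symV, add_comm])
    (fun i j => by simp only [symU, symV, add_comm]) hc α γ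
  have hI : Complex.I / 4 ≠ 0 := div_ne_zero Complex.I_ne_zero (by norm_num)
  constructor
  · rw [← homProj_symU, ← homProj_swap_symV, ← map_add,
      (smul_eq_zero.1 this.1).resolve_left hI, map_zero]
  · rw [← homProj_symV, ← homProj_swap_symU, ← map_add,
      (smul_eq_zero.1 this.2).resolve_left hI, map_zero]

theorem represents_one : Represents h 1
    ((diagonalPoly A).map (phi h) ⊔ (diagonalPoly A).map (phiTr h)) := by
  refine represents_of h (sup_le ?_ ?_) ?_ ?_
  · rintro _ ⟨F, hF, rfl⟩
    rw [phi_eq]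
    exact oneForm_mem_cocycles h fun i j => dy_dz_mem_diagonal hF i j
  · rintro _ ⟨F, hF, rfl⟩
    rw [phiTr_eq]
    exact oneForm_mem_cocycles h fun i j => yt_zt_mem_diagonal hF i j
  · rintro ω ⟨hω, hc⟩
    obtain ⟨f, hf, rfl⟩ := exists_oneForm h hω
    have hcl := closed_oneForm_components h hc
    refine mem_of_formProj_add fun a b hb hab => ?_
    rw [formProj_oneForm, formProj_oneForm]
    by_cases he : Even (a - b)
    swap
    · have he' : ¬ Even (b - a) := by rwa [← neg_sub, even_neg]
      simp only [homProj_bosonic (hf _ _) he, homProj_bosonic (hf _ _) he']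
      simp [oneForm]
    rcases hab.eq_or_lt with rfl | hlt
    · obtain ⟨F₁, F₂, g, g', h1, h2, h3, h4, e⟩ := one_form_decomp (W := polyOps A) (n := b)
        (f := fun i j => homProj A b b (f i j)) (fun i j => homProj_hom _ _ _)
        (by exact_mod_cast (by omega : b + 1 ≠ 0))
      have e' : ∀ i j, homProj A b b (f i j) = _ := e
      simp only [e']
      have key : (oneForm h fun i j => (polyOps A).dy i ((polyOps A).dz j F₁) +
          (polyOps A).yt i ((polyOps A).zt j F₂) + (polyOps A).zt j ((polyOps A).dy i g) +
          (polyOps A).yt i ((polyOps A).dz j g')) ∈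
          ((diagonalPoly A).map (phi h) ⊔ (diagonalPoly A).map (phiTr h)) ⊔ coboundaries h 1 := by
        rw [oneForm_add, oneForm_add, oneForm_add, ← phi_eq, ← phiTr_eq, add_assoc]
        refine Submodule.add_mem_sup (Submodule.add_mem_sup ⟨F₁, mem_diagonalPoly_of_hom h1, rfl⟩
          ⟨F₂, mem_diagonalPoly_of_hom h2, rfl⟩) (add_mem ?_ ?_)
        · exact oneForm_gradient_mem h (a := b + 1) (b := b - 1)
            (h3.congr (by push_cast; ring) (by push_cast; ring)) (by omega) ⟨1, by ring⟩
        · exact oneForm_gradient_mem' h (a := b - 1) (b := b + 1)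
            (h4.congr (by push_cast; ring) (by push_cast; ring)) (by omega) ⟨-1, by ring⟩
      -- On the diagonal the mirror pair is the same component taken twice.
      exact add_mem key key
    · have he2 : b + 2 ≤ a := by
        obtain ⟨c, hc⟩ := he; omega
      -- The competing source of the bidegree `(a-1, b+1)` is `(a-2, b+2)`. As `a - b` is even and
      -- at least two, it lies below the diagonal only if `a = b + 2`.
      have hidx : ∀ f, (if a - 1 - 1 < b + 1 + 1 then homProj A (a - 1 - 1) (b + 1 + 1) f else 0) =
          if a = b + 2 then homProj A b a f else 0 := fun f => by
        by_cases e : a = b + 2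
        · rw [if_pos e, if_pos (by omega), show a - 1 - 1 = b by omega, show b + 1 + 1 = a by omega]
        · obtain ⟨c, hc'⟩ := he
          rw [if_neg e, if_neg (by omega)]
      have hidx' : ∀ f, (if a - 1 - 1 < b + 1 + 1 then homProj A (b + 1 + 1) (a - 1 - 1) f else 0) =
          if a = b + 2 then homProj A a b f else 0 := fun f => by
        by_cases e : a = b + 2
        · rw [if_pos e, if_pos (by omega), show a - 1 - 1 = b by omega, show b + 1 + 1 = a by omega]
        · obtain ⟨c, hc'⟩ := he
          rw [if_neg e, if_neg (by omega)]
      refine Submodule.mem_sup_right (add_mem ?_ ?_)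
      · obtain ⟨g, hg, e⟩ := gradient_of_closed (W := polyOps A)
          (f := fun i j => homProj A a b (f i j)) (f' := fun i j => homProj A b a (f i j))
          (fun i j => homProj_hom _ _ _) (fun i j => homProj_hom _ _ _) hb he2
          (fun α γ => by
            have := (hcl (a - 1) (b + 1) α γ).1
            simp only [sub_add_cancel, add_sub_cancel_right, homProj_gtProj, homProj_ltProj,
              gt_iff_lt, if_pos hlt, hidx] at this
            split_ifs at this ⊢ with e
            · exact this
            · simpa only [symU_zero, symV_zero] using this)
          (fun α γ => by
            have := (hcl (a - 1) (b + 1) α γ).2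
            simp only [sub_add_cancel, add_sub_cancel_right, homProj_gtProj, homProj_ltProj,
              gt_iff_lt, if_pos hlt, hidx] at this
            split_ifs at this ⊢ with e
            · exact this
            · simpa only [symU_zero, symV_zero] using this)
        have e' : ∀ i j, homProj A a b (f i j) = _ := e
        simp only [e']
        refine oneForm_gradient_mem h (a := a + 1) (b := b - 1)
            (hg.congr (by push_cast; ring) (by push_cast; ring)) (by omega) ?_
        have : a + 1 - (b - 1) = a - b + 2 := by ring
        rw [this]; exact he.add even_two
      · obtain ⟨g, hg, e⟩ := gradient_of_closed (W := (polyOps A).swap)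
          (f := fun i j => homProj A b a (f j i)) (f' := fun i j => homProj A a b (f j i))
          (fun i j => (homProj_hom _ _ _).swap) (fun i j => (homProj_hom _ _ _).swap) hb he2
          (fun α γ => by
            have := (hcl (b + 1) (a - 1) α γ).2
            simp only [sub_add_cancel, add_sub_cancel_right, homProj_gtProj, homProj_ltProj,
              gt_iff_lt, if_pos hlt, hidx'] at this
            rw [add_comm] at this
            split_ifs at this ⊢ with e
            · exact this
            · simpa only [symU_zero, symV_zero] using this)
          (fun α γ => by
            have := (hcl (b + 1) (a - 1) α γ).1
            simp only [sub_add_cancel, add_sub_cancel_right, homProj_gtProj, homProj_ltProj,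
              gt_iff_lt, if_pos hlt, hidx'] at this
            rw [add_comm] at this
            split_ifs at this ⊢ with e
            · exact this
            · simpa only [symU_zero, symV_zero] using this)
        have e' : ∀ i j, homProj A b a (f i j) = (polyOps A).yt i ((polyOps A).dz j g) :=
          fun i j => e j i
        simp only [e']
        refine oneForm_gradient_mem' h (a := b - 1) (b := a + 1)
            (hg.swap.congr (by push_cast; ring) (by push_cast; ring)) (by omega) ?_
        have : b - 1 - (a + 1) = -(a - b + 2) := by ring
        rw [this, even_neg]; exact he.add even_two
  · intro r hr hb
    obtain ⟨_, ⟨F₁, h1, rfl⟩, _, ⟨F₂, h2, rfl⟩, rfl⟩ := Submodule.mem_sup.1 hr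
    obtain ⟨ω, hω, e⟩ := hb
    obtain ⟨g, -, rfl⟩ := exists_zeroForm hω
    obtain ⟨e1, e2⟩ := phi_add_phiTr_eq_zero h h1 h2 e.symm
    rw [e1, e2, add_zero]

end ZeroOne

/-! ### Fronsdal cocycles and constant two-forms -/

namespace WeylOps
variable {k M : Type*} [Field k] [AddCommGroup M] [Module k M] {W : WeylOps k M}

lemma threeForm_sub (U V U₁ V₁ : Fin 2 → Fin 2 → M) (γ φ : Fin 2) :
    W.threeForm (fun i j => U i j - U₁ i j) (fun i j => V i j - V₁ i j) γ φ =
      W.threeForm U V γ φ - W.threeForm U₁ V₁ γ φ := by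
  simp only [threeForm, yCurl_sub, zDot_sub, map_sub]; abel

lemma threeForm_zero (γ φ : Fin 2) :
    W.threeForm (fun _ _ => 0) (fun _ _ => 0) γ φ = 0 := by
  simp [threeForm, yCurl, zDot_def]

lemma Hom.yDot_dy_dy {a b : k} {m : M} (hm : W.Hom a b m) (γ : Fin 2) :
    W.yDot (fun α => W.dy α (W.dy γ m)) = (a - 1) • W.dy γ m := (hm.dy γ).1.yDot_dy

lemma Hom.yCurl_yt_yt {a b : k} {m : M} (hm : W.Hom a b m) (γ : Fin 2) :
    W.yCurl (fun α => W.yt α (W.yt γ m)) = -(a + 3) • W.yt γ m := by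
  rw [(hm.yt γ).1.yCurl_yt]; congr 1; ring

lemma Hom.yDot_yDot_dy_dy {a b : k} {m : M} (hm : W.Hom a b m) :
    W.yDot (fun γ => W.yDot fun α => W.dy α (W.dy γ m)) = (a * (a - 1)) • m := by
  simp only [hm.yDot_dy_dy, yDot_smul, hm.1.yDot_dy, smul_smul, mul_comm]

lemma Hom.yCurl_yCurl_yt_yt {a b : k} {m : M} (hm : W.Hom a b m) :
    W.yCurl (fun γ => W.yCurl fun α => W.yt α (W.yt γ m)) = ((a + 2) * (a + 3)) • m := by
  simp only [hm.yCurl_yt_yt, yCurl_smul, hm.1.yCurl_yt, smul_smul]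
  congr 1; ring

/-- The Fronsdal cocycles are closed. -/
lemma threeForm_fronsdal {n : k} {p q : M} (hp : W.Hom (n + 1) (n + 1) p)
    (hq : W.Hom (n - 1) (n - 1) q) (γ φ : Fin 2) :
    W.threeForm (fun i j => W.yt i (W.yt j q)) (fun i j => W.dz i (W.dz j p)) γ φ -
      W.swap.threeForm (fun i j => W.zt i (W.zt j q)) (fun i j => W.dy i (W.dy j p)) φ γ = 0 := by
  have e1 : W.zDot (fun α => W.dz α (W.dz φ p)) = (n + 1 - 1) • W.dz φ p := hp.swap.yDot_dy_dy φ
  have e2 : W.zCurl (fun α => W.zt α (W.zt φ q)) = -(n - 1 + 3) • W.zt φ q :=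
    hq.swap.yCurl_yt_yt φ
  -- Both three-forms equal `-(n+2) y_γ z_φ q - n ∂_γ ∂̄_φ p`.
  simp only [threeForm, swap_zt, swap_yCurl, swap_zDot, hp.yDot_dy_dy, hq.yCurl_yt_yt, e1, e2,
    map_smul, yt_zt]
  simp only [swap, W.dz_dy]
  abel

/-- A closed two-form in bidegrees `(n + 1, n - 1)` and `(n - 1, n + 1)` is a sum of Fronsdal
cocycles and of a form closed in each bidegree. -/
lemma exists_fronsdal [CharZero k] {n : k} {U V U' V' : Fin 2 → Fin 2 → M}
    (hV : ∀ i j, W.Hom (n + 1) (n - 1) (V i j)) (hU : ∀ i j, W.Hom (n + 1) (n - 1) (U i j))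
    (hU' : ∀ i j, W.Hom (n - 1) (n + 1) (U' i j)) (hV' : ∀ i j, W.Hom (n - 1) (n + 1) (V' i j))
    (hn : n ≠ 0) (hn1 : n + 1 ≠ 0) (hn2 : n + 2 ≠ 0)
    (h : ∀ γ φ, W.threeForm U V γ φ - W.swap.threeForm V' U' φ γ = 0) :
    ∃ p q, W.Hom (n + 1) (n + 1) p ∧ W.Hom (n - 1) (n - 1) q ∧
      (∀ γ φ, W.threeForm (fun i j => U i j - W.yt i (W.yt j q))
        (fun i j => V i j - W.dz i (W.dz j p)) γ φ = 0) ∧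
      ∀ γ φ, W.swap.threeForm (fun i j => V' i j - W.zt i (W.zt j q))
        (fun i j => U' i j - W.dy i (W.dy j p)) φ γ = 0 := by
  obtain ⟨e1, e2⟩ := closed_pair_parts hV hU hU' hV' hn1 h
  -- The normalisations are the eigenvalues `(n+1) n` of the double contraction on second
  -- derivatives of `p` and `(n+1)(n+2)` of the double curl on quadratic multiples of `q`. By
  -- `closed_pair_parts` the same `p` and `q` serve the mirror components.
  have hp : W.Hom (n + 1) (n + 1) (((n + 1) * n)⁻¹ • W.zDot fun φ => W.zDot fun β => V β φ) :=
    ((Hom.zDot fun φ => Hom.zDot fun β => hV β φ).congr rfl (by ring)).smul _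
  have hq : W.Hom (n - 1) (n - 1)
      (((n + 1) * (n + 2))⁻¹ • W.yCurl fun φ => W.yCurl fun β => U β φ) :=
    ((Hom.yCurl fun φ => Hom.yCurl fun β => hU β φ).congr (by ring) rfl).smul _
  refine ⟨_, _, hp, hq, ?_⟩
  set p := ((n + 1) * n)⁻¹ • W.zDot fun φ => W.zDot fun β => V β φ with hpd
  set q := ((n + 1) * (n + 2))⁻¹ • W.yCurl fun φ => W.yCurl fun β => U β φ with hqd
  have ep : ((n + 1) * n) • p = W.zDot fun φ => W.zDot fun β => V β φ :=
    smul_inv_smul₀ (mul_ne_zero hn1 hn) _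
  have eq : ((n + 1) * (n + 2)) • q = W.yCurl fun φ => W.yCurl fun β => U β φ :=
    smul_inv_smul₀ (mul_ne_zero hn1 hn2) _
  have p1 : W.yDot (fun γ => W.yDot fun α => W.dy α (W.dy γ p)) = ((n + 1) * n) • p := by
    rw [hp.yDot_yDot_dy_dy, add_sub_cancel_right]
  have p2 : W.zDot (fun γ => W.zDot fun α => W.dz α (W.dz γ p)) = ((n + 1) * n) • p := by
    rw [← add_sub_cancel_right n 1, add_sub_cancel_right n 1]
    exact hp.swap.yDot_yDot_dy_dy.trans (by rw [add_sub_cancel_right])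
  have q1 : W.yCurl (fun γ => W.yCurl fun α => W.yt α (W.yt γ q)) = ((n + 1) * (n + 2)) • q := by
    rw [hq.yCurl_yCurl_yt_yt]; congr 1; ring
  have q2 : W.zCurl (fun γ => W.zCurl fun α => W.zt α (W.zt γ q)) = ((n + 1) * (n + 2)) • q :=
    hq.swap.yCurl_yCurl_yt_yt.trans (by congr 1; ring)
  refine closed_of_pair (n := n)
    (fun i j => (hV i j).sub (((hp.dz j).dz i).congr rfl (by ring)))
    (fun i j => (hU i j).sub (((hq.yt j).yt i).congr (by ring) rfl))
    (fun i j => (hU' i j).sub (((hp.dy j).dy i).congr (by ring) rfl))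
    (fun i j => (hV' i j).sub (((hq.zt j).zt i).congr rfl (by ring))) hn1 (fun γ φ => ?_) ?_ ?_ ?_ ?_
  · rw [threeForm_sub, threeForm_sub, sub_sub_sub_comm, h, threeForm_fronsdal hp hq, sub_zero]
  · simp only [zDot_sub]; rw [p2, ep, sub_self]
  · simp only [yCurl_sub]; rw [q1, eq, sub_self]
  · simp only [zCurl_sub]; rw [q2, eq, e2, sub_self]
  · simp only [yDot_sub]; rw [p1, ep, e1, sub_self]

/-- `symm_decomp` degenerates in degree zero, so `U` is integrated twice by hand. Its curls vanish
for degree reasons, and the symmetry of `U` makes the first potential curl-free. -/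
lemma exists_eq_dy_dy_of_const [CharZero k] {b : k} {U : Fin 2 → Fin 2 → M}
    (hUs : ∀ i j, U i j = U j i) (hU : ∀ i j, W.Hom 0 b (U i j))
    (hneg : ∀ c m, W.Hom (-1) c m → m = 0) :
    ∃ p, W.Hom 2 b p ∧ ∀ i j, U i j = W.dy i (W.dy j p) := by
  have e : ∀ i j, U i j = W.dy i (W.yDot fun i => U i j) := fun i j => by
    have h1 := covector_decomp (W := W) (fun i => (hU i j).1) i
    have h2 := hneg _ _ ((Hom.yCurl fun i => hU i j).congr (zero_sub 1) rfl)
    rwa [h2, map_zero, sub_zero, zero_add, one_smul] at h1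
  have hφ : ∀ j, W.Hom 1 b (W.yDot fun i => U i j) := fun j =>
    (Hom.yDot fun i => hU i j).congr (zero_add 1) rfl
  refine ⟨(2 : k)⁻¹ • W.yDot fun j => W.yDot fun i => U i j,
    ((Hom.yDot hφ).congr one_add_one_eq_two rfl).smul _, fun i j => ?_⟩
  have h1 := covector_decomp (W := W) (fun j => (hφ j).1) j
  have h2 : W.yCurl (fun j => W.yDot fun i => U i j) = 0 := by
    rw [yCurl, ← e, ← e, hUs, sub_self]
  rw [h2, map_zero, sub_zero, one_add_one_eq_two] at h1
  rw [map_smul, ← h1, inv_smul_smul₀ two_ne_zero, ← e]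

end WeylOps

/-! ### Setting one kind of spinor variable to zero -/

section Substitution
variable {A : Type*} [CommRing A]

/-- As a bidegree projection, the substitution commutes with all other such projections. -/
lemma holomorphicPart_eq : holomorphicPart A = bidegProj A fun _ Nb => Nb = 0 := by
  classical
  refine (MvPolynomial.basisMonomials (Fin 2 ⊕ Fin 2) A).ext fun m => ?_
  rw [MvPolynomial.coe_basisMonomials, bidegProj_monomial, holomorphicPart,
    AlgHom.toLinearMap_apply, MvPolynomial.aeval_monomial, Finsupp.prod_fintype _ _ (by simp),
    MvPolynomial.monomial_eq, Finsupp.prod_fintype _ _ (by simp)]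
  simp only [Fintype.prod_sum_type, Fin.prod_univ_two, degYBar, Fin.sum_univ_two, Sum.elim_inl,
    Sum.elim_inr, map_one, one_mul]
  split_ifs with h
  · obtain ⟨h0, h1⟩ := Nat.add_eq_zero_iff.1 h
    simp [h0, h1]
  · rcases Nat.eq_zero_or_pos (m (Sum.inr 0)) with h0 | h0
    · rw [zero_pow (M₀ := SpinorPoly A) (n := m (Sum.inr 1)) (by omega)]; simp
    · rw [zero_pow (M₀ := SpinorPoly A) (n := m (Sum.inr 0)) (by omega)]; simp

lemma antiholomorphicPart_eq : antiholomorphicPart A = bidegProj A fun N _ => N = 0 := by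
  classical
  refine (MvPolynomial.basisMonomials (Fin 2 ⊕ Fin 2) A).ext fun m => ?_
  rw [MvPolynomial.coe_basisMonomials, bidegProj_monomial, antiholomorphicPart,
    AlgHom.toLinearMap_apply, MvPolynomial.aeval_monomial, Finsupp.prod_fintype _ _ (by simp),
    MvPolynomial.monomial_eq, Finsupp.prod_fintype _ _ (by simp)]
  simp only [Fintype.prod_sum_type, Fin.prod_univ_two, degY, Fin.sum_univ_two, Sum.elim_inl,
    Sum.elim_inr, map_one, one_mul]
  split_ifs with h
  · obtain ⟨h0, h1⟩ := Nat.add_eq_zero_iff.1 h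
    simp [h0, h1]
  · rcases Nat.eq_zero_or_pos (m (Sum.inl 0)) with h0 | h0
    · rw [zero_pow (M₀ := SpinorPoly A) (n := m (Sum.inl 1)) (by omega)]; simp
    · rw [zero_pow (M₀ := SpinorPoly A) (n := m (Sum.inl 0)) (by omega)]; simp

variable [Algebra ℂ A]

lemma holomorphicPart_of_hom {a b : ℤ} {f : SpinorPoly A} (hf : (polyOps A).Hom a b f) :
    holomorphicPart A f = if b = 0 then f else 0 := by
  rw [holomorphicPart_eq]
  split_ifs with h
  · exact bidegProj_of_hom hf fun _ _ _ _ => by omega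
  · exact bidegProj_of_hom_not hf fun _ _ _ _ => by omega

lemma antiholomorphicPart_of_hom {a b : ℤ} {f : SpinorPoly A} (hf : (polyOps A).Hom a b f) :
    antiholomorphicPart A f = if a = 0 then f else 0 := by
  rw [antiholomorphicPart_eq]
  split_ifs with h
  · exact bidegProj_of_hom hf fun _ _ _ _ => by omega
  · exact bidegProj_of_hom_not hf fun _ _ _ _ => by omega

lemma homProj_holomorphicPart (a b : ℤ) (f : SpinorPoly A) :
    homProj A a b (holomorphicPart A f) = if b = 0 then homProj A a b f else 0 := by
  rw [holomorphicPart_eq, homProj_bidegProj, ← holomorphicPart_eq,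
    holomorphicPart_of_hom (homProj_hom a b f)]

lemma homProj_antiholomorphicPart (a b : ℤ) (f : SpinorPoly A) :
    homProj A a b (antiholomorphicPart A f) = if a = 0 then homProj A a b f else 0 := by
  rw [antiholomorphicPart_eq, homProj_bidegProj, ← antiholomorphicPart_eq,
    antiholomorphicPart_of_hom (homProj_hom a b f)]

end Substitution

/-! ### Representatives and closedness of two-forms in components -/

section Two
variable {A : Type*} [CommRing A] [Algebra ℂ A] {L : Type*} [AddCommGroup L] [Module A L]
  (h : Module.Basis (Fin 2 × Fin 2) A L)
open WeylOps

lemma weyl_eq (C : SpinorPoly A) : weyl h C = twoForm h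
    (fun i j => (polyOps A).dy i ((polyOps A).dy j (holomorphicPart A C)))
    (fun i j => (polyOps A).dz i ((polyOps A).dz j (antiholomorphicPart A C))) := by
  simp only [weyl, LinearMap.sum_apply]; rfl

lemma fronsdalA_eq (C : SpinorPoly A) : fronsdalA h C = twoForm h
    (fun i j => (polyOps A).dy i ((polyOps A).dy j C))
    (fun i j => (polyOps A).dz i ((polyOps A).dz j C)) := by
  simp only [fronsdalA, LinearMap.sum_apply]; rfl

lemma fronsdalB_eq (C : SpinorPoly A) : fronsdalB h C = twoForm h
    (fun i j => (polyOps A).yt i ((polyOps A).yt j C))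
    (fun i j => (polyOps A).zt i ((polyOps A).zt j C)) := by
  -- The convention for `yt` is opposite to `yLow`; the sign cancels in the quadratic expression.
  have e1 : ∀ i f, yLow A i f = -(polyOps A).yt i f := fun i f => by
    fin_cases i <;> simp [yLow, eps, yt]
  have e2 : ∀ i f, yBarLow A i f = -(polyOps A).zt i f := fun i f => by
    fin_cases i <;> simp [yBarLow, eps, zt, yt, swap]
  simp only [fronsdalB, LinearMap.sum_apply, LinearMap.add_apply, formOp, LinearMap.comp_apply,
    e1, e2, map_neg, neg_neg]
  rfl

/-- The condition for a two-form to be closed, in components. -/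
lemma twoForm_mem_cocycles_iff {U V : Fin 2 → Fin 2 → SpinorPoly A}
    (hU : ∀ i j, U i j ∈ bosonicPoly A) (hV : ∀ i j, V i j ∈ bosonicPoly A)
    (hUs : ∀ i j, U i j = U j i) (hVs : ∀ i j, V i j = V j i) :
    twoForm h U V ∈ cocycles h 2 ↔ ∀ (a b : ℤ) γ φ,
      (polyOps A).threeForm (fun i j => if b < a + 2 then homProj A (a + 1) (b - 1) (U i j) else 0)
        (fun i j => if b < a + 2 then homProj A (a + 1) (b - 1) (V i j) else 0) γ φ -
      (polyOps A).swap.threeForm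
        (fun i j => if a < b + 2 then homProj A (a - 1) (b + 1) (V i j) else 0)
        (fun i j => if a < b + 2 then homProj A (a - 1) (b + 1) (U i j) else 0) φ γ = 0 := by
  have key : ∀ (a b : ℤ) γ φ, homProj A a b
      ((polyOps A).threeForm (fun i j => gtProj A (U i j)) (fun i j => gtProj A (V i j)) γ φ -
      (polyOps A).swap.threeForm (fun i j => ltProj A (V i j)) (fun i j => ltProj A (U i j))
        φ γ) =
      (polyOps A).threeForm (fun i j => if b < a + 2 then homProj A (a + 1) (b - 1) (U i j) else 0)
        (fun i j => if b < a + 2 then homProj A (a + 1) (b - 1) (V i j) else 0) γ φ -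
      (polyOps A).swap.threeForm
        (fun i j => if a < b + 2 then homProj A (a - 1) (b + 1) (V i j) else 0)
        (fun i j => if a < b + 2 then homProj A (a - 1) (b + 1) (U i j) else 0) φ γ :=
    fun a b γ φ => by
      have c1 : (a + 1 > b - 1) = (b < a + 2) := propext (by omega)
      have c2 : (a - 1 < b + 1) = (a < b + 2) := propext (by omega)
      rw [map_sub, homProj_threeForm, homProj_swap_threeForm]
      simp only [homProj_gtProj, homProj_ltProj, c1, c2]
  rw [cocycles, Submodule.mem_inf, LinearMap.mem_ker, sigmaMinus_twoForm h hUs hVs]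
  refine ⟨fun H a b γ φ => ?_, fun H => ⟨twoForm_mem h hU hV, ?_⟩⟩
  · rw [← key, (smul_eq_zero.1 (triForm_eq_zero h H.2 γ φ)).resolve_left (by simp), map_zero]
  · have : ∀ γ φ, (polyOps A).threeForm (fun i j => gtProj A (U i j))
      (fun i j => gtProj A (V i j)) γ φ - (polyOps A).swap.threeForm
        (fun i j => ltProj A (V i j)) (fun i j => ltProj A (U i j)) φ γ = 0 := fun γ φ =>
      eq_zero_of_homProj fun a b => by rw [key, H]
    simp only [this]
    simp [triForm]

end Two

/-! ### Closedness of the Fronsdal and Weyl cocycles; components of exact two-forms -/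

section Two
variable {A : Type*} [CommRing A] [Algebra ℂ A] {L : Type*} [AddCommGroup L] [Module A L]
  (h : Module.Basis (Fin 2 × Fin 2) A L)
open WeylOps

lemma homProj_dy_dy (a b : ℤ) (i j : Fin 2) (f : SpinorPoly A) :
    homProj A a b ((polyOps A).dy i ((polyOps A).dy j f)) =
      (polyOps A).dy i ((polyOps A).dy j (homProj A (a + 2) b f)) := by
  rw [homProj_polyOps_dy, homProj_polyOps_dy, add_assoc, one_add_one_eq_two]

lemma homProj_dz_dz (a b : ℤ) (i j : Fin 2) (f : SpinorPoly A) :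
    homProj A a b ((polyOps A).dz i ((polyOps A).dz j f)) =
      (polyOps A).dz i ((polyOps A).dz j (homProj A a (b + 2) f)) := by
  rw [homProj_polyOps_dz, homProj_polyOps_dz, add_assoc, one_add_one_eq_two]

lemma homProj_yt_yt (a b : ℤ) (i j : Fin 2) (f : SpinorPoly A) :
    homProj A a b ((polyOps A).yt i ((polyOps A).yt j f)) =
      (polyOps A).yt i ((polyOps A).yt j (homProj A (a - 2) b f)) := by
  rw [homProj_yt, homProj_yt, sub_sub, one_add_one_eq_two]

lemma homProj_zt_zt (a b : ℤ) (i j : Fin 2) (f : SpinorPoly A) :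
    homProj A a b ((polyOps A).zt i ((polyOps A).zt j f)) =
      (polyOps A).zt i ((polyOps A).zt j (homProj A a (b - 2) f)) := by
  rw [homProj_zt, homProj_zt, sub_sub, one_add_one_eq_two]

lemma zt_comm (i j : Fin 2) (f : SpinorPoly A) :
    (polyOps A).zt i ((polyOps A).zt j f) = (polyOps A).zt j ((polyOps A).zt i f) :=
  (polyOps A).swap.yt_comm i j f

lemma dy_dy_mem_bosonic {f : SpinorPoly A} (hf : f ∈ bosonicPoly A) (i j : Fin 2) :
    (polyOps A).dy i ((polyOps A).dy j f) ∈ bosonicPoly A :=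
  mem_bosonicPoly_iff.2 fun a b hab => by
    rw [homProj_dy_dy, homProj_bosonic hf (by rw [Int.even_iff] at *; omega), map_zero, map_zero]

lemma dz_dz_mem_bosonic {f : SpinorPoly A} (hf : f ∈ bosonicPoly A) (i j : Fin 2) :
    (polyOps A).dz i ((polyOps A).dz j f) ∈ bosonicPoly A :=
  mem_bosonicPoly_iff.2 fun a b hab => by
    rw [homProj_dz_dz, homProj_bosonic hf (by rw [Int.even_iff] at *; omega), map_zero, map_zero]

lemma yt_yt_mem_bosonic {f : SpinorPoly A} (hf : f ∈ bosonicPoly A) (i j : Fin 2) :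
    (polyOps A).yt i ((polyOps A).yt j f) ∈ bosonicPoly A :=
  mem_bosonicPoly_iff.2 fun a b hab => by
    rw [homProj_yt_yt, homProj_bosonic hf (by rw [Int.even_iff] at *; omega), map_zero, map_zero]

lemma zt_zt_mem_bosonic {f : SpinorPoly A} (hf : f ∈ bosonicPoly A) (i j : Fin 2) :
    (polyOps A).zt i ((polyOps A).zt j f) ∈ bosonicPoly A :=
  mem_bosonicPoly_iff.2 fun a b hab => by
    rw [homProj_zt_zt, homProj_bosonic hf (by rw [Int.even_iff] at *; omega), map_zero, map_zero]

lemma holomorphicPart_mem_bosonic {f : SpinorPoly A} (hf : f ∈ bosonicPoly A) :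
    holomorphicPart A f ∈ bosonicPoly A :=
  mem_bosonicPoly_iff.2 fun a b hab => by
    rw [homProj_holomorphicPart, homProj_bosonic hf hab, ite_self]

lemma antiholomorphicPart_mem_bosonic {f : SpinorPoly A} (hf : f ∈ bosonicPoly A) :
    antiholomorphicPart A f ∈ bosonicPoly A :=
  mem_bosonicPoly_iff.2 fun a b hab => by
    rw [homProj_antiholomorphicPart, homProj_bosonic hf hab, ite_self]

/-- Images from above and below the diagonal cancel in bidegrees `(a, a)` by `threeForm_fronsdal`.
Elsewhere only off-diagonal components of `p` and `q` would enter. -/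
lemma fronsdal_mem_cocycles {p q : SpinorPoly A} (hp : p ∈ diagonalPoly A)
    (hq : q ∈ diagonalPoly A) : fronsdalA h p + fronsdalB h q ∈ cocycles h 2 := by
  have hp' := diagonalPoly_le_bosonicPoly hp
  have hq' := diagonalPoly_le_bosonicPoly hq
  rw [fronsdalA_eq, fronsdalB_eq, ← twoForm_add, twoForm_mem_cocycles_iff h
    (fun i j => add_mem (dy_dy_mem_bosonic hp' i j) (yt_yt_mem_bosonic hq' i j))
    (fun i j => add_mem (dz_dz_mem_bosonic hp' i j) (zt_zt_mem_bosonic hq' i j))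
    (fun i j => by rw [(polyOps A).dy_dy, yt_comm])
    (fun i j => by rw [(polyOps A).dz_dz, zt_comm])]
  intro a b γ φ
  simp only [map_add, homProj_dy_dy, homProj_dz_dz, homProj_yt_yt, homProj_zt_zt]
  by_cases hab : a = b
  · subst hab
    rw [← threeForm_fronsdal (n := (a : ℂ)) (W := polyOps A)
      ((homProj_hom (a + 1) (a + 1) p).congr (by push_cast; ring) (by push_cast; ring))
      ((homProj_hom (a - 1) (a - 1) q).congr (by push_cast; ring) (by push_cast; ring)) γ φ]
    rw [homProj_diagonal hp (a := a + 1 + 2) (by omega), homProj_diagonal hp (b := a + 1 + 2) (by omega),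
      homProj_diagonal hq (a := a - 1 - 2) (by omega), homProj_diagonal hq (b := a - 1 - 2) (by omega)]
    simp only [if_pos (show a < a + 2 by omega), map_zero, add_zero, zero_add,
      show a + 1 - 2 = a - 1 by ring, show a - 1 + 2 = a + 1 by ring]
  · have eA : ∀ i j, (if b < a + 2 then (polyOps A).dy i ((polyOps A).dy j
        (homProj A (a + 1 + 2) (b - 1) p)) + (polyOps A).yt i ((polyOps A).yt j
        (homProj A (a + 1 - 2) (b - 1) q)) else 0) = 0 := fun i j => by
      split_ifs
      · rw [homProj_diagonal hp (by omega), homProj_diagonal hq (by omega)]; simp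
      · rfl
    have eB : ∀ i j, (if b < a + 2 then (polyOps A).dz i ((polyOps A).dz j
        (homProj A (a + 1) (b - 1 + 2) p)) + (polyOps A).zt i ((polyOps A).zt j
        (homProj A (a + 1) (b - 1 - 2) q)) else 0) = 0 := fun i j => by
      split_ifs
      · rw [homProj_diagonal hp (by omega), homProj_diagonal hq (by omega)]; simp
      · rfl
    have eC : ∀ i j, (if a < b + 2 then (polyOps A).dy i ((polyOps A).dy j
        (homProj A (a - 1 + 2) (b + 1) p)) + (polyOps A).yt i ((polyOps A).yt j
        (homProj A (a - 1 - 2) (b + 1) q)) else 0) = 0 := fun i j => by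
      split_ifs
      · rw [homProj_diagonal hp (by omega), homProj_diagonal hq (by omega)]; simp
      · rfl
    have eD : ∀ i j, (if a < b + 2 then (polyOps A).dz i ((polyOps A).dz j
        (homProj A (a - 1) (b + 1 + 2) p)) + (polyOps A).zt i ((polyOps A).zt j
        (homProj A (a - 1) (b + 1 - 2) q)) else 0) = 0 := fun i j => by
      split_ifs
      · rw [homProj_diagonal hp (by omega), homProj_diagonal hq (by omega)]; simp
      · rfl
    simp only [eA, eB, eC, eD]
    simp [threeForm, yCurl, zDot_def]

/-- A matrix of second derivatives has no curl. The other term of the three-form is absent, because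
a form with `N = 0` is never above the diagonal and one with `N̄ = 0` never below. -/
lemma weyl_mem_cocycles {C : SpinorPoly A} (hC : C ∈ bosonicPoly A) :
    weyl h C ∈ cocycles h 2 := by
  have hU := dy_dy_mem_bosonic (holomorphicPart_mem_bosonic hC)
  have hV := dz_dz_mem_bosonic (antiholomorphicPart_mem_bosonic hC)
  rw [weyl_eq, twoForm_mem_cocycles_iff h hU hV (fun i j => (polyOps A).dy_dy _ _ _)
    (fun i j => (polyOps A).dz_dz _ _ _)]
  intro a b γ φ
  have e1 : ∀ i j, (if b < a + 2 then homProj A (a + 1) (b - 1) ((polyOps A).dz i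
      ((polyOps A).dz j (antiholomorphicPart A C))) else 0) = 0 := fun i j => by
    split_ifs
    · by_cases ha : a + 1 = 0
      · exact eq_zero_of_hom_neg (homProj_hom _ _ _) (by omega)
      · rw [homProj_dz_dz, homProj_antiholomorphicPart, if_neg ha, map_zero, map_zero]
    · rfl
  have e2 : ∀ i j, (if a < b + 2 then homProj A (a - 1) (b + 1) ((polyOps A).dy i
      ((polyOps A).dy j (holomorphicPart A C))) else 0) = 0 := fun i j => by
    split_ifs
    · by_cases hb : b + 1 = 0
      · exact eq_zero_of_hom_neg (homProj_hom _ _ _) (by omega)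
      · rw [homProj_dy_dy, homProj_holomorphicPart, if_neg hb, map_zero, map_zero]
    · rfl
  have z1 : (polyOps A).zDot (fun _ => (0 : SpinorPoly A)) = 0 := (polyOps A).swap.yDot_zero
  simp only [e1, e2]
  simp only [threeForm, homProj_dy_dy, homProj_dz_dz, swap_zDot, yDot_zero, z1, map_zero,
    sub_zero, swap_yCurl]
  have c1 : (polyOps A).yCurl (fun _ => (0 : SpinorPoly A)) = 0 := by simp [yCurl]
  have c2 : (polyOps A).zCurl (fun _ => (0 : SpinorPoly A)) = 0 := by simp [zCurl_def]
  split_ifs <;> simp only [yCurl_dy, zCurl_dz, c1, c2, map_zero, sub_self]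

lemma exact_twoForm_components {U V f : Fin 2 → Fin 2 → SpinorPoly A}
    (hUs : ∀ i j, U i j = U j i) (hVs : ∀ i j, V i j = V j i)
    (H : twoForm h U V = sigmaMinus h (oneForm h f)) (a b : ℤ) (α γ : Fin 2) :
    homProj A a b (U α γ) = (Complex.I / 4) •
      ((polyOps A).symU (fun i j => if b < a + 2 then homProj A (a + 1) (b - 1) (f i j) else 0) α γ +
        (polyOps A).swap.symV
          (fun i j => if a < b + 2 then homProj A (a - 1) (b + 1) (f j i) else 0) α γ) ∧
    homProj A a b (V α γ) = (Complex.I / 4) •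
      ((polyOps A).symV (fun i j => if b < a + 2 then homProj A (a + 1) (b - 1) (f i j) else 0) α γ +
        (polyOps A).swap.symU
          (fun i j => if a < b + 2 then homProj A (a - 1) (b + 1) (f j i) else 0) α γ) := by
  rw [sigmaMinus_oneForm, ← sub_eq_zero, ← twoForm_sub] at H
  have := twoForm_eq_zero h (fun i j => by simp only [hUs i j, symU, symV, add_comm])
    (fun i j => by simp only [hVs i j, symU, symV, add_comm]) H α γ
  have c1 : (a + 1 > b - 1) = (b < a + 2) := propext (by omega)
  have c2 : (a - 1 < b + 1) = (a < b + 2) := propext (by omega)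
  constructor
  · rw [sub_eq_zero.1 this.1, homProj_smul, map_add, homProj_symU, homProj_swap_symV]
    simp only [homProj_gtProj, homProj_ltProj, c1, c2]
  · rw [sub_eq_zero.1 this.2, homProj_smul, map_add, homProj_symV, homProj_swap_symU]
    simp only [homProj_gtProj, homProj_ltProj, c1, c2]

end Two

/-! ### Independence of the `H²` representatives modulo exact forms -/

section Two
variable {A : Type*} [CommRing A] [Algebra ℂ A] {L : Type*} [AddCommGroup L] [Module A L]
  (h : Module.Basis (Fin 2 × Fin 2) A L)
open WeylOps

/-- This and `yCurl_yCurl_symU` are the invariants that separate `E_A` and `E_B` from exact forms.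
-/
lemma zDot_zDot_symV {M : Type*} [AddCommGroup M] [Module ℂ M] (W : WeylOps ℂ M)
    (f : Fin 2 → Fin 2 → M) :
    W.zDot (fun γ => W.zDot fun α => W.symV f α γ) = 0 :=
  W.swap.yDot_yDot_symYt fun δ => W.yCurl fun i => f i δ

lemma yCurl_yCurl_symU {M : Type*} [AddCommGroup M] [Module ℂ M] (W : WeylOps ℂ M)
    (f : Fin 2 → Fin 2 → M) :
    W.yCurl (fun γ => W.yCurl fun α => W.symU f α γ) = 0 :=
  W.yCurl_yCurl_symDy fun γ => W.zDot (f γ)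

/-- `P` and `Q` stand for the holomorphic and antiholomorphic parts of the Weyl polynomial.
Components of `p`, `P`, `Q` of low degree are killed by two derivatives, so only their second
derivatives can be shown to vanish. -/
lemma weyl_add_fronsdal_exact {P Q p q : SpinorPoly A} {f : Fin 2 → Fin 2 → SpinorPoly A}
    (hP : ∀ a b : ℤ, b ≠ 0 → homProj A a b P = 0) (hQ : ∀ a b : ℤ, a ≠ 0 → homProj A a b Q = 0)
    (hp : p ∈ diagonalPoly A) (hq : q ∈ diagonalPoly A) (hf : ∀ i j, f i j ∈ bosonicPoly A)
    (H : twoForm h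
        (fun i j => (polyOps A).dy i ((polyOps A).dy j P) + ((polyOps A).dy i ((polyOps A).dy j p) +
          (polyOps A).yt i ((polyOps A).yt j q)))
        (fun i j => (polyOps A).dz i ((polyOps A).dz j Q) + ((polyOps A).dz i ((polyOps A).dz j p) +
          (polyOps A).zt i ((polyOps A).zt j q))) = sigmaMinus h (oneForm h f)) :
    q = 0 ∧ (∀ i j, (polyOps A).dy i ((polyOps A).dy j p) = 0) ∧
      (∀ i j, (polyOps A).dz i ((polyOps A).dz j p) = 0) ∧
      (∀ i j, (polyOps A).dy i ((polyOps A).dy j P) = 0) ∧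
      ∀ i j, (polyOps A).dz i ((polyOps A).dz j Q) = 0 := by
  have key := fun a b α γ => exact_twoForm_components h
    (fun i j => by simp only [(polyOps A).dy_dy i j, (polyOps A).yt_comm i j])
    (fun i j => by simp only [(polyOps A).dz_dz i j, zt_comm i j]) H a b α γ
  simp only [map_add, homProj_dy_dy, homProj_dz_dz, homProj_yt_yt, homProj_zt_zt] at key
  have hq0 : q = 0 := by
    refine eq_zero_of_homProj fun a b => ?_
    by_cases hab : a = b
    swap
    · exact homProj_diagonal hq hab
    subst hab
    by_cases ha : 0 ≤ a
    swap
    · exact eq_zero_of_hom_neg (homProj_hom _ _ _) (by omega)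
    -- In bidegree `(a+2, a)` the source from below would be `(a+1, a+1)`, where `σ₋` is zero. The
    -- double curl kills the remaining exact term and the Weyl term, leaving `(a+2)(a+3) q`.
    have e := fun α γ => (key (a + 2) a α γ).1
    simp only [homProj_diagonal hp (show a + 2 + 2 ≠ a by omega), map_zero, zero_add,
      if_neg (show ¬ a + 2 < a + 2 by omega), symV_zero, add_zero, add_sub_cancel_right] at e
    have e' := congrArg (fun S : Fin 2 → Fin 2 → SpinorPoly A =>
      (polyOps A).yCurl fun γ => (polyOps A).yCurl fun α => S α γ) (funext₂ e)
    simp only [yCurl_add, yCurl_smul, yCurl_yCurl_symU, yCurl_dy, smul_zero,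
      (homProj_hom a a q).yCurl_yCurl_yt_yt] at e'
    have z : (polyOps A).yCurl (fun _ => (0 : SpinorPoly A)) = 0 := by simp [yCurl]
    rw [z, zero_add] at e'
    refine (smul_eq_zero.1 e').resolve_left ?_
    exact_mod_cast mul_ne_zero (by omega : a + 2 ≠ 0) (by omega : a + 3 ≠ 0)
  have hp0 : ∀ a b : ℤ, 2 ≤ a → homProj A a b p = 0 := fun a b ha => by
    by_cases hab : a = b
    swap
    · exact homProj_diagonal hp hab
    subst hab
    -- Likewise the source from below is now the diagonal `(a-1, a-1)`, and the double contraction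
    -- of `V` gives `a(a-1) p`.
    have e := fun α γ => (key a (a - 2) α γ).2
    simp only [hq0, map_zero, add_zero, sub_add_cancel, hQ a _ (by omega), zero_add,
      if_neg (show ¬ a < a by omega), symU_zero] at e
    have e' := congrArg (fun S : Fin 2 → Fin 2 → SpinorPoly A =>
      (polyOps A).zDot fun γ => (polyOps A).zDot fun α => S α γ) (funext₂ e)
    have z := (homProj_hom a a p).swap.yDot_yDot_dy_dy
    simp only [zDot_smul, zDot_zDot_symV, smul_zero] at e'
    refine (smul_eq_zero.1 (z.symm.trans e')).resolve_left ?_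
    exact_mod_cast mul_ne_zero (by omega : a ≠ 0) (by omega : a - 1 ≠ 0)
  have hpU : ∀ i j, (polyOps A).dy i ((polyOps A).dy j p) = 0 := fun i j =>
    eq_zero_of_homProj fun a b => by
      by_cases ha : 0 ≤ a
      · rw [homProj_dy_dy, hp0 _ _ (by omega), map_zero, map_zero]
      · exact eq_zero_of_hom_neg (homProj_hom _ _ _) (by omega)
  have hpV : ∀ i j, (polyOps A).dz i ((polyOps A).dz j p) = 0 := fun i j =>
    eq_zero_of_homProj fun a b => by
      by_cases hab : a = b + 2
      · by_cases hb : 0 ≤ b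
        · rw [homProj_dz_dz, hp0 _ _ (by omega), map_zero, map_zero]
        · exact eq_zero_of_hom_neg (homProj_hom _ _ _) (by omega)
      · rw [homProj_dz_dz, homProj_diagonal hp hab, map_zero, map_zero]
  refine ⟨hq0, hpU, hpV, fun i j => eq_zero_of_homProj fun a b => ?_,
    fun i j => eq_zero_of_homProj fun a b => ?_⟩
  · rw [homProj_dy_dy]
    by_cases hb : b = 0
    swap
    · rw [hP _ _ hb, map_zero, map_zero]
    subst hb
    have e := (key a 0 i j).1
    rw [← homProj_dy_dy a 0 i j p, hpU] at e
    have e1 : ∀ i j, homProj A (a + 1) (0 - 1) (f i j) = 0 := fun i j =>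
      eq_zero_of_hom_neg (homProj_hom _ _ _) (by omega)
    -- The only source with nonnegative degrees is `(0, 1)`, at `a = 1`, and it is excluded because
    -- `f` is bosonic.
    have e2 : ∀ i j, (if a < 0 + 2 then homProj A (a - 1) (0 + 1) (f i j) else 0) = 0 :=
      fun i j => by
        split_ifs
        · by_cases ha : a = 1
          · exact homProj_bosonic (hf i j) (by rw [Int.even_iff]; omega)
          · exact eq_zero_of_hom_neg (homProj_hom _ _ _) (by omega)
        · rfl
    simpa only [hq0, e1, e2, ite_self, symU_zero, symV_zero, map_zero, add_zero, smul_zero] using e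
  · rw [homProj_dz_dz]
    by_cases ha : a = 0
    swap
    · rw [hQ _ _ ha, map_zero, map_zero]
    subst ha
    have e := (key 0 b i j).2
    rw [← homProj_dz_dz 0 b i j p, hpV] at e
    have e1 : ∀ i j, homProj A (0 - 1) (b + 1) (f i j) = 0 := fun i j =>
      eq_zero_of_hom_neg (homProj_hom _ _ _) (by omega)
    have e2 : ∀ i j, (if b < 0 + 2 then homProj A (0 + 1) (b - 1) (f i j) else 0) = 0 :=
      fun i j => by
        split_ifs
        · by_cases hb : b = 1
          · exact homProj_bosonic (hf i j) (by rw [Int.even_iff]; omega)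
          · exact eq_zero_of_hom_neg (homProj_hom _ _ _) (by omega)
        · rfl
    simpa only [hq0, e1, e2, ite_self, symU_zero, symV_zero, map_zero, add_zero, smul_zero] using e

lemma weyl_add_fronsdal_eq_zero {C p q : SpinorPoly A} {f : Fin 2 → Fin 2 → SpinorPoly A}
    (hp : p ∈ diagonalPoly A) (hq : q ∈ diagonalPoly A) (hf : ∀ i j, f i j ∈ bosonicPoly A)
    (H : weyl h C + (fronsdalA h p + fronsdalB h q) = sigmaMinus h (oneForm h f)) :
    weyl h C = 0 ∧ fronsdalA h p = 0 ∧ fronsdalB h q = 0 := by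
  rw [weyl_eq, fronsdalA_eq, fronsdalB_eq, ← twoForm_add, ← twoForm_add] at H
  obtain ⟨e1, e2, e3, e4, e5⟩ := weyl_add_fronsdal_exact h
    (fun a b hb => by rw [homProj_holomorphicPart, if_neg hb])
    (fun a b ha => by rw [homProj_antiholomorphicPart, if_neg ha]) hp hq hf H
  rw [weyl_eq, fronsdalA_eq, e1, map_zero]
  simp only [e2, e3, e4, e5]
  simp [twoForm]

theorem iSupIndep_weyl_fronsdal : iSupIndep ![(bosonicPoly A).map (weyl h),
    (diagonalPoly A).map (fronsdalA h), (diagonalPoly A).map (fronsdalB h)] := by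
  have key : ∀ w ∈ (bosonicPoly A).map (weyl h), ∀ a ∈ (diagonalPoly A).map (fronsdalA h),
      ∀ b ∈ (diagonalPoly A).map (fronsdalB h), w + (a + b) = 0 → w = 0 ∧ a = 0 ∧ b = 0 := by
    rintro _ ⟨C, -, rfl⟩ _ ⟨p, hp, rfl⟩ _ ⟨q, hq, rfl⟩ e
    refine weyl_add_fronsdal_eq_zero h (f := fun _ _ => 0) hp hq (fun _ _ => zero_mem _) ?_
    rw [e, oneForm_zero, map_zero]
  rw [iSupIndep_fin_three]
  simp only [Submodule.disjoint_def, Matrix.cons_val_zero, Matrix.cons_val_one, Matrix.cons_val]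
  refine ⟨fun x hx hx' => ?_, fun x hx hx' => ?_, fun x hx hx' => ?_⟩ <;>
    obtain ⟨u, hu, v, hv, rfl⟩ := Submodule.mem_sup.1 hx'
  · exact neg_eq_zero.1 (key _ (neg_mem hx) _ hu _ hv (neg_add_cancel _)).1
  · exact neg_eq_zero.1 (key _ hv _ (neg_mem hx) _ hu (by abel)).2.1
  · exact neg_eq_zero.1 (key _ hu _ hv _ (neg_mem hx) (by abel)).2.2

end Two

/-! ### Every closed bosonic two-form is a sum of representatives and an exact form -/

section Two
variable {A : Type*} [CommRing A] [Algebra ℂ A] {L : Type*} [AddCommGroup L] [Module A L]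
  (h : Module.Basis (Fin 2 × Fin 2) A L)
open WeylOps

/-- Compensates the prefactor `I / 4` of `sigmaMinus_oneForm` when primitives are written down. -/
lemma four_I_smul (m : SpinorPoly A) : (Complex.I / 4) • (-4 * Complex.I) • m = m := by
  rw [smul_smul, show Complex.I / 4 * (-4 * Complex.I) = -(Complex.I * Complex.I) by ring,
    Complex.I_mul_I, neg_neg, one_smul]

lemma symU_smul {M : Type*} [AddCommGroup M] [Module ℂ M] (W : WeylOps ℂ M) (c : ℂ)
    (f : Fin 2 → Fin 2 → M) (α γ : Fin 2) :
    W.symU (fun i j => c • f i j) α γ = c • W.symU f α γ := by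
  simp only [symU, zDot_smul, map_smul, smul_add]

lemma symV_smul {M : Type*} [AddCommGroup M] [Module ℂ M] (W : WeylOps ℂ M) (c : ℂ)
    (f : Fin 2 → Fin 2 → M) (α γ : Fin 2) :
    W.symV (fun i j => c • f i j) α γ = c • W.symV f α γ := by
  simp only [symV, yCurl_smul, map_smul, smul_add]

lemma twoForm_sym_mem {a b : ℤ} {f : Fin 2 → Fin 2 → SpinorPoly A}
    (hf : ∀ i j, (polyOps A).Hom a b (f i j)) (hab : a > b) (he : Even (a - b)) :
    twoForm h ((polyOps A).symU f) ((polyOps A).symV f) ∈ coboundaries h 2 := by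
  refine ⟨oneForm h fun i j => (-4 * Complex.I) • f i j, oneForm_mem h fun i j =>
    smul_mem_of_complex _ _ (mem_bosonicPoly_of_hom (hf i j) he), ?_⟩
  have e1 : ∀ i j, gtProj A ((-4 * Complex.I) • f i j) = (-4 * Complex.I) • f i j := fun i j => by
    rw [gtProj_of_hom ((hf i j).smul _), if_pos hab]
  have e2 : ∀ i j, ltProj A ((-4 * Complex.I) • f i j) = 0 := fun i j => by
    rw [ltProj_of_hom ((hf i j).smul _), if_neg (by omega)]
  rw [sigmaMinus_oneForm]
  simp only [e1, e2, symU_zero, symV_zero, add_zero, symU_smul, symV_smul, four_I_smul]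

lemma twoForm_swap_sym_mem {a b : ℤ} {f : Fin 2 → Fin 2 → SpinorPoly A}
    (hf : ∀ i j, (polyOps A).Hom a b (f i j)) (hab : a < b) (he : Even (a - b)) :
    twoForm h ((polyOps A).swap.symV fun i j => f j i) ((polyOps A).swap.symU fun i j => f j i) ∈
      coboundaries h 2 := by
  refine ⟨oneForm h fun i j => (-4 * Complex.I) • f i j, oneForm_mem h fun i j =>
    smul_mem_of_complex _ _ (mem_bosonicPoly_of_hom (hf i j) he), ?_⟩
  have e1 : ∀ i j, gtProj A ((-4 * Complex.I) • f i j) = 0 := fun i j => by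
    rw [gtProj_of_hom ((hf i j).smul _), if_neg (by omega)]
  have e2 : ∀ i j, ltProj A ((-4 * Complex.I) • f i j) = (-4 * Complex.I) • f i j := fun i j => by
    rw [ltProj_of_hom ((hf i j).smul _), if_pos hab]
  rw [sigmaMinus_oneForm]
  simp only [e1, e2, symU_zero, symV_zero, zero_add, symU_smul, symV_smul, four_I_smul]

lemma weyl_of_hom {a : ℤ} {C : SpinorPoly A} (hC : (polyOps A).Hom a 0 C) (ha : a ≠ 0) :
    weyl h C = twoForm h (fun i j => (polyOps A).dy i ((polyOps A).dy j C)) fun _ _ => 0 := by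
  have hC' : (polyOps A).Hom (a : ℂ) ((0 : ℤ) : ℂ) C := hC.congr rfl Int.cast_zero.symm
  rw [weyl_eq, holomorphicPart_of_hom hC', antiholomorphicPart_of_hom hC', if_pos rfl, if_neg ha]
  simp only [map_zero]

lemma weyl_of_hom' {b : ℤ} {C : SpinorPoly A} (hC : (polyOps A).Hom 0 b C) (hb : b ≠ 0) :
    weyl h C = twoForm h (fun _ _ => 0) fun i j => (polyOps A).dz i ((polyOps A).dz j C) := by
  have hC' : (polyOps A).Hom ((0 : ℤ) : ℂ) (b : ℂ) C := hC.congr Int.cast_zero.symm rfl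
  rw [weyl_eq, holomorphicPart_of_hom hC', antiholomorphicPart_of_hom hC', if_pos rfl, if_neg hb]
  simp only [map_zero]

lemma eq_zero_of_hom_neg_right {c : ℂ} {f : SpinorPoly A} (hf : (polyOps A).Hom c (-1) f) :
    f = 0 := by
  ext m
  by_contra hm
  have := (homZ_iff (-1) f).1 hf.2 m (by simpa using hm)
  norm_cast at this

lemma eq_zero_of_hom_neg_left {c : ℂ} {f : SpinorPoly A} (hf : (polyOps A).Hom (-1) c f) :
    f = 0 := by
  ext m
  by_contra hm
  have := (homY_iff (-1) f).1 hf.1 m (by simpa using hm)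
  norm_cast at this

variable {U V : Fin 2 → Fin 2 → SpinorPoly A} {a b : ℤ}

/-- The forms closed in a bidegree `(a, b)` with `a > b` are exact or Weyl cocycles. -/
lemma twoForm_mem_of_closed (hUs : ∀ i j, U i j = U j i) (hVs : ∀ i j, V i j = V j i)
    (hU : ∀ i j, (polyOps A).Hom a b (U i j)) (hV : ∀ i j, (polyOps A).Hom a b (V i j))
    (hb : 0 ≤ b) (hab : b < a) (he : Even (a - b))
    (H : ∀ γ φ, (polyOps A).threeForm U V γ φ = 0) :
    twoForm h U V ∈ (bosonicPoly A).map (weyl h) ⊔ coboundaries h 2 := by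
  have ha0 : (a : ℂ) ≠ 0 := by exact_mod_cast (by omega : a ≠ 0)
  have ha1 : (a : ℂ) + 1 ≠ 0 := by exact_mod_cast (by omega : a + 1 ≠ 0)
  have ha2 : (a : ℂ) + 2 ≠ 0 := by exact_mod_cast (by omega : a + 2 ≠ 0)
  rcases hb.eq_or_lt with rfl | hb
  · obtain ⟨⟨p, hp, e⟩, e'⟩ := exists_eq_dy_dy (W := polyOps A) hUs hVs
      (fun i j => (hU i j).congr rfl Int.cast_zero) (fun i j => (hV i j).congr rfl Int.cast_zero)
      (fun c m => eq_zero_of_hom_neg_right) ha0 ha1 ha2 H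
    refine Submodule.mem_sup_left ⟨p, mem_bosonicPoly_of_hom (a := a + 2) (b := 0)
      (hp.congr (by push_cast; ring) Int.cast_zero.symm) (by rw [Int.even_iff] at *; omega), ?_⟩
    rw [weyl_of_hom h (a := a + 2) (hp.congr (by push_cast; ring) rfl) (by omega), funext₂ e,
      funext₂ e']
  · obtain ⟨f, hf, e, e'⟩ := exists_eq_sym (W := polyOps A) hUs hVs hU hV ha0 ha1 ha2
      (by exact_mod_cast (by omega : b ≠ 0)) (by exact_mod_cast (by omega : b + 1 ≠ 0))
      (by exact_mod_cast (by omega : b + 2 ≠ 0)) H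
    rw [funext₂ e, funext₂ e']
    exact Submodule.mem_sup_right (twoForm_sym_mem h (a := a + 1) (b := b - 1)
      (fun i j => (hf i j).congr (by push_cast; ring) (by push_cast; ring)) (by omega)
      (by rw [Int.even_iff] at *; omega))

/-- The forms closed in a bidegree `(b, a)` with `a > b` are exact or Weyl cocycles. -/
lemma twoForm_mem_of_swap_closed (hUs : ∀ i j, U i j = U j i) (hVs : ∀ i j, V i j = V j i)
    (hU : ∀ i j, (polyOps A).Hom b a (U i j)) (hV : ∀ i j, (polyOps A).Hom b a (V i j))
    (hb : 0 ≤ b) (hab : b < a) (he : Even (a - b))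
    (H : ∀ γ φ, (polyOps A).swap.threeForm V U γ φ = 0) :
    twoForm h U V ∈ (bosonicPoly A).map (weyl h) ⊔ coboundaries h 2 := by
  have ha0 : (a : ℂ) ≠ 0 := by exact_mod_cast (by omega : a ≠ 0)
  have ha1 : (a : ℂ) + 1 ≠ 0 := by exact_mod_cast (by omega : a + 1 ≠ 0)
  have ha2 : (a : ℂ) + 2 ≠ 0 := by exact_mod_cast (by omega : a + 2 ≠ 0)
  rcases hb.eq_or_lt with rfl | hb
  · obtain ⟨⟨p, hp, e⟩, e'⟩ := exists_eq_dy_dy (W := (polyOps A).swap) hVs hUs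
      (fun i j => (hV i j).swap.congr rfl Int.cast_zero)
      (fun i j => (hU i j).swap.congr rfl Int.cast_zero)
      (fun c m hm => eq_zero_of_hom_neg_left hm.swap) ha0 ha1 ha2 H
    have hp : (polyOps A).Hom 0 ((a + 2 : ℤ) : ℂ) p := hp.swap.congr rfl (by push_cast; ring)
    refine Submodule.mem_sup_left ⟨p, mem_bosonicPoly_of_hom (a := 0) (b := a + 2)
      (hp.congr Int.cast_zero.symm rfl) (by rw [Int.even_iff] at *; omega), ?_⟩
    rw [weyl_of_hom' h hp (by omega), funext₂ e, funext₂ e']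
    rfl
  · obtain ⟨f, hf, e, e'⟩ := exists_eq_sym (W := (polyOps A).swap) hVs hUs
      (fun i j => (hV i j).swap) (fun i j => (hU i j).swap) ha0 ha1 ha2
      (by exact_mod_cast (by omega : b ≠ 0)) (by exact_mod_cast (by omega : b + 1 ≠ 0))
      (by exact_mod_cast (by omega : b + 2 ≠ 0)) H
    rw [funext₂ e, funext₂ e']
    exact Submodule.mem_sup_right (twoForm_swap_sym_mem h (a := b - 1) (b := a + 1)
      (f := fun i j => f j i)
      (fun i j => (hf j i).swap.congr (by push_cast; ring) (by push_cast; ring)) (by omega)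
      (by rw [Int.even_iff] at *; omega))

/-- The diagonal two-forms are exact or Weyl cocycles. -/
lemma twoForm_mem_of_diagonal (hUs : ∀ i j, U i j = U j i) (hVs : ∀ i j, V i j = V j i)
    (hU : ∀ i j, (polyOps A).Hom b b (U i j)) (hV : ∀ i j, (polyOps A).Hom b b (V i j))
    (hb : 0 ≤ b) : twoForm h U V ∈ (bosonicPoly A).map (weyl h) ⊔ coboundaries h 2 := by
  rcases hb.eq_or_lt with rfl | hb
  -- In bidegree `(0, 0)` the coefficients are second derivatives of polynomials of bidegree `(2,
  -- 0)` and `(0, 2)`; these are the Weyl cocycles of lowest degree.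
  · obtain ⟨p, hp, e⟩ := exists_eq_dy_dy_of_const (W := polyOps A) hUs
      (fun i j => (hU i j).congr Int.cast_zero Int.cast_zero)
      (fun c m hm => eq_zero_of_hom_neg_left hm)
    obtain ⟨q, hq, e'⟩ := exists_eq_dy_dy_of_const (W := (polyOps A).swap) hVs
      (fun i j => (hV i j).swap.congr Int.cast_zero Int.cast_zero)
      (fun c m hm => eq_zero_of_hom_neg_right hm.swap)
    refine Submodule.mem_sup_left ⟨p + q, add_mem
      (mem_bosonicPoly_of_hom (a := 2) (b := 0) (by exact_mod_cast hp) (by decide))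
      (mem_bosonicPoly_of_hom (a := 0) (b := 2) (by exact_mod_cast hq.swap) (by decide)), ?_⟩
    rw [map_add, weyl_of_hom h (a := 2) (by exact_mod_cast hp) two_ne_zero,
      weyl_of_hom' h (b := 2) (by exact_mod_cast hq.swap) two_ne_zero, ← twoForm_add, funext₂ e,
      funext₂ e']
    simp only [add_zero, zero_add]
    rfl
  · obtain ⟨f, f', hf, hf', e, e'⟩ := exists_eq_sym_diagonal (W := polyOps A) hUs hVs hU hV
      (by exact_mod_cast (by omega : b ≠ 0)) (by exact_mod_cast (by omega : b + 1 ≠ 0))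
      (by exact_mod_cast (by omega : b + 2 ≠ 0))
    rw [funext₂ e, funext₂ e', twoForm_add]
    exact Submodule.mem_sup_right (add_mem
      (twoForm_sym_mem h (a := b + 1) (b := b - 1)
        (fun i j => (hf i j).congr (by push_cast; ring) (by push_cast; ring)) (by omega)
        ⟨1, by ring⟩)
      (twoForm_swap_sym_mem h (a := b - 1) (b := b + 1)
        (fun i j => (hf' i j).congr (by push_cast; ring) (by push_cast; ring)) (by omega)
        ⟨-1, by ring⟩))

lemma weyl_sup_coboundaries_le : (bosonicPoly A).map (weyl h) ⊔ coboundaries h 2 ≤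
    ((bosonicPoly A).map (weyl h) ⊔ (diagonalPoly A).map (fronsdalA h) ⊔
      (diagonalPoly A).map (fronsdalB h)) ⊔ coboundaries h 2 :=
  sup_le_sup_right (le_sup_left.trans le_sup_left) _

/-- The forms closed in a pair of bidegrees `(b + 2, b)`, `(b, b + 2)` are sums of Fronsdal
cocycles, Weyl cocycles and exact forms. -/
lemma twoForm_add_mem_of_closed_pair {U' V' : Fin 2 → Fin 2 → SpinorPoly A}
    (hUs : ∀ i j, U i j = U j i) (hVs : ∀ i j, V i j = V j i)
    (hUs' : ∀ i j, U' i j = U' j i) (hVs' : ∀ i j, V' i j = V' j i)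
    (hU : ∀ i j, (polyOps A).Hom ((b + 2 : ℤ) : ℂ) b (U i j))
    (hV : ∀ i j, (polyOps A).Hom ((b + 2 : ℤ) : ℂ) b (V i j))
    (hU' : ∀ i j, (polyOps A).Hom b ((b + 2 : ℤ) : ℂ) (U' i j))
    (hV' : ∀ i j, (polyOps A).Hom b ((b + 2 : ℤ) : ℂ) (V' i j)) (hb : 0 ≤ b)
    (H : ∀ γ φ, (polyOps A).threeForm U V γ φ - (polyOps A).swap.threeForm V' U' φ γ = 0) :
    twoForm h U V + twoForm h U' V' ∈
      ((bosonicPoly A).map (weyl h) ⊔ (diagonalPoly A).map (fronsdalA h) ⊔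
        (diagonalPoly A).map (fronsdalB h)) ⊔ coboundaries h 2 := by
  have he : Even (b + 2 - b) := ⟨1, by ring⟩
  have i1 : (((b + 1 : ℤ) : ℂ) + 1) = ((b + 2 : ℤ) : ℂ) := by push_cast; ring
  have i2 : (((b + 1 : ℤ) : ℂ) - 1) = b := by push_cast; ring
  obtain ⟨p, q, hp, hq, e1, e2⟩ := exists_fronsdal (W := polyOps A) (n := ((b + 1 : ℤ) : ℂ))
    (fun i j => (hV i j).congr i1.symm i2.symm) (fun i j => (hU i j).congr i1.symm i2.symm)
    (fun i j => (hU' i j).congr i2.symm i1.symm) (fun i j => (hV' i j).congr i2.symm i1.symm)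
    (by exact_mod_cast (by omega : b + 1 ≠ 0)) (by exact_mod_cast (by omega : b + 1 + 1 ≠ 0))
    (by exact_mod_cast (by omega : b + 1 + 2 ≠ 0)) H
  rw [i1] at hp
  rw [i2] at hq
  have i3 : ((b + 2 : ℤ) : ℂ) - 1 - 1 = b := by push_cast; ring
  have i4 : (b : ℂ) + 1 + 1 = ((b + 2 : ℤ) : ℂ) := by push_cast; ring
  -- With the Fronsdal part subtracted, each of the two bidegrees is closed by itself and falls
  -- under the uncoupled case.
  have m1 := twoForm_mem_of_closed h (a := b + 2) (b := b)
    (fun i j => by rw [hUs, (polyOps A).yt_comm]) (fun i j => by rw [hVs, (polyOps A).dz_dz])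
    (fun i j => (hU i j).sub (((hq.yt j).yt i).congr i4 rfl))
    (fun i j => (hV i j).sub (((hp.dz j).dz i).congr rfl i3)) hb (by omega) he e1
  have m2 := twoForm_mem_of_swap_closed h (a := b + 2) (b := b)
    (fun i j => by rw [hUs', (polyOps A).dy_dy]) (fun i j => by rw [hVs', zt_comm])
    (fun i j => (hU' i j).sub (((hp.dy j).dy i).congr i3 rfl))
    (fun i j => (hV' i j).sub (((hq.zt j).zt i).congr rfl i4)) hb (by omega) he
    fun γ φ => e2 φ γ
  have m3 : fronsdalA h p + fronsdalB h q ∈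
      ((bosonicPoly A).map (weyl h) ⊔ (diagonalPoly A).map (fronsdalA h) ⊔
        (diagonalPoly A).map (fronsdalB h)) := add_mem
    (Submodule.mem_sup_left (Submodule.mem_sup_right ⟨p, mem_diagonalPoly_of_hom hp, rfl⟩))
    (Submodule.mem_sup_right ⟨q, mem_diagonalPoly_of_hom hq, rfl⟩)
  have m4 := add_mem (weyl_sup_coboundaries_le h (add_mem m1 m2))
    (Submodule.mem_sup_left (T := coboundaries h 2) m3)
  convert m4 using 1
  rw [fronsdalA_eq, fronsdalB_eq, twoForm_sub, twoForm_sub]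
  simp only [twoForm, Finset.sum_add_distrib]
  abel

/-- The distance `a - b` from the diagonal decides: at `0` closedness is automatic, at `2` the
mirror components share a target, and from `4` on they decouple. -/
lemma cocycles_two_le : cocycles h 2 ≤
    ((bosonicPoly A).map (weyl h) ⊔ (diagonalPoly A).map (fronsdalA h) ⊔
      (diagonalPoly A).map (fronsdalB h)) ⊔ coboundaries h 2 := by
  have hW := weyl_sup_coboundaries_le h
  rintro ω hω
  obtain ⟨U, V, hU, hV, hUs, hVs, rfl⟩ := exists_twoForm h hω.1
  have hcl := (twoForm_mem_cocycles_iff h hU hV hUs hVs).1 hω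
  refine mem_of_formProj_add fun a b hb hab => ?_
  rw [formProj_twoForm, formProj_twoForm]
  have hUs' : ∀ a b i j, homProj A a b (U i j) = homProj A a b (U j i) :=
    fun a b i j => by rw [hUs]
  have hVs' : ∀ a b i j, homProj A a b (V i j) = homProj A a b (V j i) :=
    fun a b i j => by rw [hVs]
  by_cases he : Even (a - b)
  swap
  · have he' : ¬ Even (b - a) := by rwa [← neg_sub, even_neg]
    simp only [homProj_bosonic (hU _ _) he, homProj_bosonic (hU _ _) he',
      homProj_bosonic (hV _ _) he, homProj_bosonic (hV _ _) he']
    simp [twoForm]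
  rcases hab.eq_or_lt with rfl | hlt
  · have := hW (twoForm_mem_of_diagonal h (hUs' b b) (hVs' b b) (fun _ _ => homProj_hom _ _ _)
      (fun _ _ => homProj_hom _ _ _) hb)
    exact add_mem this this
  by_cases hab2 : a = b + 2
  · subst hab2
    have hc := hcl (b + 1) (b + 1)
    simp only [if_pos (show b + 1 < b + 1 + 2 by omega), add_sub_cancel_right,
      show b + 1 + 1 = b + 2 by ring] at hc
    exact twoForm_add_mem_of_closed_pair h (hUs' _ _) (hVs' _ _) (hUs' _ _) (hVs' _ _)
      (fun _ _ => homProj_hom _ _ _) (fun _ _ => homProj_hom _ _ _) (fun _ _ => homProj_hom _ _ _)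
      (fun _ _ => homProj_hom _ _ _) hb hc
  · have hab4 : b + 4 ≤ a := by obtain ⟨c, hc⟩ := he; omega
    refine add_mem (hW (twoForm_mem_of_closed h (hUs' a b) (hVs' a b)
      (fun _ _ => homProj_hom _ _ _) (fun _ _ => homProj_hom _ _ _) hb hlt he fun γ φ => ?_))
      (hW (twoForm_mem_of_swap_closed h (hUs' b a) (hVs' b a)
      (fun _ _ => homProj_hom _ _ _) (fun _ _ => homProj_hom _ _ _) hb hlt he fun γ φ => ?_))
    · have := hcl (a - 1) (b + 1) γ φ
      simp only [if_pos (show b + 1 < a - 1 + 2 by omega), sub_add_cancel, add_sub_cancel_right,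
        if_neg (show ¬ a - 1 < b + 1 + 2 by omega), threeForm_zero, sub_zero] at this
      exact this
    · have := hcl (b + 1) (a - 1) φ γ
      simp only [if_pos (show b + 1 < a - 1 + 2 by omega), sub_add_cancel, add_sub_cancel_right,
        if_neg (show ¬ a - 1 < b + 1 + 2 by omega), threeForm_zero, zero_sub, neg_eq_zero] at this
      exact this

theorem represents_two : Represents h 2 ((bosonicPoly A).map (weyl h) ⊔
    (diagonalPoly A).map (fronsdalA h) ⊔ (diagonalPoly A).map (fronsdalB h)) := by
  refine represents_of h (sup_le (sup_le ?_ ?_) ?_) (cocycles_two_le h) ?_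
  · rintro _ ⟨C, hC, rfl⟩
    exact weyl_mem_cocycles h hC
  · rintro _ ⟨p, hp, rfl⟩
    simpa using fronsdal_mem_cocycles h hp (zero_mem _)
  · rintro _ ⟨q, hq, rfl⟩
    simpa using fronsdal_mem_cocycles h (zero_mem _) hq
  · intro r hr hb
    obtain ⟨_, hr', _, ⟨q, hq, rfl⟩, rfl⟩ := Submodule.mem_sup.1 hr
    obtain ⟨_, ⟨C, -, rfl⟩, _, ⟨p, hp, rfl⟩, rfl⟩ := Submodule.mem_sup.1 hr'
    obtain ⟨ω, hω, e⟩ := hb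
    obtain ⟨f, hf, rfl⟩ := exists_oneForm h hω
    obtain ⟨e1, e2, e3⟩ := weyl_add_fronsdal_eq_zero h (C := C) hp hq hf
      (by rw [e, add_assoc])
    rw [e1, e2, e3, add_zero, add_zero]

end Two
end
end HigherSpin

theorem mainTheorem3 {A : Type*} [CommRing A] [Algebra ℂ A]
    {L : Type*} [AddCommGroup L] [Module A L] (h : Module.Basis (Fin 2 × Fin 2) A L) :
    (∀ p, HigherSpin.coboundaries h p ≤ HigherSpin.cocycles h p) ∧
    HigherSpin.Represents h 0 (HigherSpin.diagonalMultispinors A L) ∧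
    (HigherSpin.Represents h 1
        ((HigherSpin.diagonalPoly A).map (HigherSpin.phi h) ⊔
          (HigherSpin.diagonalPoly A).map (HigherSpin.phiTr h)) ∧
      Disjoint ((HigherSpin.diagonalPoly A).map (HigherSpin.phi h))
        ((HigherSpin.diagonalPoly A).map (HigherSpin.phiTr h))) ∧
    (HigherSpin.Represents h 2
        ((HigherSpin.bosonicPoly A).map (HigherSpin.weyl h) ⊔
          (HigherSpin.diagonalPoly A).map (HigherSpin.fronsdalA h) ⊔
          (HigherSpin.diagonalPoly A).map (HigherSpin.fronsdalB h)) ∧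
      iSupIndep ![(HigherSpin.bosonicPoly A).map (HigherSpin.weyl h),
        (HigherSpin.diagonalPoly A).map (HigherSpin.fronsdalA h),
        (HigherSpin.diagonalPoly A).map (HigherSpin.fronsdalB h)]) :=
  ⟨HigherSpin.coboundaries_le_cocycles h, HigherSpin.represents_zero h,
    ⟨HigherSpin.represents_one h, HigherSpin.disjoint_phi_phiTr h⟩,
    HigherSpin.represents_two h, HigherSpin.iSupIndep_weyl_fronsdal h⟩
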